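/- Fix $q=252$, $\theta=3q+1$, $m=\theta+1$. There is $\tau_0>0$ such that the following holds for every $0<\tau<\tau_0$, every integer $r\ge m+5q$ and all constants $\eta,K,\lambda_0,c>0$, $D_0,B\ge 1$. **Setting.** Let $U\subset\mathbb R^2$ be open, convex and bounded, and let $N'(\varphi,I,t)=H_0'(I)+R(\varphi,I,t)$ on $\mathbb T^2\times U\times\mathbb T$ be in Pöschel normal form: with $s=\lfloor 3r-2\tau\rfloor$, $H_0'$ and $R$ are of class $C^{s}$, $\|H_0'\|_{C^{s}(U)}\le K$, $D_0^{-1}\mathrm{Id}\le\partial_I^2H_0'\le D_0\,\mathrm{Id}$, and, for some $0<\varepsilon\le 1$, $R$ vanishes on $E=\{(\varphi,I,t):\Omega(I)\in\mathcal D^U\}$ and satisfies $$\|R\|_{C^j(U_\lambda(E))}\le K\varepsilon\lambda^{3r-2\tau-j}\qquad(0<\lambda\le\lambda_0,\ 0\le j\le s).$$ Here $\Omega=\partial_IH_0'$, $U_\lambda(E)$ is the $\lambda$-neighbourhood of $E$ (in the phase space), and $\mathcal D^U$ is the set of $\omega$ such that the $\eta$-ball around $\omega$ lies in $\Omega(U)$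 and $|k\cdot(\omega,1)|\ge\eta|k|^{-2-\tau}$ for all $k\in(\mathbb Z^2\setminus 0)\times\mathbb Z$. Let $R_{n+1}=R_n^{1+2\tau}$ and $\rho_n=R_n^{-(3-5\tau)}$. A Dirichlet resonant segment of generation $n\ge1$ is a segment $\mathcal S=\mathcal S_{k_n}^{\omega_n}\subset\{\omega:k_n\cdot(\omega,1)=0\}$ with $k_n\in(\mathbb Z^2\setminus0)\times\mathbb Z$, $R_n/4\le|k_n|\le R_n$, $\omega_n\in\mathcal D^U$, $\eta R_n^{-(2+\tau)}\le|k_n\cdot(\omega_n,1)|\le R_n^{-(2-3\tau)}$, $\mathcal S\cap B_{\rho_n}(\omega_n)\ne\emptyset$, and $\mathcal S\subset B_{3\rho_{n-1}}(\omega_{n-1})$ for some $\omega_{n-1}\in\mathcal D^U$. Put $\mathcal I=\{I\in U:\Omega(I)\in\mathcal S\}$. A point $I_0\in\mathcal I$ with $k'\cdot(\Omega(I_0),1)=0$, where the first two components of $k_n$ and $k'$ are linearly independent, is a $\theta$-strong double resonance if the lattice generated by $k_n,k'$ contains a vector $k''\notin\mathbb Z k_n$ with $|k''|\le|k_n|^\theta$.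 Let $I_1,I_2\in\mathcal I$ be two consecutive $\theta$-strong double resonances, corresponding to $k'$ and $k''$; let $\mu_n$ satisfy $B^{-1}\le\mu_n\,\rho_n^{-(2\theta-1)\frac{1+2\tau}{3-5\tau}}\le B$, and let $$\mathrm{Sr}_n=\mathbb T^2\times\Big\{I\in\mathcal A_1\cup\mathcal A_2:\ \mathrm{dist}(I,\mathcal I)\le c\rho_n^{m+\frac13\theta+1}\Big\}\times\mathbb T,\qquad \mathcal A_i=\{I\in U:\ c\rho_n^m\le|I-I_i|\le\mu_n\},$$ be the single resonance zone. **Claim.** There are $C,D\ge1$ and $R_*>1$, depending only on $\tau,r,\eta,D_0,K,\lambda_0,c,B$ (so not on $U$, $N'$, $\varepsilon$, $R_0$, $n$, $\rho_n$ or the segment), such that for all $R_0\ge R_*$ and all data as above there are an open set $W\subset U$ and a time-preserving symplectic change of coordinates $\Phi_n$ of class $C^2$ on $V=\mathbb T^2\times W\times\mathbb T$ (a diffeomorphism onto its image in $\mathbb T^2\times U\times\mathbb T$; symplectic in the extended phase space, where it acts by $(x,E)\mapsto(\Phi_n(x),E+e(x))$, with $E$ conjugate to $t$) with $\mathrm{Sr}_n\subset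 V$ and $\mathrm{Sr}_n\subset\Phi_n(V)$, such that $N'$ is transformed into $$N'\circ\Phi_n(\psi,J,t)+e(\psi,J,t)=\mathcal H_0^{k_n}(J)+\mathcal Z^{k_n}(k_n\cdot(\psi,t),J)+\mathcal R^{k_n}(\psi,J,t)\quad\text{on }V,$$ all terms being $C^2$, $\mathcal R^{k_n}$ being $1$-periodic in $\psi_1,\psi_2,t$ and $\mathcal Z^{k_n}$ being $\gcd(k_n)$-periodic in its first argument, with: 1. $\mathcal H_0^{k_n}=H_0'$ on $W$, and $D^{-1}\mathrm{Id}\le\partial_J^2\mathcal H_0^{k_n}\le D\,\mathrm{Id}$; 2. on $V$ (in particular on $\Phi_n^{-1}(\mathrm{Sr}_n)$) the function $\mathcal Z^{k_n}(k_n\cdot(\psi,t),J)$ has $C^2$ norm at most $C\rho_n^{\frac43r-2m}$, and $\|\mathcal R^{k_n}\|_{C^2}\le C\rho_n^{q(r+1)-2m}$; 3. $\|\Phi_n-\mathrm{Id}\|_{C^1}\le C\rho_n^{2r-2m}$ on $V$ (including the component $e$); 4. in the rescaled variables $I=I_1+\rho_n^m\tilde I$, $J=I_1+\rho_n^m\tilde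 J$, $E=\rho_n^m\tilde E$ one has, on the rescaled $V$, $\|\mathcal Z^{k_n}\|_{C^2}\le C\rho_n^{\frac43r}$, $\|\mathcal R^{k_n}\|_{C^2}\le C\rho_n^{q(r+1)}$ and $\|\Phi_n-\mathrm{Id}\|_{C^1}\le C\rho_n^{r-\frac m2}$. -/

import Mathlib

open Set

noncomputable section

namespace SRNF

/-! ### Constants -/

/-- `q = 252`. -/
def qPar : ℕ := 252

/-- `θ = 3 q + 1`. -/
def thetaPar : ℕ := 3 * qPar + 1

/-- `m = θ + 1`. -/
def mPar : ℕ := thetaPar + 1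

/-! ### Spaces -/

/-- Actions `I = (I₁, I₂)`, and also frequencies `ω = (ω₁, ω₂)`. -/
abbrev Act := EuclideanSpace ℝ (Fin 2)

/-- Lifts to `ℝ³` of the angles `(φ₁, φ₂, t) ∈ 𝕋² × 𝕋`. -/
abbrev Ang := EuclideanSpace ℝ (Fin 3)

/-- (The universal cover in the angles of) the phase space, with points `((φ₁, φ₂, t), I)`. -/
abbrev Base := Ang × Act

/-- The extended phase space, with points `(((φ₁, φ₂, t), I), E)`, `E` being conjugate to `t`. -/
abbrev Ext := Base × ℝ

/-- Integer vectors, as translations of the angles. -/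
def intVec (l : Fin 3 → ℤ) : Ang := WithLp.toLp 2 (fun i => (l i : ℝ))

/-- `‖f‖_{C^k(S)} ≤ B`: all derivatives of order `0, …, k` are bounded by `B` on `S`. It is used for
`f` of class `C^k` on an open set containing `S`. -/
def CkNormLE {E F : Type*} [NormedAddCommGroup E] [NormedSpace ℝ E]
    [NormedAddCommGroup F] [NormedSpace ℝ F] (k : ℕ) (f : E → F) (S : Set E) (B : ℝ) : Prop :=
  ∀ i : ℕ, i ≤ k → ∀ x ∈ S, ‖iteratedFDeriv ℝ i f x‖ ≤ B

/-- `D⁻¹ Id ≤ ∂²H ≤ D Id` on `S`. -/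
def HessianBounds (H : Act → ℝ) (S : Set Act) (D : ℝ) : Prop :=
  ∀ I ∈ S, ∀ v : Act, D⁻¹ * ‖v‖ ^ 2 ≤ iteratedFDeriv ℝ 2 H I ![v, v] ∧
    iteratedFDeriv ℝ 2 H I ![v, v] ≤ D * ‖v‖ ^ 2

/-! ### Resonances and Diophantine frequencies -/

/-- The Euclidean length of an integer vector. -/
def len (k : Fin 3 → ℤ) : ℝ := Real.sqrt (∑ i, (k i : ℝ) ^ 2)

/-- `k ∈ (ℤ² \ {0}) × ℤ`. -/
def IsResVec (k : Fin 3 → ℤ) : Prop := k 0 ≠ 0 ∨ k 1 ≠ 0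

/-- `k · (ω, 1)`. -/
def kdot (k : Fin 3 → ℤ) (ω : Act) : ℝ := k 0 * ω 0 + k 1 * ω 1 + k 2

/-- `k · (φ₁, φ₂, t)`. -/
def slow (k : Fin 3 → ℤ) (φ : Ang) : ℝ := ∑ i, (k i : ℝ) * φ i

/-- The `(η, τ)`-Diophantine frequencies. -/
def Dioph (η τ : ℝ) : Set Act :=
  {ω | ∀ k : Fin 3 → ℤ, IsResVec k → η * len k ^ (-(2 + τ)) ≤ |kdot k ω|}

/-- The frequencies in the frequency domain `U' = ∇H(U)` whose `η`-neighbourhood is contained in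
`U'` and which are `(η, τ)`-Diophantine. -/
def DiophU (U : Set Act) (H : Act → ℝ) (η τ : ℝ) : Set Act :=
  {ω | ω ∈ Dioph η τ ∧ Metric.ball ω η ⊆ gradient H '' U}

/-- The sequence `R₀`, `R_{n+1} = R_n^{1+2τ}`. -/
def Rgen (τ R₀ : ℝ) : ℕ → ℝ
  | 0 => R₀
  | n + 1 => Rgen τ R₀ n ^ (1 + 2 * τ)

/-- The sequence `ρ_n = R_n^{-(3-5τ)}`. -/
def rho (τ R₀ : ℝ) (n : ℕ) : ℝ := Rgen τ R₀ n ^ (-(3 - 5 * τ))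

/-! ### Hamiltonians in Pöschel normal form -/

/-- The actions in `U` at distance less than `lam` from an action with frequency in
`D^U_{η,τ}`. -/
def nearDioph (U : Set Act) (H : Act → ℝ) (η τ lam : ℝ) : Set Act :=
  {I | I ∈ U ∧ ∃ I' ∈ U, gradient H I' ∈ DiophU U H η τ ∧ dist I I' < lam}

/-- `N'(φ, I, t) = H(I) + R(φ, I, t)` is in Pöschel normal form on `𝕋² × U × 𝕋`: `H` is strictly
convex, and `R` vanishes on the set of Diophantine tori and is flat there, with the bounds
`‖R‖_{C^j} ≤ K ε λ^{3r-2τ-j}` on the `λ`-neighbourhood of that set. -/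
structure IsPoschelNormalForm (U : Set Act) (r : ℕ) (η τ ε D K lam₀ : ℝ)
    (H : Act → ℝ) (R : Base → ℝ) : Prop where
  isOpen : IsOpen U
  convex : Convex ℝ U
  bounded : Bornology.IsBounded U
  eps_pos : 0 < ε
  eps_le : ε ≤ 1
  smooth_H : ContDiffOn ℝ (⌊3 * (r : ℝ) - 2 * τ⌋₊ : ℕ) H U
  bound_H : CkNormLE ⌊3 * (r : ℝ) - 2 * τ⌋₊ H U K
  hessian_H : HessianBounds H U D
  smooth_R : ContDiffOn ℝ (⌊3 * (r : ℝ) - 2 * τ⌋₊ : ℕ) R (univ ×ˢ U)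
  periodic_R : ∀ (φ : Ang) (I : Act) (l : Fin 3 → ℤ), I ∈ U → R (φ + intVec l, I) = R (φ, I)
  vanish_R : ∀ (φ : Ang) (I : Act), I ∈ U → gradient H I ∈ DiophU U H η τ → R (φ, I) = 0
  bound_R : ∀ lam : ℝ, 0 < lam → lam ≤ lam₀ → ∀ j : ℕ, j ≤ ⌊3 * (r : ℝ) - 2 * τ⌋₊ →
    CkNormLE j R (univ ×ˢ nearDioph U H η τ lam) (K * ε * lam ^ (3 * (r : ℝ) - 2 * τ - j))

/-! ### Dirichlet resonant segments and single resonance zones -/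

/-- `S = S_{k}^{ω}` is a Dirichlet resonant segment of generation `n ≥ 1`, with resonant vector
`k = k_n`, attached to the Diophantine frequency `ω = ω_n`, near the frequency `ω' = ω_{n-1}` of
the previous generation. -/
structure IsDirichletSegment (U : Set Act) (H : Act → ℝ) (η τ R₀ : ℝ) (n : ℕ)
    (k : Fin 3 → ℤ) (ω ω' : Act) (S : Set Act) : Prop where
  one_le : 1 ≤ n
  isResVec : IsResVec k
  le_len : Rgen τ R₀ n / 4 ≤ len k
  len_le : len k ≤ Rgen τ R₀ n
  mem : ω ∈ DiophU U H η τ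
  mem' : ω' ∈ DiophU U H η τ
  lower : η * Rgen τ R₀ n ^ (-(2 + τ)) ≤ |kdot k ω|
  upper : |kdot k ω| ≤ Rgen τ R₀ n ^ (-(2 - 3 * τ))
  isSegment : ∃ a b : Act, S = segment ℝ a b
  resonant : ∀ x ∈ S, kdot k x = 0
  near : (S ∩ Metric.ball ω (rho τ R₀ n)).Nonempty
  subset_ball : S ⊆ Metric.ball ω' (3 * rho τ R₀ (n - 1))

/-- The resonant segment in action space. -/
def actSegment (U : Set Act) (H : Act → ℝ) (S : Set Act) : Set Act :=
  {I | I ∈ U ∧ gradient H I ∈ S}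

/-- The frequency `ω` is the (single) intersection point of the resonant lines of `k` and `k'`, and
this double resonance is `θ`-strong: the lattice generated by `k` and `k'` contains a vector
outside `ℤ k` of length at most `|k|^θ`. -/
def IsStrongDR (k k' : Fin 3 → ℤ) (ω : Act) : Prop :=
  k 0 * k' 1 - k 1 * k' 0 ≠ 0 ∧ kdot k ω = 0 ∧ kdot k' ω = 0 ∧
    ∃ k'' : Fin 3 → ℤ, k'' ∈ AddSubgroup.closure {k, k'} ∧ k'' ∉ AddSubgroup.zmultiples k ∧
      len k'' ≤ len k ^ thetaPar

/-- `I₁` and `I₂` are two consecutive `θ`-strong double resonances on the resonant segment `S`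
of `k`, corresponding to `(k, k₁)` and `(k, k₂)`. -/
def AreConsecutiveStrongDR (U : Set Act) (H : Act → ℝ) (S : Set Act) (k k₁ k₂ : Fin 3 → ℤ)
    (I₁ I₂ : Act) : Prop :=
  I₁ ∈ actSegment U H S ∧ I₂ ∈ actSegment U H S ∧ I₁ ≠ I₂ ∧
    IsStrongDR k k₁ (gradient H I₁) ∧ IsStrongDR k k₂ (gradient H I₂) ∧
    ∀ x ∈ openSegment ℝ (gradient H I₁) (gradient H I₂), ¬ ∃ k₃ : Fin 3 → ℤ, IsStrongDR k k₃ x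

/-- The annulus around the core of a double resonance. -/
def annulus (U : Set Act) (c ρ μ : ℝ) (I₀ : Act) : Set Act :=
  {I | I ∈ U ∧ c * ρ ^ mPar ≤ dist I I₀ ∧ dist I I₀ ≤ μ}

/-- The actions of the single resonance zone between the double resonances `I₁` and `I₂`. -/
def zoneActions (U : Set Act) (H : Act → ℝ) (S : Set Act) (c ρ μ : ℝ) (I₁ I₂ : Act) : Set Act :=
  {I | I ∈ annulus U c ρ μ I₁ ∪ annulus U c ρ μ I₂ ∧
    Metric.infDist I (actSegment U H S) ≤ c * ρ ^ ((mPar : ℝ) + (thetaPar : ℝ) / 3 + 1)}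

/-- The single resonance zone `Sr_n(k, k₁, k₂)` in the phase space. -/
def zone (U : Set Act) (H : Act → ℝ) (S : Set Act) (c ρ μ : ℝ) (I₁ I₂ : Act) : Set Base :=
  univ ×ˢ zoneActions U H S c ρ μ I₁ I₂

/-! ### Time-dependent symplectic changes of coordinates -/

/-- The symplectic form `dI ∧ dφ + dE ∧ dt` on the extended phase space. -/
def sympForm (u v : Ext) : ℝ :=
  (u.1.2 0 * v.1.1 0 - v.1.2 0 * u.1.1 0) + (u.1.2 1 * v.1.1 1 - v.1.2 1 * u.1.1 1) +
    (u.2 * v.1.1 2 - v.2 * u.1.1 2)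

/-- The extension `(x, E) ↦ (Φ x, E + e x)` of `Φ` to the extended phase space. -/
def extMap (Φ : Base → Base) (e : Base → ℝ) (z : Ext) : Ext := (Φ z.1, z.2 + e z.1)

/-- `Φ` is a symplectic change of coordinates on `𝕋² × W × 𝕋` (a time-preserving diffeomorphism
onto its image, given by its lift, whose extension by the energy shift `e` is symplectic). -/
structure IsSymplecticChange (W : Set Act) (Φ : Base → Base) (e : Base → ℝ) : Prop where
  smooth : ContDiffOn ℝ 2 Φ (univ ×ˢ W)
  smooth_e : ContDiffOn ℝ 2 e (univ ×ˢ W)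
  injOn : InjOn Φ (univ ×ˢ W)
  equivariant : ∀ (φ : Ang) (I : Act) (l : Fin 3 → ℤ), I ∈ W →
    Φ (φ + intVec l, I) = Φ (φ, I) + (intVec l, 0)
  periodic_e : ∀ (φ : Ang) (I : Act) (l : Fin 3 → ℤ), I ∈ W → e (φ + intVec l, I) = e (φ, I)
  time : ∀ x : Base, x.2 ∈ W → (Φ x).1 2 = x.1 2
  symplectic : ∀ z : Ext, z.1.2 ∈ W → ∀ u v : Ext,
    sympForm (fderiv ℝ (extMap Φ e) z u) (fderiv ℝ (extMap Φ e) z v) = sympForm u v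

/-- The displacement `Φ - Id`, including the displacement of the energy variable. -/
def displacement (Φ : Base → Base) (e : Base → ℝ) (x : Base) : Ext := (Φ x - x, e x)

/-- The function `(ψ, J, t) ↦ Z(k · (ψ, t), J)`. -/
def onSlow (k : Fin 3 → ℤ) (Z : ℝ → Act → ℝ) (x : Base) : ℝ := Z (slow k x.1) x.2

/-- The rescaling `(φ, J) ↦ (φ, I₀ + s J)` of the actions. -/
def rescale (s : ℝ) (I₀ : Act) (x : Base) : Base := (x.1, I₀ + s • x.2)

/-- The displacement of the change of coordinates `Φ` written in the rescaled variables
(`I = I₀ + s J` and `E ↦ s E`). -/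
def rescaledDisplacement (s : ℝ) (I₀ : Act) (Φ : Base → Base) (e : Base → ℝ) (x : Base) : Ext :=
  (((displacement Φ e (rescale s I₀ x)).1.1, s⁻¹ • (displacement Φ e (rescale s I₀ x)).1.2),
    s⁻¹ * (displacement Φ e (rescale s I₀ x)).2)

end SRNF

end

/-!
The change of coordinates is given by one generating function `J · φ + χ(φ, J)`, with
`I = J + ∂_φ χ`, `ψ = φ + ∂_J χ` and energy shift `∂_t χ`. It carries `H + R` to
`H + z + (remainder)` exactly when the defect `hjDefect` of the Hamilton-Jacobi equation is the
remainder written in the mixed variables `(φ, J)`. So it is enough to find `χ` and a function `z` of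
the slow angle `k · (φ, t)` for which the defect is tiny. The coordinate change is then recovered
by inverting `φ ↦ φ + ∂_J χ` (`GenFun.exists_isMixedCoord`, `GenFun.isSymplecticChange`,
`exists_normalForm_of_hamiltonJacobi`). No composition of coordinate changes is needed, and the
integrable part stays equal to `H`.

The pair `(χ, z)` is built by an iteration with finitely many steps. Each step solves the
homological equation for the current defect (`exists_homological_solution`): the Fourier series in
the three angles is truncated to a box of size `M`, the harmonics that are rational multiples of `k`
are put into `z`, and the other ones are divided by their divisors `k' · (Ω, 1)`. The new defect is
the Fourier tail, together with the terms in which the correction meets `χ`, `z`, `R` or itself, so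
that it gains a fixed small factor (`IterStage.step`, `exists_iterStage`). Estimates are in the
weighted norms `DBd`, where a derivative costs a factor `Λ`; a step costs one derivative.

The divisors are controlled by the geometry of the zone. Let `ω₀` be one of the two strong double
resonances, with `k''` a short second resonant vector, and let `k'` not be a multiple of `k`. The
integer `det (k, k'', k')` equals a nonzero minor times `k' · (ω₀, 1)`. If it is not zero, then
`|k' · (ω₀, 1)| ≥ 1 / (|k| |k''|)`, and this survives on the zone, which lies within `μ` of the
double resonance. If it is zero, then `k'` is resonant at `ω₀` too, and along the resonant line
of `k` its divisor grows linearly with the distance from `ω₀`, which is at least of order `ρ ^ m`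
on the zone (`divisor_dichotomy`, `le_divisor_of_mem_thickening`).

The perturbation is small because the segment lies in a ball of radius `3 ρ_{n-1}` about a
Diophantine frequency `ω_{n-1}`. By strict convexity the zone is within `5 D ρ_{n-1}` of the
corresponding torus, and Pöschel's flatness estimate applies at that distance. A neighbourhood of
the zone lies in the domain `U` since the frequency map is bi-Lipschitz and its image contains the
`η`-ball about `ω_{n-1}` (`ball_subset_of_ball_subset_image`).

Sizes are compared as powers of the order of resonance `X = R_n`: `ρ_{n-1} ≈ X ^ (-3)`,
`ρ_n ≈ X ^ (-3)` with exponents that differ by `O(τ)`, `M ≈ X ^ 400`, divisors at least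
`X ^ (-2276)` on a neighbourhood of the zone of width comparable to `X ^ (-2680)`, and
`R ≤ X ^ (-(8 r + 1000))`. In actions rescaled by `X ^ (-2680)` one step gains `X ^ (8647 - 8 r)`.
As `r ≥ 2018`, 300 steps, leaving about `3 r - 300` derivatives for the Fourier tail, bring the
remainder below `ρ_n ^ (q (r + 1))`, while `χ` and `z` remain of the size of `R` up to a fixed power
of `X` (`exists_normalForm_of_scaleData`, `IsPoschelNormalForm.scaleData`). A lower bound on `X`
absorbs all constants, so that the estimates hold with `C = 1` and `D = D₀`.
-/

noncomputable section

namespace SRNF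

/-! ### Weighted derivative bounds -/

section DerivBounds

variable {E E' F G : Type} [NormedAddCommGroup E] [NormedSpace ℝ E]
  [NormedAddCommGroup E'] [NormedSpace ℝ E']
  [NormedAddCommGroup F] [NormedSpace ℝ F] [NormedAddCommGroup G] [NormedSpace ℝ G]

/-- `f` is of class `C^p` on `S` and its derivatives satisfy `‖D^i f‖ ≤ B Λ^i` there: each
derivative costs a factor `Λ`. -/
def DBd (S : Set E) (Λ : ℝ) (p : ℕ) (B : ℝ) (f : E → F) : Prop :=
  ContDiffOn ℝ p f S ∧ ∀ i ≤ p, ∀ x ∈ S, ‖iteratedFDeriv ℝ i f x‖ ≤ B * Λ ^ i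

variable {S S' : Set E} {Λ : ℝ} {p q : ℕ} {B B' : ℝ} {f g : E → F}

theorem DBd.norm_le (h : DBd S Λ p B f) {x : E} (hx : x ∈ S) : ‖f x‖ ≤ B := by
  simpa using h.2 0 (Nat.zero_le _) x hx

theorem DBd.mono_order (h : DBd S Λ p B f) (hq : q ≤ p) : DBd S Λ q B f :=
  ⟨h.1.of_le (by exact_mod_cast hq), fun i hi => h.2 i (hi.trans hq)⟩

theorem DBd.mono_bound (h : DBd S Λ p B f) (hΛ : 0 ≤ Λ) (hB : B ≤ B') : DBd S Λ p B' f :=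
  ⟨h.1, fun i hi x hx => (h.2 i hi x hx).trans
    (mul_le_mul_of_nonneg_right hB (pow_nonneg hΛ i))⟩

theorem DBd.mono_set (h : DBd S Λ p B f) (hS : S' ⊆ S) : DBd S' Λ p B f :=
  ⟨h.1.mono hS, fun i hi x hx => h.2 i hi x (hS hx)⟩

theorem DBd.congr (h : DBd S Λ p B f) (hS : IsOpen S) (hfg : EqOn g f S) : DBd S Λ p B g := by
  refine ⟨h.1.congr hfg, fun i hi x hx => ?_⟩
  have : g =ᶠ[nhds x] f := Filter.eventuallyEq_of_mem (hS.mem_nhds hx) hfg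
  rw [(this.iteratedFDeriv ℝ i).eq_of_nhds]
  exact h.2 i hi x hx

theorem DBd.contDiffAt (h : DBd S Λ p B f) (hS : IsOpen S) {x : E} (hx : x ∈ S) :
    ContDiffAt ℝ p f x := h.1.contDiffAt (hS.mem_nhds hx)

theorem DBd.differentiableAt (h : DBd S Λ p B f) (hS : IsOpen S) (hp : p ≠ 0) {x : E}
    (hx : x ∈ S) : DifferentiableAt ℝ f x :=
  (h.contDiffAt hS hx).differentiableAt (by exact_mod_cast hp)

theorem dBd_zero_iff : DBd S Λ 0 B f ↔ ContinuousOn f S ∧ ∀ x ∈ S, ‖f x‖ ≤ B := by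
  simp [DBd, contDiffOn_zero]

/-- The recursion by which weighted bounds are proved: bound the function, and bound its derivative
to one order less with `B Λ` in place of `B`. -/
theorem dBd_succ_iff (hS : IsOpen S) :
    DBd S Λ (p + 1) B f ↔ DifferentiableOn ℝ f S ∧ (∀ x ∈ S, ‖f x‖ ≤ B) ∧
      DBd S Λ p (B * Λ) (fderiv ℝ f) := by
  have key : ∀ i x, ‖iteratedFDeriv ℝ i (fderiv ℝ f) x‖ = ‖iteratedFDeriv ℝ (i + 1) f x‖ :=
    fun i x => norm_iteratedFDeriv_fderiv
  have hc := contDiffOn_succ_iff_fderiv_of_isOpen (𝕜 := ℝ) (n := (p : WithTop ℕ∞)) (f := f) hS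
  constructor
  · intro h
    have h1 := hc.1 (by exact_mod_cast h.1)
    refine ⟨h1.1, fun x hx => h.norm_le hx, h1.2.2, fun i hi x hx => ?_⟩
    rw [key]
    refine (h.2 (i + 1) (by omega) x hx).trans (le_of_eq ?_)
    ring
  · rintro ⟨h1, h2, h3⟩
    refine ⟨?_, fun i hi x hx => ?_⟩
    · have := hc.2 ⟨h1, by simp, h3.1⟩
      exact_mod_cast this
    · cases i with
      | zero => simpa using h2 x hx
      | succ i =>
        rw [← key]
        refine (h3.2 i (by omega) x hx).trans (le_of_eq ?_)
        ring

theorem DBd.fderiv (h : DBd S Λ (p + 1) B f) (hS : IsOpen S) :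
    DBd S Λ p (B * Λ) (fderiv ℝ f) := ((dBd_succ_iff hS).1 h).2.2

theorem DBd.nonneg (h : DBd S Λ p B f) {x : E} (hx : x ∈ S) : 0 ≤ B :=
  (norm_nonneg _).trans (h.norm_le hx)

theorem DBd.zero (hΛ : 0 ≤ Λ) (hB : 0 ≤ B) : DBd S Λ p B (fun _ => (0 : F)) := by
  refine ⟨contDiffOn_const, fun i _ x _ => ?_⟩
  have : iteratedFDeriv ℝ i (fun _ : E => (0 : F)) x = 0 := by
    simp
  rw [this, norm_zero]
  positivity

theorem DBd.const (hΛ : 0 ≤ Λ) {c : F} (hc : ‖c‖ ≤ B) : DBd S Λ p B (fun _ => c) := by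
  refine ⟨contDiffOn_const, fun i _ x _ => ?_⟩
  cases i with
  | zero => simpa using hc
  | succ i =>
    rw [iteratedFDeriv_succ_const]
    have : 0 ≤ B := (norm_nonneg _).trans hc
    simp only [Pi.zero_apply, norm_zero]
    positivity

theorem DBd.clm_comp (h : DBd S Λ p B f) (hS : IsOpen S) (L : F →L[ℝ] G) :
    DBd S Λ p (‖L‖ * B) (fun x => L (f x)) := by
  refine ⟨L.contDiff.comp_contDiffOn h.1, fun i hi x hx => ?_⟩
  have := L.norm_iteratedFDeriv_comp_left (n := i) (h.contDiffAt hS hx)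
    (by exact_mod_cast hi)
  refine this.trans ?_
  rw [mul_assoc]
  exact mul_le_mul_of_nonneg_left (h.2 i hi x hx) (norm_nonneg _)

theorem DBd.add (hf : DBd S Λ p B f) (hg : DBd S Λ p B' g) (hS : IsOpen S) :
    DBd S Λ p (B + B') (fun x => f x + g x) := by
  refine ⟨hf.1.add hg.1, fun i hi x hx => ?_⟩
  have : iteratedFDeriv ℝ i (fun x => f x + g x) x
      = iteratedFDeriv ℝ i f x + iteratedFDeriv ℝ i g x :=
    fun_iteratedFDeriv_add_apply ((hf.contDiffAt hS hx).of_le (by exact_mod_cast hi))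
      ((hg.contDiffAt hS hx).of_le (by exact_mod_cast hi))
  rw [this, add_mul]
  exact (norm_add_le _ _).trans (add_le_add (hf.2 i hi x hx) (hg.2 i hi x hx))

theorem DBd.neg (hf : DBd S Λ p B f) : DBd S Λ p B (fun x => - f x) := by
  refine ⟨hf.1.neg, fun i hi x hx => ?_⟩
  have : iteratedFDeriv ℝ i (fun x => - f x) x = - iteratedFDeriv ℝ i f x :=
    iteratedFDeriv_neg_apply
  rw [this, norm_neg]
  exact hf.2 i hi x hx

theorem DBd.sub (hf : DBd S Λ p B f) (hg : DBd S Λ p B' g) (hS : IsOpen S) :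
    DBd S Λ p (B + B') (fun x => f x - g x) := by
  simpa [sub_eq_add_neg] using hf.add hg.neg hS

theorem DBd.sum {ι : Type*} (s : Finset ι) {fs : ι → E → F} (hS : IsOpen S) (hΛ : 0 ≤ Λ)
    (h : ∀ j ∈ s, DBd S Λ p B (fs j)) :
    DBd S Λ p (s.card * B) (fun x => ∑ j ∈ s, fs j x) := by
  classical
  induction s using Finset.induction_on with
  | empty => simpa using DBd.zero hΛ le_rfl
  | insert a s ha ih =>
    have := (h a (Finset.mem_insert_self _ _)).add
      (ih fun j hj => h j (Finset.mem_insert_of_mem hj)) hS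
    simp only [Finset.sum_insert ha, Finset.card_insert_of_notMem ha]
    refine this.mono_bound hΛ ?_
    push_cast
    linarith

/-- A bilinear expression costs the factor `2 ^ p` from the Leibniz rule. -/
theorem DBd.bilin {F' : Type} [NormedAddCommGroup F'] [NormedSpace ℝ F'] {g : E → F'}
    (hf : DBd S Λ p B f) (hg : DBd S Λ p B' g) (hS : IsOpen S) (hΛ : 0 ≤ Λ)
    (L : F →L[ℝ] F' →L[ℝ] G) :
    DBd S Λ p (‖L‖ * 2 ^ p * (B * B')) (fun x => L (f x) (g x)) := by
  refine ⟨L.isBoundedBilinearMap.contDiff.comp_contDiffOn (hf.1.prodMk hg.1),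
    fun n hn x hx => ?_⟩
  have hB : 0 ≤ B := hf.nonneg hx
  have hB' : 0 ≤ B' := hg.nonneg hx
  have h1 := L.norm_iteratedFDerivWithin_le_of_bilinear (n := n) hf.1 hg.1
    hS.uniqueDiffOn hx (by exact_mod_cast hn)
  simp only [iteratedFDerivWithin_of_isOpen _ hS hx] at h1
  refine h1.trans ?_
  have h2 : ∑ i ∈ Finset.range (n + 1), (n.choose i : ℝ) * ‖iteratedFDeriv ℝ i f x‖ *
      ‖iteratedFDeriv ℝ (n - i) g x‖
      ≤ ∑ i ∈ Finset.range (n + 1), (n.choose i : ℝ) * (B * B' * Λ ^ n) := by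
    refine Finset.sum_le_sum fun i hi => ?_
    have hin : i ≤ n := by simpa [Nat.lt_succ_iff] using hi
    rw [mul_assoc]
    refine mul_le_mul_of_nonneg_left ?_ (by positivity)
    calc _ ≤ (B * Λ ^ i) * (B' * Λ ^ (n - i)) :=
          mul_le_mul (hf.2 i (hin.trans hn) x hx) (hg.2 (n - i) (by omega) x hx)
            (norm_nonneg _) (by positivity)
      _ = B * B' * (Λ ^ i * Λ ^ (n - i)) := by ring
      _ = _ := by rw [← pow_add, Nat.add_sub_cancel' hin]
  have h3 : ∑ i ∈ Finset.range (n + 1), (n.choose i : ℝ) * (B * B' * Λ ^ n)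
      = 2 ^ n * (B * B' * Λ ^ n) := by
    rw [← Finset.sum_mul]
    congr 1
    exact_mod_cast Nat.sum_range_choose n
  have h4 : (2 : ℝ) ^ n ≤ 2 ^ p := pow_le_pow_right₀ (by norm_num) hn
  calc _ ≤ ‖L‖ * (2 ^ n * (B * B' * Λ ^ n)) :=
        mul_le_mul_of_nonneg_left (h2.trans h3.le) L.opNorm_nonneg
    _ ≤ ‖L‖ * (2 ^ p * (B * B' * Λ ^ n)) :=
        mul_le_mul_of_nonneg_left (by gcongr) L.opNorm_nonneg
    _ = _ := by ring

theorem DBd.clm_apply {A : E → F →L[ℝ] G} {v : E → F}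
    (hf : DBd S Λ p B A) (hg : DBd S Λ p B' v) (hS : IsOpen S) (hΛ : 0 ≤ Λ)
    (hB : 0 ≤ B) (hB' : 0 ≤ B') :
    DBd S Λ p (2 ^ p * (B * B')) (fun x => A x (v x)) := by
  refine (hf.bilin hg hS hΛ (ContinuousLinearMap.id ℝ (F →L[ℝ] G))).mono_bound hΛ ?_
  have := ContinuousLinearMap.norm_id_le (𝕜 := ℝ) (E := F →L[ℝ] G)
  calc _ ≤ 1 * 2 ^ p * (B * B') := by gcongr
    _ = _ := by ring

theorem DBd.mul {f g : E → ℝ} (hf : DBd S Λ p B f) (hg : DBd S Λ p B' g) (hS : IsOpen S)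
    (hΛ : 0 ≤ Λ) (hB : 0 ≤ B) (hB' : 0 ≤ B') :
    DBd S Λ p (2 ^ p * (B * B')) (fun x => f x * g x) := by
  refine (hf.bilin hg hS hΛ (ContinuousLinearMap.mul ℝ ℝ)).mono_bound hΛ ?_
  have := ContinuousLinearMap.opNorm_mul_le ℝ ℝ
  calc _ ≤ 1 * 2 ^ p * (B * B') := by gcongr
    _ = _ := by ring

/-- Composition with a map whose first derivative has the weighted bound `c`. -/
theorem DBd.comp {T : Set E'} {c : ℝ} {ψ : E → E'} (hS : IsOpen S) (hT : IsOpen T)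
    (hΛ : 0 ≤ Λ) (hc : 1 ≤ c) (hmaps : MapsTo ψ S T) (p : ℕ) :
    ∀ {F : Type} [NormedAddCommGroup F] [NormedSpace ℝ F] {B : ℝ} {g : E' → F}, 0 ≤ B →
      DBd T Λ p B g → ContinuousOn ψ S → (∀ j, j + 1 ≤ p → DifferentiableOn ℝ ψ S ∧
        DBd S Λ j c (_root_.fderiv ℝ ψ)) →
      DBd S Λ p (2 ^ (p ^ 2) * c ^ p * B) (fun x => g (ψ x)) := by
  induction p with
  | zero =>
    intro F _ _ B g hB hg hψ _
    rw [dBd_zero_iff] at hg ⊢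
    exact ⟨hg.1.comp hψ hmaps, fun x hx => by simpa using hg.2 _ (hmaps hx)⟩
  | succ p ih =>
    intro F _ _ B g hB hg hψ hD
    obtain ⟨hdψ, hDψ⟩ := hD p le_rfl
    have hg' := (dBd_succ_iff hT).1 hg
    have h1 := ih (by positivity) hg'.2.2 hψ fun j hj => hD j (by omega)
    have hcp : 1 ≤ c ^ p := one_le_pow₀ hc
    have h2 := h1.bilin hDψ hS hΛ (ContinuousLinearMap.compL ℝ E E' F)
    have hdg : ∀ x ∈ S, DifferentiableAt ℝ g (ψ x) := fun x hx =>
      hg.differentiableAt hT (by omega) (hmaps hx)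
    have hdψ' : ∀ x ∈ S, DifferentiableAt ℝ ψ x := fun x hx =>
      hdψ.differentiableAt (hS.mem_nhds hx)
    have hpow : (2 : ℝ) ^ p * 2 ^ (p ^ 2) ≤ 2 ^ ((p + 1) ^ 2) := by
      rw [← pow_add]
      exact pow_le_pow_right₀ (by norm_num) (by nlinarith)
    rw [dBd_succ_iff hS]
    refine ⟨fun x hx => ((hdg x hx).comp x (hdψ' x hx)).differentiableWithinAt,
      fun x hx => ?_, ?_⟩
    · refine (hg.norm_le (hmaps hx)).trans ?_
      have : (1 : ℝ) ≤ 2 ^ ((p + 1) ^ 2) * c ^ (p + 1) :=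
        one_le_mul_of_one_le_of_one_le (one_le_pow₀ (by norm_num)) (one_le_pow₀ hc)
      nlinarith
    · have h3 : EqOn (_root_.fderiv ℝ (fun x => g (ψ x)))
          (fun x => ContinuousLinearMap.compL ℝ E E' F (_root_.fderiv ℝ g (ψ x))
            (_root_.fderiv ℝ ψ x)) S := by
        intro x hx
        exact fderiv_comp x (hdg x hx) (hdψ' x hx)
      refine (h2.congr hS h3).mono_bound hΛ ?_
      have hL := ContinuousLinearMap.norm_compL_le ℝ E E' F
      calc _ ≤ 1 * 2 ^ p * (2 ^ (p ^ 2) * c ^ p * (B * Λ) * c) := by gcongr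
        _ = (2 ^ p * 2 ^ (p ^ 2)) * (c ^ (p + 1) * B * Λ) := by ring
        _ ≤ 2 ^ ((p + 1) ^ 2) * (c ^ (p + 1) * B * Λ) := by gcongr
        _ = _ := by ring

/-- Composition with a map close to the identity. -/
theorem DBd.comp_add {T : Set E} {a : E → E} (hS : IsOpen S) (hT : IsOpen T)
    (hΛ : 1 ≤ Λ) (hB : 0 ≤ B) (hg : DBd T Λ p B g) (ha : DBd S Λ p Λ⁻¹ a)
    (hmaps : MapsTo (fun x => x + a x) S T) :
    DBd S Λ p (2 ^ (p ^ 2) * 2 ^ p * B) (fun x => g (x + a x)) := by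
  have hΛ0 : 0 ≤ Λ := by linarith
  refine DBd.comp (ψ := fun x => x + a x) hS hT hΛ0 (by norm_num) hmaps p hB hg
    (continuousOn_id.add ha.1.continuousOn) fun j hj => ?_
  have ha' := (ha.mono_order hj)
  have hd := (dBd_succ_iff hS).1 ha'
  refine ⟨differentiableOn_id.add hd.1, ?_⟩
  have h1 : DBd S Λ j 1 (fun _ : E => ContinuousLinearMap.id ℝ E) :=
    DBd.const hΛ0 ContinuousLinearMap.norm_id_le
  have h2 := h1.add hd.2.2 hS
  have hb : (1 : ℝ) + Λ⁻¹ * Λ = 2 := by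
    rw [inv_mul_cancel₀ (by linarith)]; norm_num
  rw [hb] at h2
  refine h2.congr hS fun x hx => ?_
  have := ((hasFDerivAt_id x).add (hd.1.differentiableAt (hS.mem_nhds hx)).hasFDerivAt).fderiv
  exact this

/-- Derivative bounds for a small divisor: if the derivatives of `d` are bounded by `β Λ ^ i`, with
the lower bound `β` of `|d|`, then `1 / d` has weighted bounds at the same rate `Λ`. -/
theorem DBd.inv {β : ℝ} (hS : IsOpen S) (hΛ : 0 ≤ Λ) (hβ : 0 < β) {d : E → ℝ} (p : ℕ)
    (hd : ContinuousOn d S)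
    (hD : ∀ j, j + 1 ≤ p → DifferentiableOn ℝ d S ∧ DBd S Λ j (β * Λ) (_root_.fderiv ℝ d))
    (hlow : ∀ x ∈ S, β ≤ |d x|) :
    DBd S Λ p (2 ^ (4 ^ p) * β⁻¹) (fun x => (d x)⁻¹) := by
  have hne : ∀ x ∈ S, d x ≠ 0 := fun x hx h => by
    have := hlow x hx
    rw [h, abs_zero] at this
    linarith
  have hbd : ∀ x ∈ S, ‖(d x)⁻¹‖ ≤ β⁻¹ := fun x hx => by
    rw [norm_inv]
    exact inv_anti₀ hβ (hlow x hx)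
  induction p with
  | zero =>
    rw [dBd_zero_iff]
    refine ⟨hd.inv₀ hne, fun x hx => (hbd x hx).trans ?_⟩
    have : 0 ≤ β⁻¹ := by positivity
    norm_num
    linarith
  | succ p ih =>
    have ih' := ih fun j hj => hD j (by omega)
    obtain ⟨hdd, hDd⟩ := hD p le_rfl
    have hd' : ∀ x ∈ S, DifferentiableAt ℝ d x := fun x hx =>
      hdd.differentiableAt (hS.mem_nhds hx)
    have hβ' : 0 ≤ β⁻¹ := by positivity
    rw [dBd_succ_iff hS]
    refine ⟨fun x hx => ((hd' x hx).inv (hne x hx)).differentiableWithinAt, fun x hx => ?_, ?_⟩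
    · refine (hbd x hx).trans ?_
      have : (1 : ℝ) ≤ 2 ^ (4 ^ (p + 1)) := one_le_pow₀ (by norm_num)
      nlinarith
    -- the derivative of `1 / d` is `-(1 / d) ^ 2` times that of `d`
    · have hsq := ih'.mul ih' hS hΛ (by positivity) (by positivity)
      have h2 := (hsq.bilin hDd hS hΛ (ContinuousLinearMap.lsmul ℝ ℝ)).neg
      refine (h2.congr hS fun x hx => ?_).mono_bound hΛ ?_
      · have h3 := ((hasDerivAt_inv (hne x hx)).comp_hasFDerivAt x (hd' x hx).hasFDerivAt).fderiv
        change _root_.fderiv ℝ (fun x => (d x)⁻¹) x = _ at h3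
        rw [h3]
        ext v
        simp only [neg_smul, neg_apply, smul_apply, smul_eq_mul, ContinuousLinearMap.lsmul_apply]
        rw [sq, mul_inv]
      · have hL := ContinuousLinearMap.opNorm_lsmul_le (𝕜 := ℝ) (R := ℝ) (E := E →L[ℝ] ℝ)
        calc _ ≤ 1 * 2 ^ p * (2 ^ p * (2 ^ (4 ^ p) * β⁻¹ * (2 ^ (4 ^ p) * β⁻¹)) * (β * Λ)) := by
              gcongr
          _ = 2 ^ (p + p + 4 ^ p + 4 ^ p) * β⁻¹ * Λ * (β⁻¹ * β) := by
              rw [pow_add, pow_add, pow_add]; ring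
          _ = 2 ^ (p + p + 4 ^ p + 4 ^ p) * β⁻¹ * Λ := by
              rw [inv_mul_cancel₀ hβ.ne', mul_one]
          _ ≤ 2 ^ (4 ^ (p + 1)) * β⁻¹ * Λ := by
              have : p < 4 ^ p := Nat.lt_pow_self (by norm_num)
              have h5 : (2 : ℝ) ^ (p + p + 4 ^ p + 4 ^ p) ≤ 2 ^ (4 ^ (p + 1)) :=
                pow_le_pow_right₀ (by norm_num) (by rw [pow_succ]; omega)
              gcongr

end DerivBounds

/-! ### Integrals depending on a parameter, and increments of a function -/

section ParamIntegral

theorem intervalIntegrable_of_continuousOn_prod {E F : Type} [TopologicalSpace E]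
    [NormedAddCommGroup F] {S : Set E} {T : Set ℝ} (hT : Icc (0 : ℝ) 1 ⊆ T)
    {f : ℝ → E → F} (hf : ContinuousOn (fun z : ℝ × E => f z.1 z.2) (T ×ˢ S)) {x : E}
    (hx : x ∈ S) : IntervalIntegrable (fun t => f t x) MeasureTheory.volume 0 1 := by
  apply ContinuousOn.intervalIntegrable
  rw [uIcc_of_le zero_le_one]
  exact hf.comp (f := fun t : ℝ => (t, x)) (by fun_prop) fun t ht => ⟨hT ht, hx⟩

theorem continuousOn_integral_of_bounded {E F : Type} [NormedAddCommGroup E]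
    [NormedAddCommGroup F] [NormedSpace ℝ F] {S : Set E} {T : Set ℝ}
    (hS : IsOpen S) (hT : Icc (0 : ℝ) 1 ⊆ T) {B : ℝ} {f : ℝ → E → F}
    (hf : ContinuousOn (fun z : ℝ × E => f z.1 z.2) (T ×ˢ S))
    (hB : ∀ t ∈ Icc (0 : ℝ) 1, ∀ x ∈ S, ‖f t x‖ ≤ B) :
    ContinuousOn (fun x => ∫ t in (0 : ℝ)..1, f t x) S := by
  intro x hx
  apply ContinuousAt.continuousWithinAt
  have hio : uIoc (0 : ℝ) 1 ⊆ Icc 0 1 := by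
    rw [uIoc_of_le zero_le_one]; exact Ioc_subset_Icc_self
  refine intervalIntegral.continuousAt_of_dominated_interval (bound := fun _ => B) ?_ ?_ ?_ ?_
  · filter_upwards [hS.mem_nhds hx] with y hy
    exact (intervalIntegrable_of_continuousOn_prod hT hf hy).def'.aestronglyMeasurable
  · filter_upwards [hS.mem_nhds hx] with y hy
    exact Filter.Eventually.of_forall fun t ht => hB t (hio ht) y hy
  · exact intervalIntegrable_const
  · refine Filter.Eventually.of_forall fun t ht => ?_
    have h1 : ContinuousOn (fun y => f t y) S :=
      hf.comp (f := fun y : E => (t, y)) (by fun_prop) fun y hy => ⟨hT (hio ht), hy⟩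
    exact h1.continuousAt (hS.mem_nhds hx)

variable {E : Type} [NormedAddCommGroup E] [NormedSpace ℝ E] {S : Set E} {T : Set ℝ} {Λ : ℝ}

/-- The derivative in the second variable of a jointly smooth family is jointly smooth. -/
theorem contDiffOn_fderiv_param {F : Type} [NormedAddCommGroup F] [NormedSpace ℝ F]
    (hS : IsOpen S) (hTo : IsOpen T) {p : ℕ} {f : ℝ → E → F}
    (hf : ContDiffOn ℝ (p + 1 : ℕ) (fun z : ℝ × E => f z.1 z.2) (T ×ˢ S)) :
    (∀ t ∈ T, ∀ x ∈ S, DifferentiableAt ℝ (f t) x) ∧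
      ContDiffOn ℝ p (fun z : ℝ × E => fderiv ℝ (f z.1) z.2) (T ×ˢ S) := by
  have ho : IsOpen (T ×ˢ S) := hTo.prod hS
  have hd : ∀ z ∈ T ×ˢ S, HasFDerivAt (f z.1)
      ((fderiv ℝ (fun z : ℝ × E => f z.1 z.2) z).comp (ContinuousLinearMap.inr ℝ ℝ E)) z.2 := by
    intro z hz
    have h1 : DifferentiableAt ℝ (fun z : ℝ × E => f z.1 z.2) z :=
      (hf.contDiffAt (ho.mem_nhds hz)).differentiableAt (by simp)
    have h2 : HasFDerivAt (fun y : E => (z.1, y)) (ContinuousLinearMap.inr ℝ ℝ E) z.2 :=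
      hasFDerivAt_prodMk_right z.1 z.2
    exact HasFDerivAt.comp (g := fun z : ℝ × E => f z.1 z.2) z.2 h1.hasFDerivAt h2
  refine ⟨fun t ht x hx => (hd (t, x) ⟨ht, hx⟩).differentiableAt, ?_⟩
  have h3 : ContDiffOn ℝ p (fderiv ℝ (fun z : ℝ × E => f z.1 z.2)) (T ×ˢ S) :=
    hf.fderiv_of_isOpen ho (by exact_mod_cast le_rfl)
  refine (h3.clm_comp (contDiffOn_const (c := ContinuousLinearMap.inr ℝ ℝ E))).congr
    fun z hz => (hd z hz).fderiv

/-- Differentiation under the integral sign. -/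
theorem hasFDerivAt_integral_of_bounded {F : Type} [NormedAddCommGroup F] [NormedSpace ℝ F]
    (hS : IsOpen S) (hTo : IsOpen T) (hT : Icc (0 : ℝ) 1 ⊆ T) {B : ℝ} {f : ℝ → E → F}
    (hf : ContDiffOn ℝ 1 (fun z : ℝ × E => f z.1 z.2) (T ×ˢ S))
    (hB : ∀ t ∈ Icc (0 : ℝ) 1, ∀ x ∈ S, ‖fderiv ℝ (f t) x‖ ≤ B) {x : E} (hx : x ∈ S) :
    HasFDerivAt (fun x => ∫ t in (0 : ℝ)..1, f t x) (∫ t in (0 : ℝ)..1, fderiv ℝ (f t) x) x := by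
  have hio : uIoc (0 : ℝ) 1 ⊆ Icc 0 1 := by
    rw [uIoc_of_le zero_le_one]; exact Ioc_subset_Icc_self
  obtain ⟨hd, hc⟩ := contDiffOn_fderiv_param (p := 0) hS hTo (by exact_mod_cast hf)
  have hc' := hc.continuousOn
  refine intervalIntegral.hasFDerivAt_integral_of_dominated_of_fderiv_le (𝕜 := ℝ)
    (bound := fun _ => B) (F := fun x t => f t x) (F' := fun x t => fderiv ℝ (f t) x)
    (hS.mem_nhds hx) ?_ ?_ ?_ ?_ ?_ ?_
  · filter_upwards [hS.mem_nhds hx] with y hy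
    exact (intervalIntegrable_of_continuousOn_prod hT hf.continuousOn hy).def'.aestronglyMeasurable
  · exact intervalIntegrable_of_continuousOn_prod hT hf.continuousOn hx
  · exact (intervalIntegrable_of_continuousOn_prod (f := fun t x => fderiv ℝ (f t) x)
      hT hc' hx).def'.aestronglyMeasurable
  · exact Filter.Eventually.of_forall fun t ht y hy => hB t (hio ht) y hy
  · exact intervalIntegrable_const
  · exact Filter.Eventually.of_forall fun t ht y hy => (hd t (hT (hio ht)) y hy).hasFDerivAt

/-- Derivative bounds that are uniform in a parameter pass to the integral over it. -/
theorem DBd.integral (hS : IsOpen S) (hTo : IsOpen T) (hT : Icc (0 : ℝ) 1 ⊆ T) (p : ℕ) :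
    ∀ {F : Type} [NormedAddCommGroup F] [NormedSpace ℝ F] {B : ℝ} {f : ℝ → E → F},
      ContDiffOn ℝ p (fun z : ℝ × E => f z.1 z.2) (T ×ˢ S) →
      (∀ t ∈ Icc (0 : ℝ) 1, DBd S Λ p B (f t)) →
      DBd S Λ p B (fun x => ∫ t in (0 : ℝ)..1, f t x) := by
  have hio : uIoc (0 : ℝ) 1 ⊆ Icc 0 1 := by
    rw [uIoc_of_le zero_le_one]; exact Ioc_subset_Icc_self
  have hnorm : ∀ {F : Type} [NormedAddCommGroup F] [NormedSpace ℝ F] {B : ℝ} {f : ℝ → E → F}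
      {p : ℕ}, (∀ t ∈ Icc (0 : ℝ) 1, DBd S Λ p B (f t)) →
      ∀ x ∈ S, ‖∫ t in (0 : ℝ)..1, f t x‖ ≤ B := by
    intro F _ _ B f p h x hx
    have := intervalIntegral.norm_integral_le_of_norm_le_const (a := 0) (b := 1) (C := B)
      (f := fun t => f t x) fun t ht => (h t (hio ht)).norm_le hx
    simpa using this
  induction p with
  | zero =>
    intro F _ _ B f hf h
    rw [dBd_zero_iff]
    exact ⟨continuousOn_integral_of_bounded hS hT hf.continuousOn
      fun t ht x hx => (h t ht).norm_le hx, hnorm h⟩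
  | succ p ih =>
    intro F _ _ B f hf h
    obtain ⟨hd, hc⟩ := contDiffOn_fderiv_param hS hTo hf
    have h1 : ∀ t ∈ Icc (0 : ℝ) 1, DBd S Λ p (B * Λ) (_root_.fderiv ℝ (f t)) :=
      fun t ht => (h t ht).fderiv hS
    have h2 := ih hc h1
    have h3 : ∀ x ∈ S, HasFDerivAt (fun x => ∫ t in (0 : ℝ)..1, f t x)
        (∫ t in (0 : ℝ)..1, _root_.fderiv ℝ (f t) x) x := fun x hx =>
      hasFDerivAt_integral_of_bounded hS hTo hT (hf.of_le (by exact_mod_cast (by omega)))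
        (fun t ht x hx => (h1 t ht).norm_le hx) hx
    rw [dBd_succ_iff hS]
    exact ⟨fun x hx => (h3 x hx).differentiableAt.differentiableWithinAt, hnorm h,
      h2.congr hS fun x hx => (h3 x hx).fderiv⟩

/-- The increment of `g` between the two maps `x + a` and `x + a + w`: it gains the size of `w`,
at the price of one derivative of `g`. -/
theorem DBd.increment {F : Type} [NormedAddCommGroup F] [NormedSpace ℝ F] [CompleteSpace F]
    {S' : Set E} {p : ℕ} {B ω : ℝ}
    {g : E → F} {a w : E → E} (hS : IsOpen S) (hS' : IsOpen S') (hΛ : 1 ≤ Λ) (hB : 0 ≤ B)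
    (hω : 0 ≤ ω) (hg : ContDiffOn ℝ (p + 1 : ℕ) g S') (hDg : DBd S' Λ p B (_root_.fderiv ℝ g))
    (ha : DBd S Λ p (Λ⁻¹ / 2) a) (hw : DBd S Λ p ω w) (hωΛ : ω ≤ Λ⁻¹ / 2)
    (hmaps : ∀ t ∈ Ioo (-1 : ℝ) 2, ∀ x ∈ S, x + (a x + t • w x) ∈ S') :
    DBd S Λ p (4 ^ ((p + 1) ^ 2) * (B * ω)) (fun x => g (x + (a x + w x)) - g (x + a x)) := by
  have hΛ0 : 0 ≤ Λ := by linarith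
  have hIcc : Icc (0 : ℝ) 1 ⊆ Ioo (-1 : ℝ) 2 := fun t ht =>
    ⟨by linarith [ht.1], by linarith [ht.2]⟩
  set f : ℝ → E → F := fun t x => _root_.fderiv ℝ g (x + (a x + t • w x)) (w x)
  have hpt : ∀ t ∈ Icc (0 : ℝ) 1, DBd S Λ p (4 ^ ((p + 1) ^ 2) * (B * ω)) (f t) := by
    intro t ht
    have h1 : DBd S Λ p Λ⁻¹ (fun x => a x + t • w x) := by
      have h2 := hw.clm_comp hS (t • ContinuousLinearMap.id ℝ E)
      refine (ha.add h2 hS).mono_bound hΛ0 ?_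
      have h3 : ‖t • ContinuousLinearMap.id ℝ E‖ ≤ 1 := by
        refine (norm_smul_le t (ContinuousLinearMap.id ℝ E)).trans ?_
        rw [Real.norm_eq_abs, abs_of_nonneg ht.1]
        have := ContinuousLinearMap.norm_id_le (𝕜 := ℝ) (E := E)
        nlinarith [ht.1, ht.2, norm_nonneg (ContinuousLinearMap.id ℝ E)]
      nlinarith [norm_nonneg (t • ContinuousLinearMap.id ℝ E)]
    have h4 := DBd.comp_add hS hS' hΛ hB hDg h1 fun x hx => hmaps t (hIcc ht) x hx
    refine (h4.clm_apply hw hS hΛ0 (by positivity) hω).mono_bound hΛ0 ?_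
    have : (2 : ℝ) ^ p * (2 ^ (p ^ 2) * 2 ^ p * B * ω) = 2 ^ (p + p ^ 2 + p) * (B * ω) := by
      rw [pow_add, pow_add]; ring
    rw [this]
    have h5 : (2 : ℝ) ^ (p + p ^ 2 + p) ≤ 4 ^ ((p + 1) ^ 2) := by
      calc (2 : ℝ) ^ (p + p ^ 2 + p) ≤ 2 ^ ((p + 1) ^ 2) :=
            pow_le_pow_right₀ (by norm_num) (by nlinarith)
        _ ≤ 4 ^ ((p + 1) ^ 2) := pow_le_pow_left₀ (by norm_num) (by norm_num) _
    exact mul_le_mul_of_nonneg_right h5 (by positivity)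
  have hsm : ContDiffOn ℝ p (fun z : ℝ × E => f z.1 z.2) (Ioo (-1 : ℝ) 2 ×ˢ S) := by
    have hsnd : MapsTo (fun z : ℝ × E => z.2) (Ioo (-1 : ℝ) 2 ×ˢ S) S := fun z hz => hz.2
    have ha' := ha.1.comp (contDiff_snd.contDiffOn) hsnd
    have hw' := hw.1.comp (contDiff_snd.contDiffOn) hsnd
    have h1 : ContDiffOn ℝ p (fun z : ℝ × E => z.2 + (a z.2 + z.1 • w z.2))
        (Ioo (-1 : ℝ) 2 ×ˢ S) :=
      contDiff_snd.contDiffOn.add (ha'.add (contDiff_fst.contDiffOn.smul hw'))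
    exact (hDg.1.comp h1 fun z hz => hmaps z.1 hz.1 z.2 hz.2).clm_apply hw'
  refine (DBd.integral hS isOpen_Ioo hIcc p hsm hpt).congr hS fun x hx => ?_
  -- the fundamental theorem of calculus along the segment from `x + a x` to `x + a x + w x`
  have hder : ∀ t ∈ uIcc (0 : ℝ) 1,
      HasDerivAt (fun t : ℝ => g (x + (a x + t • w x))) (f t x) t := by
    intro t ht
    rw [uIcc_of_le zero_le_one] at ht
    have h1 : DifferentiableAt ℝ g (x + (a x + t • w x)) :=
      (hg.contDiffAt (hS'.mem_nhds (hmaps t (hIcc ht) x hx))).differentiableAt (by simp)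
    have h2 : HasDerivAt (fun t : ℝ => x + (a x + t • w x)) (w x) t := by
      simpa using (((hasDerivAt_id t).smul_const (w x)).const_add (a x)).const_add x
    exact h1.hasFDerivAt.comp_hasDerivAt t h2
  have := intervalIntegral.integral_eq_sub_of_hasDerivAt hder
    (intervalIntegrable_of_continuousOn_prod hIcc hsm.continuousOn hx)
  simp only [one_smul, zero_smul, add_zero] at this
  exact this.symm

end ParamIntegral

/-! ### Fourier harmonics in one direction -/

section Fourier

variable {E : Type} [NormedAddCommGroup E] [NormedSpace ℝ E]

/-- The character `t ↦ e^{2π i n t}`. -/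
def chr (n : ℤ) (t : ℝ) : ℂ := Complex.exp (2 * Real.pi * n * t * Complex.I)

theorem norm_chr (n : ℤ) (t : ℝ) : ‖chr n t‖ = 1 := by
  have : chr n t = Complex.exp ((2 * Real.pi * n * t : ℝ) * Complex.I) := by
    simp [chr]
  rw [this, Complex.norm_exp_ofReal_mul_I]

theorem chr_add (n : ℤ) (s t : ℝ) : chr n (s + t) = chr n s * chr n t := by
  rw [chr, chr, chr, ← Complex.exp_add]
  congr 1
  push_cast
  ring

theorem chr_zero (n : ℤ) : chr n 0 = 1 := by simp [chr]

theorem chr_int (n m : ℤ) : chr n m = 1 := by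
  have : chr n m = Complex.exp (((n * m : ℤ) : ℂ) * (2 * Real.pi * Complex.I)) := by
    rw [chr]; congr 1; push_cast; ring
  rw [this, Complex.exp_int_mul_two_pi_mul_I]

theorem chr_neg_mul_self (n : ℤ) (t : ℝ) : chr n t * chr n (-t) = 1 := by
  rw [← chr_add, add_neg_cancel, chr_zero]

theorem contDiff_chr (n : ℤ) {k : WithTop ℕ∞} : ContDiff ℝ k (chr n) := by
  have h : ContDiff ℝ k (fun t : ℝ => (t : ℂ)) := Complex.ofRealCLM.contDiff
  exact Complex.contDiff_exp.comp ((contDiff_const.mul h).mul contDiff_const)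

theorem hasDerivAt_chr (n : ℤ) (t : ℝ) :
    HasDerivAt (chr n) (2 * Real.pi * n * Complex.I * chr n t) t := by
  have h1 : HasDerivAt (fun t : ℝ => (2 * Real.pi * n * (t : ℂ) * Complex.I))
      (2 * Real.pi * n * Complex.I) t := by
    have := ((Complex.ofRealCLM.hasDerivAt (x := t)).const_mul
      (2 * Real.pi * n : ℂ)).mul_const Complex.I
    simpa using this
  exact h1.cexp.congr_deriv (mul_comm _ _)

theorem dBd_shift {F : Type} [NormedAddCommGroup F] [NormedSpace ℝ F] {f : E → F} {S : Set E}
    {v : E} {Λ B : ℝ} {p : ℕ} (hSv : ∀ x ∈ S, ∀ t : ℝ, x + t • v ∈ S) (t : ℝ)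
    (hf : DBd S Λ p B f) : DBd S Λ p B (fun x => f (x + t • v)) := by
  refine ⟨hf.1.comp (contDiff_id.add contDiff_const).contDiffOn fun x hx => hSv x hx t,
    fun i hi x hx => ?_⟩
  rw [iteratedFDeriv_comp_add_right]
  exact hf.2 i hi _ (hSv x hx t)

theorem periodic_fderiv {S : Set E} {v : E} (hS : IsOpen S)
    {F : Type} [NormedAddCommGroup F] [NormedSpace ℝ F] {f : E → F}
    (hf : ∀ x ∈ S, f (x + v) = f x) : ∀ x ∈ S, fderiv ℝ f (x + v) = fderiv ℝ f x := by
  intro x hx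
  rw [← fderiv_comp_add_right]
  exact Filter.EventuallyEq.fderiv_eq (Filter.eventuallyEq_of_mem (hS.mem_nhds hx) hf)

variable {G : Type} [NormedAddCommGroup G] [NormedSpace ℂ G] [NormedSpace ℝ G]
  [IsScalarTower ℝ ℂ G]

/-- The `n`-th Fourier harmonic of `f` in the direction `v`, in which `f` is `1`-periodic. -/
def harm (v : E) (n : ℤ) (f : E → G) (x : E) : G :=
  ∫ t in (0 : ℝ)..1, chr n (-t) • f (x + t • v)

variable {S : Set E} {v : E} {Λ B : ℝ} {p : ℕ} {f : E → G} {n : ℤ}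

/-- A harmonic is multiplied by the character under translation in its direction. -/
theorem harm_add_smul (hS : ∀ x ∈ S, ∀ t : ℝ, x + t • v ∈ S) (hf : ∀ x ∈ S, f (x + v) = f x)
    {x : E} (hx : x ∈ S) (a : ℝ) : harm v n f (x + a • v) = chr n a • harm v n f x := by
  set h : ℝ → G := fun t => chr n (-t) • f (x + t • v) with hh
  have hper : Function.Periodic h 1 := by
    intro t
    have h1 : chr n (-(t + 1)) = chr n (-t) := by
      have : -(t + 1) = -t + ((-1 : ℤ) : ℝ) := by push_cast; ring
      rw [this, chr_add, chr_int, mul_one]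
    simp only [hh, h1]
    congr 1
    rw [add_smul, one_smul, ← add_assoc]
    exact hf _ (hS x hx t)
  have h2 : ∀ t : ℝ, chr n (-t) • f (x + a • v + t • v) = chr n a • h (t + a) := by
    intro t
    simp only [hh, smul_smul]
    rw [neg_add, chr_add, mul_comm (chr n (-t)), ← mul_assoc, chr_neg_mul_self, one_mul,
      add_smul, add_comm (t • v), ← add_assoc]
  simp only [harm]
  simp_rw [h2]
  rw [intervalIntegral.integral_smul, intervalIntegral.integral_comp_add_right]
  congr 1
  have := hper.intervalIntegral_add_eq a 0
  simpa [add_comm] using this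

theorem dBd_const_smul (hS : IsOpen S) {c : ℂ} (hc : ‖c‖ ≤ 1) (hΛ : 0 ≤ Λ) (hB : 0 ≤ B)
    (hf : DBd S Λ p B f) : DBd S Λ p B (fun x => c • f x) := by
  have h1 : ‖(c • ContinuousLinearMap.id ℝ G : G →L[ℝ] G)‖ ≤ 1 := by
    refine ContinuousLinearMap.opNorm_le_bound _ zero_le_one fun y => ?_
    simp only [smul_apply, ContinuousLinearMap.id_apply, norm_smul]
    exact mul_le_mul_of_nonneg_right hc (norm_nonneg _)
  refine (hf.clm_comp hS (c • ContinuousLinearMap.id ℝ G : G →L[ℝ] G)).mono_bound hΛ ?_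
  nlinarith

theorem contDiffOn_harm_integrand (hSv : ∀ x ∈ S, ∀ t : ℝ, x + t • v ∈ S)
    {k : WithTop ℕ∞} (hf : ContDiffOn ℝ k f S) :
    ContDiffOn ℝ k (fun z : ℝ × E => chr n (-z.1) • f (z.2 + z.1 • v)) (univ ×ˢ S) := by
  have h1 : ContDiffOn ℝ k (fun z : ℝ × E => f (z.2 + z.1 • v)) (univ ×ˢ S) :=
    hf.comp (contDiff_snd.add (contDiff_fst.smul contDiff_const)).contDiffOn
      fun z hz => hSv z.2 hz.2 z.1
  exact ((contDiff_chr n).comp contDiff_fst.neg).contDiffOn.smul h1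

theorem DBd.harm (hS : IsOpen S) (hSv : ∀ x ∈ S, ∀ t : ℝ, x + t • v ∈ S) (hΛ : 0 ≤ Λ)
    (hB : 0 ≤ B) (hf : DBd S Λ p B f) : DBd S Λ p B (harm v n f) :=
  DBd.integral hS isOpen_univ (subset_univ _) p (contDiffOn_harm_integrand hSv hf.1)
    fun t _ => dBd_const_smul hS (norm_chr n _).le hΛ hB (dBd_shift hSv t hf)

/-- Taking a harmonic commutes with differentiation. The right-hand harmonic is one of a function
with values in linear maps, which is why harmonics are taken of vector-valued functions. -/
theorem hasFDerivAt_harm (hS : IsOpen S) (hSv : ∀ x ∈ S, ∀ t : ℝ, x + t • v ∈ S) (hΛ : 0 ≤ Λ)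
    (hB : 0 ≤ B) (hf : DBd S Λ (p + 1) B f) {x : E} (hx : x ∈ S) :
    HasFDerivAt (SRNF.harm v n f) (SRNF.harm v n (fderiv ℝ f) x) x := by
  have h1 : ∀ t : ℝ, DBd S Λ (p + 1) B (fun x => chr n (-t) • f (x + t • v)) := fun t =>
    dBd_const_smul hS (norm_chr n _).le hΛ hB (dBd_shift hSv t hf)
  have h2 := hasFDerivAt_integral_of_bounded (f := fun t x => chr n (-t) • f (x + t • v))
    hS isOpen_univ (subset_univ _) (B := B * Λ)
    (contDiffOn_harm_integrand hSv (hf.1.of_le (by exact_mod_cast (by omega))))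
    (fun t _ x hx => ((h1 t).fderiv hS).norm_le hx) hx
  have h3 : ∀ t : ℝ, fderiv ℝ (fun x => chr n (-t) • f (x + t • v)) x
      = chr n (-t) • fderiv ℝ f (x + t • v) := by
    intro t
    have h4 : DifferentiableAt ℝ f (x + t • v) :=
      hf.differentiableAt hS (by omega) (hSv x hx t)
    have h5 : HasFDerivAt (fun y : E => y + t • v) (ContinuousLinearMap.id ℝ E) x :=
      (hasFDerivAt_id x).add_const _
    have h6 := (h4.hasFDerivAt.comp x h5).const_smul (chr n (-t))
    exact h6.fderiv.trans (by simp)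
  simp only [h3] at h2
  exact h2

/-- Decay of the harmonics of a smooth periodic function: a derivative along `v` multiplies the
`n`-th harmonic by `2 π i n`. -/
theorem norm_harm_le (hS : IsOpen S) (hSv : ∀ x ∈ S, ∀ t : ℝ, x + t • v ∈ S) (hΛ : 0 ≤ Λ)
    (hv : ‖v‖ ≤ 1) (hn : n ≠ 0) [CompleteSpace G] (e : ℕ) : ∀ {f : E → G} {B : ℝ}, 0 ≤ B →
      (∀ x ∈ S, f (x + v) = f x) → DBd S Λ e B f →
      ∀ x ∈ S, ‖SRNF.harm v n f x‖ ≤ B * (Λ / |(n : ℝ)|) ^ e := by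
  induction e with
  | zero =>
    intro f B hB _ hf x hx
    simpa using (hf.harm (n := n) hS hSv hΛ hB).norm_le hx
  | succ e ih =>
    intro f B hB hper hf x hx
    have h1 := hasFDerivAt_harm (n := n) hS hSv hΛ hB hf hx
    have hline : HasDerivAt (fun a : ℝ => x + a • v) v 0 := by
      simpa using ((hasDerivAt_id (0 : ℝ)).smul_const v).const_add x
    have h2 : HasDerivAt (fun a : ℝ => SRNF.harm v n f (x + a • v))
        (SRNF.harm v n (fderiv ℝ f) x v) 0 := by
      have h1' : HasFDerivAt (SRNF.harm v n f) (SRNF.harm v n (fderiv ℝ f) x)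
          (x + (0 : ℝ) • v) := by simpa using h1
      exact h1'.comp_hasDerivAt 0 hline
    have h3 : HasDerivAt (fun a : ℝ => SRNF.harm v n f (x + a • v))
        ((2 * Real.pi * n * Complex.I : ℂ) • SRNF.harm v n f x) 0 := by
      have h4 := (hasDerivAt_chr n 0).smul_const (SRNF.harm v n f x)
      rw [chr_zero, mul_one] at h4
      refine h4.congr_of_eventuallyEq (Filter.Eventually.of_forall fun a => ?_)
      exact harm_add_smul hSv hper hx a
    have h5 : SRNF.harm v n (fderiv ℝ f) x v = SRNF.harm v n (fun y => fderiv ℝ f y v) x := by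
      have hint : IntervalIntegrable (fun t : ℝ => chr n (-t) • fderiv ℝ f (x + t • v))
          MeasureTheory.volume 0 1 :=
        intervalIntegrable_of_continuousOn_prod
          (f := fun (t : ℝ) (x : E) => chr n (-t) • fderiv ℝ f (x + t • v)) (subset_univ _)
          (contDiffOn_harm_integrand hSv (hf.fderiv hS).1).continuousOn hx
      have := (ContinuousLinearMap.apply ℝ G v).intervalIntegral_comp_comm hint
      simp only [SRNF.harm]
      rw [ContinuousLinearMap.apply_apply] at this
      rw [← this]
      simp
    have h6 := h2.unique h3
    have hD : DBd S Λ e (B * Λ) (fun y => fderiv ℝ f y v) := by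
      refine ((hf.fderiv hS).clm_comp hS (ContinuousLinearMap.apply ℝ G v)).mono_bound hΛ ?_
      have h7 : ‖ContinuousLinearMap.apply ℝ G v‖ ≤ 1 := by
        refine ContinuousLinearMap.opNorm_le_bound _ zero_le_one fun L => ?_
        rw [ContinuousLinearMap.apply_apply, one_mul]
        exact (L.le_opNorm v).trans (mul_le_of_le_one_right (norm_nonneg _) hv)
      calc _ ≤ 1 * (B * Λ) := mul_le_mul_of_nonneg_right h7 (by positivity)
        _ = _ := one_mul _
    have h8 := ih (by positivity) (fun y hy => by
      rw [periodic_fderiv hS hper y hy]) hD x hx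
    rw [← h5, h6, norm_smul] at h8
    have hn' : 0 < |(n : ℝ)| := abs_pos.2 (by exact_mod_cast hn)
    have h9 : ‖(2 * Real.pi * n * Complex.I : ℂ)‖ = 2 * Real.pi * |(n : ℝ)| := by
      simp [abs_of_pos Real.pi_pos]
    rw [h9] at h8
    have hpi : 1 ≤ 2 * Real.pi := by linarith [Real.pi_gt_three]
    have h10 : |(n : ℝ)| * ‖SRNF.harm v n f x‖ ≤ B * Λ * (Λ / |(n : ℝ)|) ^ e := by
      refine le_trans ?_ h8
      have : 0 ≤ |(n : ℝ)| * ‖SRNF.harm v n f x‖ := by positivity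
      nlinarith
    rw [← le_div_iff₀' hn'] at h10
    refine h10.trans (le_of_eq ?_)
    rw [pow_succ]
    field_simp

/-- A continuous periodic function with summable Fourier coefficients is the sum of its Fourier
series at `0`; the general point is reached by translation. -/
theorem hasSum_fourier_of_periodic {γ : ℝ → ℂ} (hγ : Continuous γ)
    (hper : Function.Periodic γ 1)
    (hsum : Summable fun n : ℤ => ∫ t in (0 : ℝ)..1, chr n (-t) * γ t) :
    HasSum (fun n : ℤ => ∫ t in (0 : ℝ)..1, chr n (-t) * γ t) (γ 0) := by
  have : Fact ((0 : ℝ) < 1) := ⟨one_pos⟩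
  let g : C(AddCircle (1 : ℝ), ℂ) := ⟨hper.lift, continuous_coinduced_dom.2 hγ⟩
  have hc : ∀ n : ℤ, fourierCoeff (⇑g) n = ∫ t in (0 : ℝ)..1, chr n (-t) * γ t := by
    intro n
    rw [fourierCoeff_eq_intervalIntegral (T := (1 : ℝ)) g n 0]
    simp only [div_one, one_smul, zero_add]
    refine intervalIntegral.integral_congr fun t _ => ?_
    have h1 : g (t : AddCircle (1 : ℝ)) = γ t := hper.lift_coe t
    simp only [h1, smul_eq_mul, fourier_coe_apply, chr]
    congr 2
    push_cast
    ring
  have hsum' : Summable (fourierCoeff ⇑g) := by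
    refine hsum.congr fun n => (hc n).symm
  have h2 := has_pointwise_sum_fourier_series_of_summable hsum' ((0 : ℝ) : AddCircle (1 : ℝ))
  have h3 : g ((0 : ℝ) : AddCircle (1 : ℝ)) = γ 0 := hper.lift_coe 0
  rw [h3] at h2
  refine h2.congr_fun ?_
  intro n
  rw [← hc n]
  simp

/-- The sum of the reciprocal squares of the nonzero integers; the term with `n = 0` is `1 / 0 = 0`.
-/
def sumInvSq : ℝ := ∑' n : ℤ, 1 / (n : ℝ) ^ 2

theorem summable_invSq : Summable fun n : ℤ => 1 / (n : ℝ) ^ 2 :=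
  Real.summable_one_div_int_pow.2 (by norm_num)

theorem sumInvSq_nonneg : 0 ≤ sumInvSq := tsum_nonneg fun n => by positivity

/-- The partial Fourier sum `∑_{|n| ≤ M}` in the direction `v`. -/
def partialSum (v : E) (M : ℕ) (f : E → G) (x : E) : G :=
  ∑ n ∈ Finset.Icc (-M : ℤ) M, harm v n f x

theorem norm_sub_partialSum_le_complex {f : E → ℂ} (hS : IsOpen S)
    (hSv : ∀ x ∈ S, ∀ t : ℝ, x + t • v ∈ S)
    (hΛ : 1 ≤ Λ) (hv : ‖v‖ ≤ 1) {M : ℕ} (hM : 1 ≤ M) (e : ℕ) (hB : 0 ≤ B)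
    (hper : ∀ x ∈ S, f (x + v) = f x) (hf : DBd S Λ (e + 2) B f) {x : E} (hx : x ∈ S) :
    ‖f x - partialSum v M f x‖ ≤ B * (sumInvSq * Λ ^ (e + 2) / (M : ℝ) ^ e) := by
  have hΛ0 : 0 ≤ Λ := by linarith
  have hdec : ∀ n : ℤ, n ≠ 0 → ‖harm v n f x‖ ≤ B * (Λ / |(n : ℝ)|) ^ (e + 2) := fun n hn =>
    norm_harm_le hS hSv hΛ0 hv hn (e + 2) hB hper hf x hx
  have hbd : ∀ n : ℤ, n ∉ Finset.Icc (-M : ℤ) M →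
      ‖harm v n f x‖ ≤ B * (Λ ^ (e + 2) / (M : ℝ) ^ e) * (1 / (n : ℝ) ^ 2) := by
    intro n hn
    have hn1 : (M : ℝ) ≤ |(n : ℝ)| := by
      have : (M : ℤ) ≤ |n| := by
        by_contra h
        push Not at h
        rw [abs_lt] at h
        exact hn (Finset.mem_Icc.2 ⟨h.1.le, h.2.le⟩)
      exact_mod_cast this
    have hM' : (0 : ℝ) < M := by exact_mod_cast hM
    have hn0 : n ≠ 0 := by
      rintro rfl
      simp at hn1
      omega
    refine (hdec n hn0).trans ?_
    have hn2 : 0 < |(n : ℝ)| := hM'.trans_le hn1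
    rw [mul_assoc]
    refine mul_le_mul_of_nonneg_left ?_ hB
    rw [div_pow, ← sq_abs (n : ℝ), div_mul_div_comm, mul_one, pow_add |(n : ℝ)|]
    gcongr
  have hsum : Summable fun n : ℤ => harm v n f x := by
    refine Summable.of_norm_bounded_eventually
      (g := fun n : ℤ => B * (Λ ^ (e + 2) / (M : ℝ) ^ e) * (1 / (n : ℝ) ^ 2))
      (summable_invSq.mul_left _) ?_
    have : (↑(Finset.Icc (-M : ℤ) M) : Set ℤ)ᶜ ∈ Filter.cofinite :=
      (Finset.finite_toSet _).compl_mem_cofinite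
    filter_upwards [this] with n hn
    exact hbd n (by simpa using hn)
  have hγ : Continuous fun t : ℝ => f (x + t • v) :=
    hf.1.continuousOn.comp_continuous (by fun_prop) fun t => hSv x hx t
  have hγp : Function.Periodic (fun t : ℝ => f (x + t • v)) 1 := by
    intro t
    simp only
    rw [add_smul, one_smul, ← add_assoc]
    exact hper _ (hSv x hx t)
  have h1 := hasSum_fourier_of_periodic hγ hγp (by simpa [harm] using hsum)
  simp only [zero_smul, add_zero] at h1
  have h2 : HasSum (fun n : ℤ => harm v n f x) (f x) := h1
  have h3 : f x - partialSum v M f x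
      = ∑' n : {n : ℤ // n ∉ Finset.Icc (-M : ℤ) M}, harm v n f x := by
    have := hsum.sum_add_tsum_subtype_compl (Finset.Icc (-M : ℤ) M)
    rw [h2.tsum_eq] at this
    rw [partialSum, ← this]
    ring
  rw [h3]
  have hsub : Summable fun n : {n : ℤ // n ∉ Finset.Icc (-M : ℤ) M} =>
      B * (Λ ^ (e + 2) / (M : ℝ) ^ e) * (1 / ((n : ℤ) : ℝ) ^ 2) :=
    (summable_invSq.mul_left _).subtype _
  have h4 := tsum_of_norm_bounded hsub.hasSum fun n => hbd n.1 n.2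
  refine h4.trans ?_
  rw [tsum_mul_left]
  have h5 : ∑' n : {n : ℤ // n ∉ Finset.Icc (-M : ℤ) M}, (1 / ((n : ℤ) : ℝ) ^ 2) ≤ sumInvSq :=
    summable_invSq.tsum_subtype_le _ {n : ℤ | n ∉ Finset.Icc (-M : ℤ) M} (fun n => by positivity)
  calc _ ≤ B * (Λ ^ (e + 2) / (M : ℝ) ^ e) * sumInvSq := by gcongr
    _ = _ := by ring

/-- The vector-valued case, by duality. -/
theorem norm_sub_partialSum_le [CompleteSpace G] (hS : IsOpen S)
    (hSv : ∀ x ∈ S, ∀ t : ℝ, x + t • v ∈ S)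
    (hΛ : 1 ≤ Λ) (hv : ‖v‖ ≤ 1) {M : ℕ} (hM : 1 ≤ M) (e : ℕ) (hB : 0 ≤ B)
    (hper : ∀ x ∈ S, f (x + v) = f x) (hf : DBd S Λ (e + 2) B f) {x : E} (hx : x ∈ S) :
    ‖f x - partialSum v M f x‖ ≤ B * (sumInvSq * Λ ^ (e + 2) / (M : ℝ) ^ e) := by
  have hc0 := sumInvSq_nonneg
  refine NormedSpace.norm_le_dual_bound ℂ _ (by positivity) fun ℓ => ?_
  have h1 : ℓ (f x - partialSum v M f x)
      = (fun y => ℓ (f y)) x - partialSum v M (fun y => ℓ (f y)) x := by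
    rw [map_sub, partialSum, partialSum, map_sum]
    congr 1
    refine Finset.sum_congr rfl fun n _ => ?_
    have hint : IntervalIntegrable (fun t : ℝ => chr n (-t) • f (x + t • v))
        MeasureTheory.volume 0 1 :=
      intervalIntegrable_of_continuousOn_prod
        (f := fun (t : ℝ) (x : E) => chr n (-t) • f (x + t • v)) (subset_univ _)
        (contDiffOn_harm_integrand hSv hf.1).continuousOn hx
    have := ℓ.intervalIntegral_comp_comm hint
    rw [harm, harm, ← this]
    simp
  rw [h1]
  have h2 : DBd S Λ (e + 2) (‖ℓ‖ * B) (fun y => ℓ (f y)) := by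
    have := hf.clm_comp hS (ℓ.restrictScalars ℝ)
    rwa [ContinuousLinearMap.norm_restrictScalars] at this
  refine (norm_sub_partialSum_le_complex hS hSv hΛ hv hM e (by positivity)
    (fun y hy => by rw [hper y hy]) h2 hx).trans (le_of_eq ?_)
  ring

theorem DBd.partialSum (hS : IsOpen S) (hSv : ∀ x ∈ S, ∀ t : ℝ, x + t • v ∈ S)
    (hΛ : 0 ≤ Λ) (hB : 0 ≤ B) (M : ℕ) (hf : DBd S Λ p B f) :
    DBd S Λ p ((2 * M + 1) * B) (SRNF.partialSum v M f) := by
  have := DBd.sum (Finset.Icc (-M : ℤ) M) hS hΛ fun n _ => hf.harm (n := n) hS hSv hΛ hB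
  have hcard : ((Finset.Icc (-M : ℤ) M).card : ℝ) = 2 * M + 1 := by
    rw [Int.card_Icc]
    have : ((M : ℤ) + 1 - -(M : ℤ)).toNat = 2 * M + 1 := by omega
    rw [this]
    push_cast
    ring
  rw [hcard] at this
  exact this

/-- The tail of the Fourier series of a smooth periodic function, with all its derivatives. -/
theorem DBd.sub_partialSum (hS : IsOpen S) (hSv : ∀ x ∈ S, ∀ t : ℝ, x + t • v ∈ S)
    (hΛ : 1 ≤ Λ) (hv : ‖v‖ ≤ 1) {M : ℕ} (hM : 1 ≤ M) (e p : ℕ) :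
    ∀ {G : Type} [NormedAddCommGroup G] [NormedSpace ℂ G] [NormedSpace ℝ G]
      [IsScalarTower ℝ ℂ G] [CompleteSpace G] {B : ℝ} {f : E → G}, 0 ≤ B →
      (∀ x ∈ S, f (x + v) = f x) → DBd S Λ (p + e + 2) B f →
      DBd S Λ p (B * (sumInvSq * Λ ^ (e + 2) / (M : ℝ) ^ e))
        (fun x => f x - SRNF.partialSum v M f x) := by
  have hΛ0 : 0 ≤ Λ := by linarith
  induction p with
  | zero =>
    intro G _ _ _ _ _ B f hB hper hf
    have hf0 : DBd S Λ (e + 2) B f := hf.mono_order (by omega)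
    rw [dBd_zero_iff]
    exact ⟨hf.1.continuousOn.sub (DBd.partialSum hS hSv hΛ0 hB M hf).1.continuousOn,
      fun x hx => norm_sub_partialSum_le hS hSv hΛ hv hM e hB hper hf0 hx⟩
  | succ p ih =>
    intro G _ _ _ _ _ B f hB hper hf
    have hf0 : DBd S Λ (e + 2) B f := hf.mono_order (by omega)
    have hf1 : DBd S Λ (p + e + 2 + 1) B f := hf.mono_order (by omega)
    have h1 := ih (f := _root_.fderiv ℝ f) (B := B * Λ) (by positivity)
      (periodic_fderiv hS hper) (hf1.fderiv hS)
    have hd : ∀ x ∈ S, HasFDerivAt (fun x => f x - SRNF.partialSum v M f x)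
        (_root_.fderiv ℝ f x - SRNF.partialSum v M (_root_.fderiv ℝ f) x) x := by
      intro x hx
      refine (hf1.differentiableAt hS (by omega) hx).hasFDerivAt.sub ?_
      exact HasFDerivAt.fun_sum fun n _ => hasFDerivAt_harm hS hSv hΛ0 hB hf1 hx
    rw [dBd_succ_iff hS]
    refine ⟨fun x hx => (hd x hx).differentiableAt.differentiableWithinAt,
      fun x hx => norm_sub_partialSum_le hS hSv hΛ hv hM e hB hper hf0 hx, ?_⟩
    refine (h1.congr hS fun x hx => (hd x hx).fderiv).mono_bound hΛ0 (le_of_eq ?_)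
    ring

end Fourier

/-! ### The homological equation -/

section Homological

/-- The unit vector of the `j`-th angle. -/
def angDir (j : Fin 3) : Base := (EuclideanSpace.single j 1, 0)

theorem norm_angDir (j : Fin 3) : ‖angDir j‖ ≤ 1 := by
  simp [angDir, Prod.norm_def]

/-- Periodicity in the three angles, for actions in `W`. -/
def AngPeriodic {F : Type} (W : Set Act) (f : Base → F) : Prop :=
  ∀ (φ : Ang) (I : Act) (l : Fin 3 → ℤ), I ∈ W → f (φ + intVec l, I) = f (φ, I)

theorem angle_eq_sum (ψ : Ang) :
    ((ψ, 0) : Base) = ψ 2 • angDir 2 + ψ 1 • angDir 1 + ψ 0 • angDir 0 := by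
  refine Prod.ext ?_ (by simp [angDir])
  ext i
  fin_cases i <;> simp [angDir]

theorem slow_smul (k : Fin 3 → ℤ) (c : ℝ) (ψ : Ang) : slow k (c • ψ) = c * slow k ψ := by
  simp only [slow, Finset.mul_sum, PiLp.smul_apply, smul_eq_mul]
  exact Finset.sum_congr rfl fun i _ => by ring

theorem slow_add (k : Fin 3 → ℤ) (φ ψ : Ang) : slow k (φ + ψ) = slow k φ + slow k ψ := by
  simp only [slow, ← Finset.sum_add_distrib, PiLp.add_apply]
  exact Finset.sum_congr rfl fun i _ => by ring

theorem slow_intVec (k l : Fin 3 → ℤ) : slow k (intVec l) = ((∑ i, k i * l i : ℤ) : ℝ) := by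
  simp [slow, intVec]

theorem contDiff_slow (k : Fin 3 → ℤ) {n : WithTop ℕ∞} : ContDiff ℝ n (slow k) := by
  unfold slow
  fun_prop

theorem chr_eq_chr_one (n : ℤ) (t : ℝ) : chr n t = chr 1 (n * t) := by
  simp only [chr]
  congr 1
  push_cast
  ring

variable {W : Set Act} {Λ B : ℝ} {p : ℕ}

theorem univ_prod_add_mem {x : Base} (hx : x ∈ (univ : Set Ang) ×ˢ W) (j : Fin 3) (t : ℝ) :
    x + t • angDir j ∈ (univ : Set Ang) ×ˢ W := by
  simpa [angDir] using hx

theorem AngPeriodic.angDir {F : Type} {f : Base → F} (hf : AngPeriodic W f) (j : Fin 3) :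
    ∀ x ∈ (univ : Set Ang) ×ˢ W, f (x + angDir j) = f x := by
  intro x hx
  have h := hf x.1 x.2 (Pi.single j 1) hx.2
  have h1 : intVec (Pi.single j 1) = EuclideanSpace.single j 1 := by
    ext i
    simp only [intVec, PiLp.single_apply]
    by_cases hij : i = j
    · subst hij; simp
    · simp [hij]
  have h2 : x + SRNF.angDir j = (x.1 + EuclideanSpace.single j 1, x.2) := by
    simp [SRNF.angDir, Prod.ext_iff]
  rw [h2, ← h1, h]

theorem harm_comm_smul {v w : Base} {n : ℤ} {f : Base → ℂ} {c : ℂ} {S : Set Base}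
    (hSv : ∀ x ∈ S, ∀ t : ℝ, x + t • v ∈ S) (hf : ∀ x ∈ S, f (x + w) = c * f x)
    {x : Base} (hx : x ∈ S) : harm v n f (x + w) = c * harm v n f x := by
  simp only [harm, smul_eq_mul]
  rw [← intervalIntegral.integral_const_mul]
  refine intervalIntegral.integral_congr fun t _ => ?_
  have h1 : x + w + t • v = x + t • v + w := by abel
  simp only [h1, hf _ (hSv x hx t)]
  ring

theorem harm_add_periodic {v w : Base} {n : ℤ} {f : Base → ℂ} {S : Set Base}
    (hSv : ∀ x ∈ S, ∀ t : ℝ, x + t • v ∈ S) (hf : ∀ x ∈ S, f (x + w) = f x)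
    {x : Base} (hx : x ∈ S) : harm v n f (x + w) = harm v n f x := by
  have := harm_comm_smul (n := n) (f := f) (w := w) (c := 1) hSv
    (fun x hx => by rw [hf x hx, one_mul]) hx
  rwa [one_mul] at this

/-- The Fourier harmonic of `f` with integer vector `k`, including the exponential factor: it is a
function on the phase space, not a coefficient. -/
def harm3 (k : Fin 3 → ℤ) (f : Base → ℂ) : Base → ℂ :=
  harm (angDir 0) (k 0) (harm (angDir 1) (k 1) (harm (angDir 2) (k 2) f))

theorem DBd.harm3 (hW : IsOpen W) (hΛ : 0 ≤ Λ) (hB : 0 ≤ B) (k : Fin 3 → ℤ) {f : Base → ℂ}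
    (hf : DBd (univ ×ˢ W) Λ p B f) : DBd (univ ×ˢ W) Λ p B (harm3 k f) := by
  have hS : IsOpen ((univ : Set Ang) ×ˢ W) := isOpen_univ.prod hW
  have hSv := fun (j : Fin 3) x (hx : x ∈ (univ : Set Ang) ×ˢ W) t => univ_prod_add_mem hx j t
  exact ((hf.harm hS (hSv 2) hΛ hB).harm hS (hSv 1) hΛ hB).harm hS (hSv 0) hΛ hB

/-- `harm3 k f` is equivariant under all translations of the angles, with the character of `k`. -/
theorem harm3_add (k : Fin 3 → ℤ) {f : Base → ℂ} (hf : AngPeriodic W f) {x : Base}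
    (hx : x.2 ∈ W) (ψ : Ang) :
    harm3 k f (x + (ψ, 0)) = chr 1 (slow k ψ) * harm3 k f x := by
  set S : Set Base := (univ : Set Ang) ×ˢ W
  have hSv : ∀ (j : Fin 3), ∀ x ∈ S, ∀ t : ℝ, x + t • angDir j ∈ S :=
    fun (j : Fin 3) x (hx : x ∈ S) t => univ_prod_add_mem hx j t
  have hxS : x ∈ S := ⟨mem_univ _, hx⟩
  set h2 := harm (angDir 2) (k 2) f
  set h1 := harm (angDir 1) (k 1) h2
  have e2 : ∀ a : ℝ, ∀ x ∈ S, h2 (x + a • angDir 2) = chr (k 2) a * h2 x := fun a x hx =>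
    harm_add_smul (hSv 2) (hf.angDir 2) hx a
  have p2 : ∀ j : Fin 3, ∀ x ∈ S, h2 (x + angDir j) = h2 x := fun j x hx =>
    harm_add_periodic (hSv 2) (hf.angDir j) hx
  have e12 : ∀ a : ℝ, ∀ x ∈ S, h1 (x + a • angDir 2) = chr (k 2) a * h1 x := fun a x hx =>
    harm_comm_smul (hSv 1) (e2 a) hx
  have e1 : ∀ a : ℝ, ∀ x ∈ S, h1 (x + a • angDir 1) = chr (k 1) a * h1 x := fun a x hx =>
    harm_add_smul (hSv 1) (p2 1) hx a
  have p1 : ∀ j : Fin 3, ∀ x ∈ S, h1 (x + angDir j) = h1 x := fun j x hx =>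
    harm_add_periodic (hSv 1) (p2 j) hx
  have e02 : ∀ a : ℝ, ∀ x ∈ S, harm3 k f (x + a • angDir 2) = chr (k 2) a * harm3 k f x :=
    fun a x hx => harm_comm_smul (hSv 0) (e12 a) hx
  have e01 : ∀ a : ℝ, ∀ x ∈ S, harm3 k f (x + a • angDir 1) = chr (k 1) a * harm3 k f x :=
    fun a x hx => harm_comm_smul (hSv 0) (e1 a) hx
  have e00 : ∀ a : ℝ, ∀ x ∈ S, harm3 k f (x + a • angDir 0) = chr (k 0) a * harm3 k f x :=
    fun a x hx => harm_add_smul (hSv 0) (p1 0) hx a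
  rw [angle_eq_sum ψ, ← add_assoc, ← add_assoc, e00 _ _ (hSv 1 _ (hSv 2 _ hxS _) _),
    e01 _ _ (hSv 2 _ hxS _), e02 _ _ hxS]
  have hs : slow k ψ = k 0 * ψ 0 + k 1 * ψ 1 + k 2 * ψ 2 := by
    simp [slow, Fin.sum_univ_three]
  rw [hs, chr_add, chr_add, chr_eq_chr_one (k 0), chr_eq_chr_one (k 1), chr_eq_chr_one (k 2)]
  ring

theorem harm3_eq (k : Fin 3 → ℤ) {f : Base → ℂ} (hf : AngPeriodic W f) {x : Base}
    (hx : x.2 ∈ W) : harm3 k f x = chr 1 (slow k x.1) * harm3 k f (0, x.2) := by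
  rw [← harm3_add k hf (x := (0, x.2)) hx x.1]
  congr 1
  simp

theorem AngPeriodic.harm3 (k : Fin 3 → ℤ) {f : Base → ℂ} (hf : AngPeriodic W f) :
    AngPeriodic W (harm3 k f) := by
  intro φ I l hI
  have := harm3_add k hf (x := (φ, I)) hI (intVec l)
  rw [slow_intVec, chr_int, one_mul] at this
  rw [← this]
  simp

/-- Differentiating a harmonic along a direction of the angles multiplies it by `2 π i k · ψ`. -/
theorem fderiv_harm3 (hW : IsOpen W) (hΛ : 0 ≤ Λ) (hB : 0 ≤ B) (k : Fin 3 → ℤ) {f : Base → ℂ}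
    (hf : AngPeriodic W f) (hfb : DBd (univ ×ˢ W) Λ 1 B f) {x : Base} (hx : x.2 ∈ W)
    (ψ : Ang) :
    fderiv ℝ (SRNF.harm3 k f) x (ψ, 0) = 2 * Real.pi * slow k ψ * Complex.I * SRNF.harm3 k f x := by
  have hS : IsOpen ((univ : Set Ang) ×ˢ W) := isOpen_univ.prod hW
  have h1 : DifferentiableAt ℝ (SRNF.harm3 k f) x :=
    (hfb.harm3 hW hΛ hB k).differentiableAt hS one_ne_zero ⟨mem_univ _, hx⟩
  have hline : HasDerivAt (fun a : ℝ => x + a • ((ψ, 0) : Base)) (ψ, 0) 0 := by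
    simpa using ((hasDerivAt_id (0 : ℝ)).smul_const ((ψ, 0) : Base)).const_add x
  have h2 : HasDerivAt (fun a : ℝ => SRNF.harm3 k f (x + a • ((ψ, 0) : Base)))
      (fderiv ℝ (SRNF.harm3 k f) x (ψ, 0)) 0 := by
    have h1' : HasFDerivAt (SRNF.harm3 k f) (fderiv ℝ (SRNF.harm3 k f) x)
        (x + (0 : ℝ) • ((ψ, 0) : Base)) := by simpa using h1.hasFDerivAt
    exact h1'.comp_hasDerivAt 0 hline
  have h3 : HasDerivAt (fun a : ℝ => SRNF.harm3 k f (x + a • ((ψ, 0) : Base)))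
      (2 * Real.pi * slow k ψ * Complex.I * SRNF.harm3 k f x) 0 := by
    have h4 : HasDerivAt (fun a : ℝ => chr 1 (a * slow k ψ))
        (2 * Real.pi * slow k ψ * Complex.I) 0 := by
      have h5 := hasDerivAt_chr 1 ((0 : ℝ) * slow k ψ)
      have h6 := h5.scomp (0 : ℝ) ((hasDerivAt_id (0 : ℝ)).mul_const (slow k ψ))
      refine h6.congr_deriv ?_
      simp only [zero_mul, chr_zero, Complex.real_smul]
      push_cast
      ring
    refine (h4.mul_const (SRNF.harm3 k f x)).congr_of_eventuallyEq
      (Filter.Eventually.of_forall fun a => ?_)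
    have : a • ((ψ, 0) : Base) = (a • ψ, 0) := by simp
    simp only [this]
    rw [harm3_add k hf hx, slow_smul]
  exact h2.unique h3

/-- `ζ` is a function of the slow angle `k · φ` and of the action, of class `C^p`, and it is
`gcd k`-periodic in the slow angle. -/
def IsSlow (k : Fin 3 → ℤ) (W : Set Act) (p : ℕ) (ζ : Base → ℝ) : Prop :=
  ∃ Z : ℝ → Act → ℝ, (∀ x : Base, x.2 ∈ W → ζ x = Z (slow k x.1) x.2) ∧
    (∀ (s : ℝ) (J : Act), J ∈ W → Z (s + (Finset.univ.gcd k : ℤ)) J = Z s J) ∧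
    ContDiffOn ℝ p (fun y : ℝ × Act => Z y.1 y.2) (univ ×ˢ W)

theorem IsSlow.add {k : Fin 3 → ℤ} {ζ ζ' : Base → ℝ} (h : IsSlow k W p ζ)
    (h' : IsSlow k W p ζ') : IsSlow k W p (fun x => ζ x + ζ' x) := by
  obtain ⟨Z, h1, h2, h3⟩ := h
  obtain ⟨Z', h1', h2', h3'⟩ := h'
  exact ⟨fun s J => Z s J + Z' s J, fun x hx => by simp only [h1 x hx, h1' x hx],
    fun s J hJ => by simp only [h2 s J hJ, h2' s J hJ], h3.add h3'⟩

theorem isSlow_zero (k : Fin 3 → ℤ) : IsSlow k W p (fun _ => 0) :=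
  ⟨fun _ _ => 0, fun _ _ => rfl, fun _ _ _ => rfl, contDiffOn_const⟩

theorem IsSlow.mono_order {k : Fin 3 → ℤ} {ζ : Base → ℝ} {q : ℕ} (h : IsSlow k W p ζ)
    (hq : q ≤ p) : IsSlow k W q ζ := by
  obtain ⟨Z, h1, h2, h3⟩ := h
  exact ⟨Z, h1, h2, h3.of_le (by exact_mod_cast hq)⟩

theorem IsSlow.sum {ι : Type*} {k : Fin 3 → ℤ} (s : Finset ι) {ζ : ι → Base → ℝ}
    (h : ∀ i ∈ s, IsSlow k W p (ζ i)) : IsSlow k W p (fun x => ∑ i ∈ s, ζ i x) := by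
  classical
  induction s using Finset.induction_on with
  | empty => simpa using isSlow_zero k
  | insert a s ha ih =>
    simp only [Finset.sum_insert ha]
    exact (h a (Finset.mem_insert_self _ _)).add
      (ih fun j hj => h j (Finset.mem_insert_of_mem hj))

theorem AngPeriodic.sum {ι : Type*} (s : Finset ι) {ζ : ι → Base → ℝ}
    (h : ∀ i ∈ s, AngPeriodic W (ζ i)) : AngPeriodic W (fun x => ∑ i ∈ s, ζ i x) :=
  fun φ I l hI => Finset.sum_congr rfl fun i hi => h i hi φ I l hI

/-- The integer vector `k'` is a rational multiple of `k`, that is, an integer multiple `j` of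
`k / gcd k`. -/
def IsMultiple (k k' : Fin 3 → ℤ) : Prop :=
  ∃ j : ℤ, ∀ i, Finset.univ.gcd k * k' i = j * k i

/-- The harmonics of the rational multiples of `k` depend on the angles through `k · φ` only. -/
theorem isSlow_harm3 (hW : IsOpen W) (hΛ : 0 ≤ Λ) (hB : 0 ≤ B) {k k' : Fin 3 → ℤ}
    (hk : Finset.univ.gcd k ≠ 0) (hkk : IsMultiple k k')
    {f : Base → ℂ} (hf : AngPeriodic W f) (hfb : DBd (univ ×ˢ W) Λ p B f) :
    IsSlow k W p (fun x => (SRNF.harm3 k' f x).re) := by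
  obtain ⟨j, hj⟩ := hkk
  set g : ℤ := Finset.univ.gcd k with hg
  have hg0 : (g : ℝ) ≠ 0 := by exact_mod_cast hk
  have hslow : ∀ φ, slow k' φ = j * (slow k φ / g) := by
    intro φ
    have : g * slow k' φ = j * slow k φ := by
      simp only [slow, Finset.mul_sum]
      refine Finset.sum_congr rfl fun i _ => ?_
      have : ((g * k' i : ℤ) : ℝ) = ((j * k i : ℤ) : ℝ) := by exact_mod_cast hj i
      push_cast at this
      rw [← mul_assoc, this, mul_assoc]
    field_simp
    linarith
  refine ⟨fun s J => (chr j (s / g) * SRNF.harm3 k' f (0, J)).re, fun x hx => ?_,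
    fun s J _ => ?_, ?_⟩
  · simp only
    rw [harm3_eq k' hf hx, hslow, chr_eq_chr_one j]
  · simp only
    rw [add_div, div_self hg0, chr_add]
    have := chr_int j 1
    rw [Int.cast_one] at this
    rw [this, mul_one]
  · have h1 : ContDiffOn ℝ p (fun y : ℝ × Act => SRNF.harm3 k' f (0, y.2)) (univ ×ˢ W) :=
      (hfb.harm3 hW hΛ hB k').1.comp (contDiff_const.prodMk contDiff_snd).contDiffOn
        fun y hy => ⟨mem_univ _, hy.2⟩
    have h2 : ContDiff ℝ p (fun y : ℝ × Act => chr j (y.1 / g)) :=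
      (contDiff_chr j).comp (contDiff_fst.div_const _)
    exact Complex.reCLM.contDiff.comp_contDiffOn (h2.contDiffOn.mul h1)

/-- The box `|n₀|, |n₁|, |n₂| ≤ M` of integer vectors. -/
def box (M : ℕ) : Finset (Fin 3 → ℤ) := Fintype.piFinset fun _ => Finset.Icc (-M : ℤ) M

theorem card_box (M : ℕ) : ((box M).card : ℝ) = (2 * M + 1) ^ 3 := by
  have h : (Finset.Icc (-M : ℤ) M).card = 2 * M + 1 := by
    rw [Int.card_Icc]; omega
  simp [box, Fintype.card_piFinset, h]

theorem sum_box (M : ℕ) (F : (Fin 3 → ℤ) → ℂ) :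
    ∑ k ∈ box M, F k = ∑ a ∈ Finset.Icc (-M : ℤ) M, ∑ b ∈ Finset.Icc (-M : ℤ) M,
      ∑ c ∈ Finset.Icc (-M : ℤ) M, F ![c, b, a] := by
  simp only [← Finset.sum_product']
  refine Finset.sum_bij' (fun k _ => (k 2, k 1, k 0)) (fun t _ => ![t.2.2, t.2.1, t.1])
    ?_ ?_ ?_ ?_ ?_
  · intro k hk
    simp only [box, Fintype.mem_piFinset] at hk
    simp only [Finset.mem_product]
    exact ⟨hk 2, hk 1, hk 0⟩
  · intro t ht
    simp only [Finset.mem_product] at ht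
    simp only [box, Fintype.mem_piFinset]
    intro i
    fin_cases i
    · exact ht.2.2
    · exact ht.2.1
    · exact ht.1
  · intro k _
    ext i
    fin_cases i <;> rfl
  · intro t _
    rfl
  · intro k _
    congr 1
    ext i
    fin_cases i <;> rfl

/-- Truncation of the Fourier series of a periodic function to a box, with the error. -/
theorem dBd_sub_sum_box (hW : IsOpen W) (hΛ : 1 ≤ Λ) (hB : 0 ≤ B) {M : ℕ} (hM : 1 ≤ M) (e : ℕ)
    {f : Base → ℂ} (hf : AngPeriodic W f) (hfb : DBd (univ ×ˢ W) Λ (p + e + 2) B f) :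
    DBd (univ ×ˢ W) Λ p ((2 * M + 1) ^ 3 * (B * (sumInvSq * Λ ^ (e + 2) / (M : ℝ) ^ e)))
      (fun x => f x - ∑ k ∈ box M, SRNF.harm3 k f x) := by
  have hΛ0 : 0 ≤ Λ := by linarith
  set S : Set Base := (univ : Set Ang) ×ˢ W
  have hS : IsOpen S := isOpen_univ.prod hW
  have hSv : ∀ (j : Fin 3), ∀ x ∈ S, ∀ t : ℝ, x + t • angDir j ∈ S :=
    fun (j : Fin 3) x (hx : x ∈ S) t => univ_prod_add_mem hx j t
  set τ := B * (sumInvSq * Λ ^ (e + 2) / (M : ℝ) ^ e) with hτ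
  have hτ0 : 0 ≤ τ := by have := sumInvSq_nonneg; positivity
  set Q := Finset.Icc (-M : ℤ) M with hQ
  have hcard : (Q.card : ℝ) = 2 * M + 1 := by
    rw [hQ, Int.card_Icc]
    have : ((M : ℤ) + 1 - -(M : ℤ)).toNat = 2 * M + 1 := by omega
    rw [this]; push_cast; ring
  -- one direction after the other is truncated; the later truncations act on the harmonics kept so
  -- far
  set h2 : ℤ → Base → ℂ := fun a => harm (angDir 2) a f with h2def
  set h1 : ℤ → ℤ → Base → ℂ := fun a b => harm (angDir 1) b (h2 a) with h1def
  have hper : ∀ {g : Base → ℂ} (i : Fin 3) (n : ℤ), (∀ j, ∀ x ∈ S, g (x + angDir j) = g x) →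
      ∀ j, ∀ x ∈ S, harm (angDir i) n g (x + angDir j) = harm (angDir i) n g x := by
    intro g i n hg j x hx
    exact harm_add_periodic (hSv i) (hg j) hx
  have p2 := fun a => hper 2 a hf.angDir
  have p1 := fun a b => hper 1 b (p2 a)
  have d2 : ∀ a, DBd S Λ (p + e + 2) B (h2 a) := fun a => hfb.harm hS (hSv 2) hΛ0 hB
  have d1 : ∀ a b, DBd S Λ (p + e + 2) B (h1 a b) := fun a b => (d2 a).harm hS (hSv 1) hΛ0 hB
  have t2 : DBd S Λ p τ (fun x => f x - partialSum (angDir 2) M f x) :=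
    DBd.sub_partialSum hS (hSv 2) hΛ (norm_angDir 2) hM e p hB (hf.angDir 2) hfb
  have t1 : ∀ a, DBd S Λ p τ (fun x => h2 a x - partialSum (angDir 1) M (h2 a) x) := fun a =>
    DBd.sub_partialSum hS (hSv 1) hΛ (norm_angDir 1) hM e p hB (p2 a 1) (d2 a)
  have t0 : ∀ a b, DBd S Λ p τ (fun x => h1 a b x - partialSum (angDir 0) M (h1 a b) x) :=
    fun a b => DBd.sub_partialSum hS (hSv 0) hΛ (norm_angDir 0) hM e p hB (p1 a b 0) (d1 a b)
  have s1 := DBd.sum Q hS hΛ0 fun a _ => t1 a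
  have s0 := DBd.sum Q hS hΛ0 fun a _ => DBd.sum Q hS hΛ0 fun b _ => t0 a b
  refine (((t2.add s1 hS).add s0 hS).congr hS fun x _ => ?_).mono_bound hΛ0 ?_
  · simp only [Finset.sum_sub_distrib]
    rw [sum_box]
    simp only [partialSum, harm3, h1def, h2def, hQ]
    simp only [Matrix.cons_val_zero, Matrix.cons_val_one, Matrix.cons_val]
    ring
  · rw [hcard]
    have hM0 : (0 : ℝ) ≤ M := by positivity
    have : (2 * (M : ℝ) + 1) ^ 3 * τ - (τ + (2 * M + 1) * τ + (2 * M + 1) * ((2 * M + 1) * τ))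
        = τ * ((2 * M + 1) ^ 2 * (2 * M) - (2 * M + 1) - 1) := by ring
    have h3 : (1 : ℝ) ≤ M := by exact_mod_cast hM
    have h4 : 0 ≤ (2 * (M : ℝ) + 1) ^ 2 * (2 * M) - (2 * M + 1) - 1 := by nlinarith
    nlinarith

/-- Approximate solution of the homological equation: with `N` the frequency vector (which depends
only on the actions), a periodic function `f` is the sum of a slow function `ζ`, the derivative
`-Du · N` and a remainder. The divisors `k' · N` of the harmonics that are not multiples of `k` are
bounded below by `β`. -/
theorem exists_homological_solution (hW : IsOpen W) (hΛ : 1 ≤ Λ) (hB : 0 ≤ B) {β : ℝ}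
    (hβ : 0 < β) {M : ℕ} (hM : 1 ≤ M) (e : ℕ) {k : Fin 3 → ℤ} (hk : Finset.univ.gcd k ≠ 0)
    {N : Base → Ang} (hN : ∀ x ψ, N (x + (ψ, 0)) = N x)
    (hdiv : ∀ k' ∈ box M, ¬ IsMultiple k k' →
      ContinuousOn (fun x => slow k' (N x)) (univ ×ˢ W) ∧
      DifferentiableOn ℝ (fun x => slow k' (N x)) (univ ×ˢ W) ∧
      DBd (univ ×ˢ W) Λ (p + e + 2) (β * Λ) (fderiv ℝ (fun x => slow k' (N x))) ∧
      ∀ x ∈ (univ : Set Ang) ×ˢ W, β ≤ |slow k' (N x)|)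
    {f : Base → ℝ} (hf : AngPeriodic W f) (hfb : DBd (univ ×ˢ W) Λ (p + e + 2) B f) :
    ∃ u ζ : Base → ℝ, AngPeriodic W u ∧ AngPeriodic W ζ ∧ IsSlow k W (p + e + 2) ζ ∧
      DBd (univ ×ˢ W) Λ (p + e + 2)
        ((2 * M + 1) ^ 3 * (2 ^ (p + e + 2) * (B * (2 ^ 4 ^ (p + e + 2) * β⁻¹)))) u ∧
      DBd (univ ×ˢ W) Λ (p + e + 2) ((2 * M + 1) ^ 3 * B) ζ ∧
      DBd (univ ×ˢ W) Λ p ((2 * M + 1) ^ 3 * (B * (sumInvSq * Λ ^ (e + 2) / (M : ℝ) ^ e)))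
        (fun x => f x - ζ x + fderiv ℝ u x (N x, 0)) := by
  classical
  have hΛ0 : 0 ≤ Λ := by linarith
  set S : Set Base := (univ : Set Ang) ×ˢ W
  have hS : IsOpen S := isOpen_univ.prod hW
  set P := p + e + 2 with hP
  set F : Base → ℂ := fun x => (f x : ℂ) with hF
  have hFp : AngPeriodic W F := fun φ I l hI => by simp only [hF]; rw [hf φ I l hI]
  have hFb : DBd S Λ P B F := by
    have := hfb.clm_comp hS Complex.ofRealCLM
    simpa using this
  have hre : ∀ k', DBd S Λ P B (fun x => (SRNF.harm3 k' F x).re) := fun k' => by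
    have := (hFb.harm3 hW hΛ0 hB k').clm_comp hS Complex.reCLM
    simpa using this
  have him : ∀ k', DBd S Λ P B (fun x => (SRNF.harm3 k' F x).im) := fun k' => by
    have := (hFb.harm3 hW hΛ0 hB k').clm_comp hS Complex.imCLM
    simpa using this
  have hpre : ∀ k', AngPeriodic W (SRNF.harm3 k' F) := fun k' => hFp.harm3 k'
  -- the harmonics in the box, nonresonant and resonant
  set nr := (box M).filter fun k' => ¬ IsMultiple k k' with hnr
  set rs := (box M).filter fun k' => IsMultiple k k' with hrs
  have hcnr : ((nr.card : ℕ) : ℝ) ≤ (2 * M + 1) ^ 3 := by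
    rw [← card_box]; exact_mod_cast Finset.card_filter_le _ _
  have hcrs : ((rs.card : ℕ) : ℝ) ≤ (2 * M + 1) ^ 3 := by
    rw [← card_box]; exact_mod_cast Finset.card_filter_le _ _
  set uk : (Fin 3 → ℤ) → Base → ℝ := fun k' x =>
    -(2 * Real.pi)⁻¹ * ((SRNF.harm3 k' F x).im * (slow k' (N x))⁻¹) with huk
  have hpi : (2 * Real.pi)⁻¹ ≤ 1 := inv_le_one_of_one_le₀ (by linarith [Real.pi_gt_three])
  have hpi0 : 0 < (2 * Real.pi)⁻¹ := by positivity
  set Bu := 2 ^ P * (B * (2 ^ 4 ^ P * β⁻¹)) with hBu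
  have hBu0 : 0 ≤ Bu := by positivity
  have hinv : ∀ k' ∈ nr, DBd S Λ P (2 ^ 4 ^ P * β⁻¹) (fun x => (slow k' (N x))⁻¹) := by
    intro k' hk'
    obtain ⟨h1, h2, h3, h4⟩ := hdiv k' (Finset.mem_filter.1 hk').1 (Finset.mem_filter.1 hk').2
    exact DBd.inv hS hΛ0 hβ P h1 (fun j hj => ⟨h2, h3.mono_order (by omega)⟩) h4
  have hukb : ∀ k' ∈ nr, DBd S Λ P Bu (uk k') := by
    intro k' hk'
    have h5 := (him k').mul (hinv k' hk') hS hΛ0 hB (by positivity)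
    have h6 := h5.clm_comp hS (-(2 * Real.pi)⁻¹ • ContinuousLinearMap.id ℝ ℝ)
    refine DBd.mono_bound h6 hΛ0 ?_
    have h7 : ‖(-(2 * Real.pi)⁻¹ • ContinuousLinearMap.id ℝ ℝ : ℝ →L[ℝ] ℝ)‖ ≤ 1 := by
      refine ContinuousLinearMap.opNorm_le_bound _ zero_le_one fun y => ?_
      simp only [smul_apply, ContinuousLinearMap.id_apply, norm_smul, norm_neg,
        Real.norm_eq_abs, abs_of_pos hpi0]
      nlinarith [abs_nonneg y]
    calc _ ≤ 1 * Bu := mul_le_mul_of_nonneg_right h7 hBu0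
      _ = Bu := one_mul _
  -- the derivative of each term along the frequency vector cancels one harmonic
  have hduk : ∀ k' ∈ nr, ∀ x ∈ S, fderiv ℝ (uk k') x (N x, 0) = -(SRNF.harm3 k' F x).re := by
    intro k' hk' x hx
    have hne : slow k' (N x) ≠ 0 := fun h0 => by
      obtain ⟨_, _, _, h4⟩ := hdiv k' (Finset.mem_filter.1 hk').1 (Finset.mem_filter.1 hk').2
      have := h4 x hx
      rw [h0, abs_zero] at this
      linarith
    have hdh : HasFDerivAt (SRNF.harm3 k' F) (fderiv ℝ (SRNF.harm3 k' F) x) x :=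
      ((hFb.harm3 hW hΛ0 hB k').differentiableAt hS (by omega) hx).hasFDerivAt
    have hd1 := Complex.imCLM.hasFDerivAt.comp x hdh
    have hdi : HasFDerivAt (fun x => (slow k' (N x))⁻¹)
        (fderiv ℝ (fun x => (slow k' (N x))⁻¹) x) x :=
      ((hinv k' hk').differentiableAt hS (by omega) hx).hasFDerivAt
    have h0 : fderiv ℝ (fun x => (slow k' (N x))⁻¹) x (N x, 0) = 0 := by
      have hline : HasDerivAt (fun a : ℝ => x + a • ((N x, 0) : Base)) (N x, 0) 0 := by
        simpa using ((hasDerivAt_id (0 : ℝ)).smul_const ((N x, 0) : Base)).const_add x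
      have h8 : HasDerivAt (fun a : ℝ => (slow k' (N (x + a • ((N x, 0) : Base))))⁻¹)
          (fderiv ℝ (fun x => (slow k' (N x))⁻¹) x (N x, 0)) 0 := by
        have h1' : HasFDerivAt (fun x => (slow k' (N x))⁻¹)
            (fderiv ℝ (fun x => (slow k' (N x))⁻¹) x) (x + (0 : ℝ) • ((N x, 0) : Base)) := by
          simpa using hdi
        exact h1'.comp_hasDerivAt 0 hline
      have h9 : (fun a : ℝ => (slow k' (N (x + a • ((N x, 0) : Base))))⁻¹)
          = fun _ => (slow k' (N x))⁻¹ := by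
        funext a
        have : a • ((N x, 0) : Base) = (a • N x, 0) := by simp
        rw [this, hN]
      rw [h9] at h8
      exact h8.unique (hasDerivAt_const _ _)
    have hd2 := ((hd1.mul hdi).const_mul (-(2 * Real.pi)⁻¹)).fderiv
    have hd3 : fderiv ℝ (uk k') x = _ := hd2
    rw [hd3]
    simp only [smul_apply, add_apply, Function.comp_apply, smul_eq_mul,
      ContinuousLinearMap.comp_apply, h0, Complex.imCLM_apply,
      fderiv_harm3 hW hΛ0 hB k' hFp (hFb.mono_order (by omega)) hx.2 (N x)]
    have : (2 * Real.pi * slow k' (N x) * Complex.I * SRNF.harm3 k' F x : ℂ).im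
        = 2 * Real.pi * slow k' (N x) * (SRNF.harm3 k' F x).re := by
      simp [Complex.mul_im, Complex.mul_re]
    rw [this]
    field_simp
    ring
  refine ⟨fun x => ∑ k' ∈ nr, uk k' x, fun x => ∑ k' ∈ rs, (SRNF.harm3 k' F x).re,
    AngPeriodic.sum _ fun k' _ φ I l hI => ?_, AngPeriodic.sum _ fun k' _ φ I l hI => ?_,
    IsSlow.sum _ fun k' hk' => ?_, ?_, ?_, ?_⟩
  · simp only [huk]
    rw [hpre k' φ I l hI]
    have : ((φ + intVec l, I) : Base) = (φ, I) + (intVec l, 0) := by simp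
    rw [this, hN]
  · rw [hpre k' φ I l hI]
  · exact isSlow_harm3 hW hΛ0 hB hk (Finset.mem_filter.1 hk').2 hFp hFb
  · exact (DBd.sum nr hS hΛ0 hukb).mono_bound hΛ0 (mul_le_mul_of_nonneg_right hcnr hBu0)
  · exact (DBd.sum rs hS hΛ0 fun k' _ => hre k').mono_bound hΛ0
      (mul_le_mul_of_nonneg_right hcrs hB)
  · have h1 := (dBd_sub_sum_box hW hΛ hB hM e hFp hFb).clm_comp hS Complex.reCLM
    rw [Complex.reCLM_norm, one_mul] at h1
    refine h1.congr hS fun x hx => ?_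
    have h2 : fderiv ℝ (fun x => ∑ k' ∈ nr, uk k' x) x (N x, 0)
        = -∑ k' ∈ nr, (SRNF.harm3 k' F x).re := by
      have h3 : HasFDerivAt (fun x => ∑ k' ∈ nr, uk k' x) (∑ k' ∈ nr, fderiv ℝ (uk k') x) x :=
        HasFDerivAt.fun_sum fun k' hk' =>
          ((hukb k' hk').differentiableAt hS (by omega) hx).hasFDerivAt
      rw [h3.fderiv, sum_apply, ← Finset.sum_neg_distrib]
      exact Finset.sum_congr rfl fun k' hk' => hduk k' hk' x hx
    simp only [h2, Complex.reCLM_apply, Complex.sub_re, Complex.re_sum, hF, Complex.ofReal_re]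
    have h4 := Finset.sum_filter_add_sum_filter_not (box M) (fun k' => IsMultiple k k')
      fun k' => (SRNF.harm3 k' F x).re
    rw [← h4]
    simp only [hrs, hnr]
    ring

end Homological

/-! ### Approximate solution of the Hamilton-Jacobi equation -/

section SecondIncrement

variable {E : Type} [NormedAddCommGroup E] [NormedSpace ℝ E] {S S' : Set E} {Λ : ℝ}

/-- Every point of the segment between two maps satisfies the bound for their sum. -/
theorem DBd.add_smul {F : Type} [NormedAddCommGroup F] [NormedSpace ℝ F] {p : ℕ} {α ω t : ℝ}
    {a w : E → F} (hS : IsOpen S) (hΛ : 0 ≤ Λ) (hω : 0 ≤ ω) (ht : t ∈ Icc (0 : ℝ) 1)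
    (ha : DBd S Λ p α a) (hw : DBd S Λ p ω w) :
    DBd S Λ p (α + ω) (fun x => a x + t • w x) := by
  have h2 := hw.clm_comp hS (t • ContinuousLinearMap.id ℝ F)
  refine (ha.add h2 hS).mono_bound hΛ ?_
  have h3 : ‖t • ContinuousLinearMap.id ℝ F‖ ≤ 1 := by
    refine (norm_smul_le t (ContinuousLinearMap.id ℝ F)).trans ?_
    rw [Real.norm_eq_abs, abs_of_nonneg ht.1]
    have := ContinuousLinearMap.norm_id_le (𝕜 := ℝ) (E := F)
    nlinarith [ht.1, ht.2, norm_nonneg (ContinuousLinearMap.id ℝ F)]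
  nlinarith [norm_nonneg (t • ContinuousLinearMap.id ℝ F)]

/-- The increment of `g` between `x + a` and `x + a + w`, for small `a` and `w` and `g` defined on
a unit neighbourhood. -/
theorem DBd.increment_of_margin {F : Type} [NormedAddCommGroup F] [NormedSpace ℝ F]
    [CompleteSpace F] {p : ℕ} {B α ω : ℝ}
    {g : E → F} {a w : E → E} (hS : IsOpen S) (hS' : IsOpen S') (hΛ : 1 ≤ Λ) (hB : 0 ≤ B)
    (hα : 0 ≤ α) (hω : 0 ≤ ω) (hg : ContDiffOn ℝ (p + 1 : ℕ) g S')
    (hDg : DBd S' Λ p B (_root_.fderiv ℝ g))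
    (ha : DBd S Λ p α a) (hw : DBd S Λ p ω w) (hαω : α + ω ≤ Λ⁻¹ / 4)
    (hmargin : ∀ x ∈ S, ∀ d : E, ‖d‖ ≤ 1 → x + d ∈ S') :
    DBd S Λ p (4 ^ ((p + 1) ^ 2) * (B * ω)) (fun x => g (x + (a x + w x)) - g (x + a x)) := by
  have hΛ0 : 0 ≤ Λ := by linarith
  have hinv : Λ⁻¹ ≤ 1 := inv_le_one_of_one_le₀ hΛ
  have hinv0 : 0 < Λ⁻¹ := inv_pos.2 (by linarith)
  refine DBd.increment hS hS' hΛ hB hω hg hDg (ha.mono_bound hΛ0 (by linarith)) hw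
    (by linarith) fun t ht x hx => hmargin x hx _ ?_
  have h1 := ha.norm_le hx
  have h2 := hw.norm_le hx
  have h3 : ‖t • w x‖ ≤ 2 * ω := by
    rw [norm_smul, Real.norm_eq_abs]
    have : |t| ≤ 2 := abs_le.2 ⟨by linarith [ht.1], ht.2.le⟩
    nlinarith [norm_nonneg (w x), abs_nonneg t]
  have := norm_add_le (a x) (t • w x)
  linarith

/-- The increment of `g` beyond its linear part at `x` is quadratically small. -/
theorem DBd.increment_sub_linear {F : Type} [NormedAddCommGroup F] [NormedSpace ℝ F]
    [CompleteSpace F] {p : ℕ} {B α ω : ℝ}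
    {g : E → F} {a w : E → E} (hS : IsOpen S) (hS' : IsOpen S') (hΛ : 1 ≤ Λ) (hB : 0 ≤ B)
    (hα : 0 ≤ α) (hω : 0 ≤ ω) (hg : ContDiffOn ℝ (p + 2 : ℕ) g S')
    (hDg : DBd S' Λ p B (_root_.fderiv ℝ (_root_.fderiv ℝ g)))
    (ha : DBd S Λ p α a) (hw : DBd S Λ p ω w) (hαω : α + ω ≤ Λ⁻¹ / 4)
    (hmargin : ∀ x ∈ S, ∀ d : E, ‖d‖ ≤ 1 → x + d ∈ S') :
    DBd S Λ p (2 ^ p * (4 ^ ((p + 1) ^ 2) * (B * (α + ω)) * ω))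
      (fun x => g (x + (a x + w x)) - g (x + a x) - _root_.fderiv ℝ g x (w x)) := by
  have hΛ0 : 0 ≤ Λ := by linarith
  have hinv : Λ⁻¹ ≤ 1 := inv_le_one_of_one_le₀ hΛ
  have hinv0 : 0 < Λ⁻¹ := inv_pos.2 (by linarith)
  have hSS' : S ⊆ S' := fun x hx => by simpa using hmargin x hx 0 (by simp)
  have hg1 : ContDiffOn ℝ (p + 1 : ℕ) (_root_.fderiv ℝ g) S' :=
    hg.fderiv_of_isOpen hS' (by norm_cast)
  have hIcc : Icc (0 : ℝ) 1 ⊆ Ioo (-1 : ℝ) 2 := fun t ht =>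
    ⟨by linarith [ht.1], by linarith [ht.2]⟩
  have hmaps : ∀ t ∈ Ioo (-1 : ℝ) 2, ∀ x ∈ S, x + (a x + t • w x) ∈ S' := by
    intro t ht x hx
    refine hmargin x hx _ ?_
    have h1 := ha.norm_le hx
    have h2 := hw.norm_le hx
    have h3 : ‖t • w x‖ ≤ 2 * ω := by
      rw [norm_smul, Real.norm_eq_abs]
      have : |t| ≤ 2 := abs_le.2 ⟨by linarith [ht.1], ht.2.le⟩
      nlinarith [norm_nonneg (w x), abs_nonneg t]
    have := norm_add_le (a x) (t • w x)
    linarith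
  set f : ℝ → E → F := fun t x =>
    (_root_.fderiv ℝ g (x + (a x + t • w x)) - _root_.fderiv ℝ g x) (w x)
  have hpt : ∀ t ∈ Icc (0 : ℝ) 1,
      DBd S Λ p (2 ^ p * (4 ^ ((p + 1) ^ 2) * (B * (α + ω)) * ω)) (f t) := by
    intro t ht
    have h1 : DBd S Λ p (α + ω) (fun x => a x + t • w x) := DBd.add_smul hS hΛ0 hω ht ha hw
    have h2 := DBd.increment_of_margin (a := fun _ => (0 : E)) (w := fun x => a x + t • w x)
      (α := 0) hS hS' hΛ hB le_rfl (by positivity) hg1 hDg (DBd.zero hΛ0 le_rfl) h1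
      (by linarith) hmargin
    simp only [zero_add, add_zero] at h2
    exact h2.clm_apply hw hS hΛ0 (by positivity) hω
  have hsm : ContDiffOn ℝ p (fun z : ℝ × E => f z.1 z.2) (Ioo (-1 : ℝ) 2 ×ˢ S) := by
    have hsnd : MapsTo (fun z : ℝ × E => z.2) (Ioo (-1 : ℝ) 2 ×ˢ S) S := fun z hz => hz.2
    have ha' := ha.1.comp (contDiff_snd.contDiffOn) hsnd
    have hw' := hw.1.comp (contDiff_snd.contDiffOn) hsnd
    have h1 : ContDiffOn ℝ p (fun z : ℝ × E => z.2 + (a z.2 + z.1 • w z.2))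
        (Ioo (-1 : ℝ) 2 ×ˢ S) :=
      contDiff_snd.contDiffOn.add (ha'.add (contDiff_fst.contDiffOn.smul hw'))
    have hg2 : ContDiffOn ℝ p (_root_.fderiv ℝ g) S' := hg1.of_le (by norm_cast; omega)
    have h2 := hg2.comp h1 fun z hz => hmaps z.1 hz.1 z.2 hz.2
    have h3 := (hg2.mono hSS').comp (contDiff_snd.contDiffOn) hsnd
    exact (h2.sub h3).clm_apply hw'
  refine (DBd.integral hS isOpen_Ioo hIcc p hsm hpt).congr hS fun x hx => ?_
  have hder : ∀ t ∈ uIcc (0 : ℝ) 1,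
      HasDerivAt (fun t : ℝ => g (x + (a x + t • w x)) - t • _root_.fderiv ℝ g x (w x))
        (f t x) t := by
    intro t ht
    rw [uIcc_of_le zero_le_one] at ht
    have h1 : DifferentiableAt ℝ g (x + (a x + t • w x)) :=
      (hg.contDiffAt (hS'.mem_nhds (hmaps t (hIcc ht) x hx))).differentiableAt (by simp)
    have h2 : HasDerivAt (fun t : ℝ => x + (a x + t • w x)) (w x) t := by
      simpa using (((hasDerivAt_id t).smul_const (w x)).const_add (a x)).const_add x
    have h3 := (h1.hasFDerivAt.comp_hasDerivAt t h2).sub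
      ((hasDerivAt_id t).smul_const (_root_.fderiv ℝ g x (w x)))
    rw [one_smul] at h3
    exact h3
  have := intervalIntegral.integral_eq_sub_of_hasDerivAt hder
    (intervalIntegrable_of_continuousOn_prod hIcc hsm.continuousOn hx)
  simp only [one_smul, zero_smul, add_zero, sub_zero] at this
  exact (this.trans (by abel)).symm

end SecondIncrement

section HamiltonJacobi

/-- The unit vector of the `j`-th action. -/
def actDir (j : Fin 2) : Base := (0, EuclideanSpace.single j 1)

theorem norm_actDir (j : Fin 2) : ‖actDir j‖ ≤ 1 := by
  simp [actDir, Prod.norm_def]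

/-- The displacement `(0, ∂_φ χ)` of the actions, as a linear function of `Dχ`. -/
def actShift : (Base →L[ℝ] ℝ) →L[ℝ] Base :=
  (ContinuousLinearMap.apply ℝ ℝ (angDir 0)).smulRight (actDir 0) +
    (ContinuousLinearMap.apply ℝ ℝ (angDir 1)).smulRight (actDir 1)

/-- The displacement `(∂_J χ, 0)` of the angles (not of time), as a linear function of `Dχ`. -/
def angShift : (Base →L[ℝ] ℝ) →L[ℝ] Base :=
  (ContinuousLinearMap.apply ℝ ℝ (actDir 0)).smulRight (angDir 0) +
    (ContinuousLinearMap.apply ℝ ℝ (actDir 1)).smulRight (angDir 1)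

theorem actShift_apply (ℓ : Base →L[ℝ] ℝ) :
    actShift ℓ = ℓ (angDir 0) • actDir 0 + ℓ (angDir 1) • actDir 1 := by
  simp [actShift]

theorem angShift_apply (ℓ : Base →L[ℝ] ℝ) :
    angShift ℓ = ℓ (actDir 0) • angDir 0 + ℓ (actDir 1) • angDir 1 := by
  simp [angShift]

theorem norm_apply_smul_le (ℓ : Base →L[ℝ] ℝ) {v w : Base} (hv : ‖v‖ ≤ 1) (hw : ‖w‖ ≤ 1) :
    ‖ℓ v • w‖ ≤ ‖ℓ‖ := by
  rw [norm_smul]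
  have h1 : ‖ℓ v‖ ≤ ‖ℓ‖ := (ℓ.le_opNorm v).trans (mul_le_of_le_one_right (norm_nonneg _) hv)
  exact (mul_le_of_le_one_right (norm_nonneg _) hw).trans h1

theorem norm_actShift_le : ‖actShift‖ ≤ 2 := by
  refine ContinuousLinearMap.opNorm_le_bound _ zero_le_two fun ℓ => ?_
  rw [actShift_apply]
  have h1 := norm_apply_smul_le ℓ (norm_angDir 0) (norm_actDir 0)
  have h2 := norm_apply_smul_le ℓ (norm_angDir 1) (norm_actDir 1)
  exact (norm_add_le _ _).trans (by linarith)

theorem norm_angShift_le : ‖angShift‖ ≤ 2 := by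
  refine ContinuousLinearMap.opNorm_le_bound _ zero_le_two fun ℓ => ?_
  rw [angShift_apply]
  have h1 := norm_apply_smul_le ℓ (norm_actDir 0) (norm_angDir 0)
  have h2 := norm_apply_smul_le ℓ (norm_actDir 1) (norm_angDir 1)
  exact (norm_add_le _ _).trans (by linarith)

/-- The frequency vector `(∂_I h, 1)` of the integrable Hamiltonian `h`. -/
def freqVec (h : Base → ℝ) (x : Base) : Ang :=
  WithLp.toLp 2 ![fderiv ℝ h x (actDir 0), fderiv ℝ h x (actDir 1), 1]

/-- The derivative along the unperturbed flow splits into the part seen by `h` and the time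
derivative. -/
theorem apply_freqVec (h : Base → ℝ) (x : Base) (ℓ : Base →L[ℝ] ℝ) :
    ℓ (freqVec h x, 0) = fderiv ℝ h x (actShift ℓ) + ℓ (angDir 2) := by
  rw [angle_eq_sum, actShift_apply]
  simp only [map_add, map_smul, smul_eq_mul, freqVec]
  simp only [Matrix.cons_val_zero, Matrix.cons_val_one, Matrix.cons_val]
  ring

/-- The defect of the Hamilton-Jacobi equation for the generating function `J · φ + χ` and the
normal form `h(J) + z`, both in the variables `(φ, J)`; here `I = J + ∂_φ χ` and
`ψ = φ + ∂_J χ`. -/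
def hjDefect (h R χ z : Base → ℝ) (x : Base) : ℝ :=
  h (x + actShift (fderiv ℝ χ x)) - h x + R (x + actShift (fderiv ℝ χ x))
    + fderiv ℝ χ x (angDir 2) - z (x + angShift (fderiv ℝ χ x))

variable {W W' : Set Act} {Λ : ℝ}

theorem fderiv_add_angle {F : Type} [NormedAddCommGroup F] [NormedSpace ℝ F] {f : Base → F}
    {c : Base} (hW : IsOpen W) {x : Base} (hx : x.2 ∈ W)
    (hf : ∀ x : Base, x.2 ∈ W → f (x + c) = f x) : fderiv ℝ f (x + c) = fderiv ℝ f x := by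
  rw [← fderiv_comp_add_right]
  exact Filter.EventuallyEq.fderiv_eq
    (Filter.eventuallyEq_of_mem ((isOpen_univ.prod hW).mem_nhds ⟨mem_univ _, hx⟩)
      fun y hy => hf y hy.2)

theorem AngPeriodic.add_eq {F : Type} {f : Base → F} (hf : AngPeriodic W f) (l : Fin 3 → ℤ)
    {x : Base} (hx : x.2 ∈ W) : f (x + (intVec l, 0)) = f x := by
  have := hf x.1 x.2 l hx
  rw [← this]
  congr 1
  ext <;> simp

theorem AngPeriodic.of_add_eq {F : Type} {f : Base → F}
    (h : ∀ (l : Fin 3 → ℤ) (x : Base), x.2 ∈ W → f (x + (intVec l, 0)) = f x) :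
    AngPeriodic W f := by
  intro φ I l hI
  rw [← h l (φ, I) hI]
  congr 1
  simp

theorem AngPeriodic.fderiv {f : Base → ℝ} (hW : IsOpen W) (hf : AngPeriodic W f)
    (l : Fin 3 → ℤ) {x : Base} (hx : x.2 ∈ W) :
    _root_.fderiv ℝ f (x + (intVec l, 0)) = _root_.fderiv ℝ f x :=
  fderiv_add_angle hW hx fun _ hy => hf.add_eq l hy

theorem actShift_fst (ℓ : Base →L[ℝ] ℝ) : (actShift ℓ).1 = 0 := by
  simp [actShift_apply, actDir]

theorem angShift_snd (ℓ : Base →L[ℝ] ℝ) : (angShift ℓ).2 = 0 := by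
  simp [angShift_apply, angDir]

end HamiltonJacobi

section Iteration

/-- The data of the iteration: an integrable Hamiltonian `h` and a perturbation `R` of size `B₀`
on `𝕋³ × W'`, with the divisors of the harmonics in the box of size `M` bounded below by `β` on
`W`, whose unit neighbourhood lies in `W'`. There is no loss of domain in the iteration: the shifts
of the actions stay below one, and only `h` and `R` are evaluated at shifted actions. -/
structure IterData (k : Fin 3 → ℤ) (W W' : Set Act) (Λ β B₀ : ℝ) (M Q : ℕ)
    (h R : Base → ℝ) : Prop where
  isOpen : IsOpen W
  isOpen' : IsOpen W'
  margin : ∀ J ∈ W, ∀ d : Act, ‖d‖ ≤ 1 → J + d ∈ W'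
  gcd_ne : Finset.univ.gcd k ≠ 0
  one_le : 1 ≤ Λ
  pos : 0 < β
  le_one : β ≤ 1
  one_le_M : 1 ≤ M
  nonneg : 0 ≤ B₀
  indep : ∀ (x : Base) (ψ : Ang), h (x + (ψ, 0)) = h x
  smooth : ContDiffOn ℝ (Q + 2 : ℕ) h (univ ×ˢ W')
  hess : DBd (univ ×ˢ W') Λ Q 1 (fderiv ℝ (fderiv ℝ h))
  bound : DBd (univ ×ˢ W') Λ (Q + 1) B₀ R
  periodic : AngPeriodic W' R
  divisor : ∀ k' ∈ box M, ¬ IsMultiple k k' →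
    DifferentiableOn ℝ (fun x => slow k' (freqVec h x)) (univ ×ˢ W) ∧
    DBd (univ ×ˢ W) Λ Q (β * Λ) (fderiv ℝ (fun x => slow k' (freqVec h x))) ∧
    ∀ x ∈ (univ : Set Ang) ×ˢ W, β ≤ |slow k' (freqVec h x)|

/-- The factor lost in one solution of the homological equation: the number of harmonics times the
weighted bound of the inverse divisors. -/
def homCost (β : ℝ) (M Q : ℕ) : ℝ := (2 * M + 1) ^ 3 * (2 ^ Q * (2 ^ 4 ^ Q * β⁻¹))

theorem le_homCost {β : ℝ} (hβ : 0 < β) (hβ1 : β ≤ 1) (M Q : ℕ) :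
    (2 * (M : ℝ) + 1) ^ 3 ≤ homCost β M Q := by
  have h1 : (1 : ℝ) ≤ 2 ^ Q := one_le_pow₀ (by norm_num)
  have h2 : (1 : ℝ) ≤ 2 ^ 4 ^ Q := one_le_pow₀ (by norm_num)
  have h3 : (1 : ℝ) ≤ β⁻¹ := (one_le_inv₀ hβ).2 hβ1
  have h4 : (1 : ℝ) ≤ 2 ^ Q * (2 ^ 4 ^ Q * β⁻¹) :=
    one_le_mul_of_one_le_of_one_le h1 (one_le_mul_of_one_le_of_one_le h2 h3)
  exact le_mul_of_one_le_right (by positivity) h4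

theorem one_le_homCost {β : ℝ} (hβ : 0 < β) (hβ1 : β ≤ 1) (M Q : ℕ) : 1 ≤ homCost β M Q := by
  refine le_trans ?_ (le_homCost hβ hβ1 M Q)
  exact one_le_pow₀ (by have : (0 : ℝ) ≤ M := by positivity
                        linarith)

/-- The factor by which the Fourier tail beyond the box of size `M` is smaller than the function. -/
def tailFactor (Λ : ℝ) (M e : ℕ) : ℝ :=
  (2 * M + 1) ^ 3 * (sumInvSq * Λ ^ (e + 2) / (M : ℝ) ^ e)

theorem tailFactor_nonneg {Λ : ℝ} (hΛ : 0 ≤ Λ) (M e : ℕ) : 0 ≤ tailFactor Λ M e := by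
  have := sumInvSq_nonneg
  unfold tailFactor
  positivity

/-- The constant in the gain of one step, from the composition and product estimates up to order
`Q`. -/
def stepConst (Q : ℕ) : ℝ := 10 * (2 ^ Q * 4 ^ ((Q + 1) ^ 2))

variable {k : Fin 3 → ℤ} {W W' : Set Act} {Λ β B₀ : ℝ} {M Q : ℕ} {h R : Base → ℝ}

/-- A stage of the iteration: the generating function `χ` and the slow function `z` solve the
Hamilton-Jacobi equation up to a smooth part `f`, of size `m`, and a rough part `τ`, of size `t`.
The rough part collects the Fourier tails; it has only two derivatives and is never corrected. -/
structure IterStage (k : Fin 3 → ℤ) (W : Set Act) (Λ : ℝ) (h R : Base → ℝ) (q : ℕ)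
    (A m t : ℝ) (χ z f τ : Base → ℝ) : Prop where
  per_χ : AngPeriodic W χ
  per_z : AngPeriodic W z
  per_f : AngPeriodic W f
  slow_z : IsSlow k W q z
  bd_χ : DBd (univ ×ˢ W) Λ q A χ
  bd_z : DBd (univ ×ˢ W) Λ q A z
  bd_f : DBd (univ ×ˢ W) Λ q m f
  bd_τ : DBd (univ ×ˢ W) Λ 2 t τ
  eqn : ∀ x ∈ (univ : Set Ang) ×ˢ W, hjDefect h R χ z x = f x + τ x

theorem IterData.margin_base (D : IterData k W W' Λ β B₀ M Q h R) :
    ∀ x ∈ (univ : Set Ang) ×ˢ W, ∀ d : Base, ‖d‖ ≤ 1 → x + d ∈ (univ : Set Ang) ×ˢ W' :=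
  fun x hx d hd => ⟨mem_univ _, D.margin x.2 hx.2 d.2 ((norm_snd_le d).trans hd)⟩

theorem IterData.subset (D : IterData k W W' Λ β B₀ M Q h R) : W ⊆ W' :=
  fun J hJ => by simpa using D.margin J hJ 0 (by simp)

set_option maxHeartbeats 1000000 in
/-- One step of the iteration. The new generating function and the new slow function solve the
homological equation for the smooth part `f` of the defect; the new smooth part consists of the
terms that are nonlinear in the corrections. -/
theorem IterStage.step (D : IterData k W W' Λ β B₀ M Q h R) {e q : ℕ} (heq : e + 4 ≤ q + 1)
    (hqQ : q + 1 ≤ Q) {A m t : ℝ} (hA : 0 ≤ A) (hm : 0 ≤ m) {χ z f τ : Base → ℝ}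
    (hst : IterStage k W Λ h R (q + 1) A m t χ z f τ)
    (hsmall : 2 * Λ * (A + homCost β M Q * m) ≤ Λ⁻¹ / 4) :
    ∃ χ' z' f' τ' : Base → ℝ, IterStage k W Λ h R q (A + homCost β M Q * m)
      (stepConst Q * Λ ^ 2 * (A + homCost β M Q * m + B₀) * (homCost β M Q * m))
      (t + tailFactor Λ M e * m) χ' z' f' τ' := by
  have hΛ := D.one_le
  have hΛ0 : 0 ≤ Λ := by linarith
  have hinv0 : 0 < Λ⁻¹ := inv_pos.2 (by linarith)
  have hinv1 : Λ⁻¹ ≤ 1 := inv_le_one_of_one_le₀ hΛ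
  have hB₀ := D.nonneg
  set S : Set Base := (univ : Set Ang) ×ˢ W with hSdef
  set S' : Set Base := (univ : Set Ang) ×ˢ W' with hSdef'
  have hS : IsOpen S := isOpen_univ.prod D.isOpen
  have hS' : IsOpen S' := isOpen_univ.prod D.isOpen'
  set c := homCost β M Q with hc
  have hc1 : 1 ≤ c := one_le_homCost D.pos D.le_one M Q
  have hcm : 0 ≤ c * m := by positivity
  have hN : ∀ x ψ, freqVec h (x + (ψ, 0)) = freqVec h x := by
    intro x ψ
    have : fderiv ℝ h (x + (ψ, 0)) = fderiv ℝ h x := by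
      rw [← fderiv_comp_add_right]
      congr 1
      funext y
      exact D.indep y ψ
    simp only [freqVec, this]
  -- the homological equation, at the full order `q + 1`
  obtain ⟨e', he'⟩ : ∃ e', q + 1 = e' + e + 2 := ⟨q + 1 - (e + 2), by omega⟩
  have hfb := hst.bd_f
  rw [he'] at hfb
  obtain ⟨u, ζ, hu, hζ, hζs, hub, hζb, htb⟩ := exists_homological_solution (p := e')
    D.isOpen hΛ hm D.pos D.one_le_M e D.gcd_ne hN
    (fun k' hk' hnk => by
      obtain ⟨h1, h2, h3⟩ := D.divisor k' hk' hnk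
      exact ⟨h1.continuousOn, h1, h2.mono_order (by omega), h3⟩) hst.per_f hfb
  rw [← he'] at hub hζb hζs
  have hub : DBd S Λ (q + 1) (c * m) u := by
    refine hub.mono_bound hΛ0 ?_
    have h1 : (2 : ℝ) ^ (q + 1) ≤ 2 ^ Q := pow_le_pow_right₀ (by norm_num) hqQ
    have h2 : (2 : ℝ) ^ 4 ^ (q + 1) ≤ 2 ^ 4 ^ Q :=
      pow_le_pow_right₀ (by norm_num) (Nat.pow_le_pow_right (by norm_num) hqQ)
    have h3 : 0 ≤ β⁻¹ := inv_nonneg.2 D.pos.le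
    calc _ ≤ (2 * (M : ℝ) + 1) ^ 3 * (2 ^ Q * (m * (2 ^ 4 ^ Q * β⁻¹))) := by gcongr
      _ = c * m := by rw [hc, homCost]; ring
  have hζb : DBd S Λ (q + 1) (c * m) ζ :=
    hζb.mono_bound hΛ0 (mul_le_mul_of_nonneg_right (le_homCost D.pos D.le_one M Q) hm)
  have htb : DBd S Λ 2 (tailFactor Λ M e * m)
      (fun x => f x - ζ x + fderiv ℝ u x (freqVec h x, 0)) := by
    refine (htb.mono_order (by omega)).mono_bound hΛ0 (le_of_eq ?_)
    rw [tailFactor]; ring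
  -- the shifts
  set a : Base → Base := fun x => actShift (fderiv ℝ χ x) with ha
  set w : Base → Base := fun x => actShift (fderiv ℝ u x) with hw
  set b : Base → Base := fun x => angShift (fderiv ℝ χ x) with hb
  set v : Base → Base := fun x => angShift (fderiv ℝ u x) with hv
  have hab : DBd S Λ q (2 * Λ * A) a := by
    refine ((hst.bd_χ.fderiv hS).clm_comp hS actShift).mono_bound hΛ0 ?_
    have := norm_actShift_le
    nlinarith [mul_nonneg hA hΛ0]
  have hwb : DBd S Λ q (2 * Λ * (c * m)) w := by
    refine ((hub.fderiv hS).clm_comp hS actShift).mono_bound hΛ0 ?_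
    have := norm_actShift_le
    nlinarith [mul_nonneg hcm hΛ0]
  have hbb : DBd S Λ q (2 * Λ * A) b := by
    refine ((hst.bd_χ.fderiv hS).clm_comp hS angShift).mono_bound hΛ0 ?_
    have := norm_angShift_le
    nlinarith [mul_nonneg hA hΛ0]
  have hvb : DBd S Λ q (2 * Λ * (c * m)) v := by
    refine ((hub.fderiv hS).clm_comp hS angShift).mono_bound hΛ0 ?_
    have := norm_angShift_le
    nlinarith [mul_nonneg hcm hΛ0]
  have hA2 : 0 ≤ 2 * Λ * A := by positivity
  have hc2 : 0 ≤ 2 * Λ * (c * m) := by positivity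
  have hsm : 2 * Λ * A + 2 * Λ * (c * m) ≤ Λ⁻¹ / 4 := by linarith
  have hpow : ∀ j, j ≤ Q → (4 : ℝ) ^ ((j + 1) ^ 2) ≤ 4 ^ ((Q + 1) ^ 2) := fun j hj =>
    pow_le_pow_right₀ (by norm_num) (Nat.pow_le_pow_left (by omega) 2)
  set C : ℝ := 2 ^ Q * 4 ^ ((Q + 1) ^ 2) with hC
  have hC4 : (4 : ℝ) ^ ((q + 1) ^ 2) ≤ C := by
    refine (hpow q (by omega)).trans (le_mul_of_one_le_left (by positivity) ?_)
    exact one_le_pow₀ (by norm_num)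
  have hC24 : (2 : ℝ) ^ q * 4 ^ ((q + 1) ^ 2) ≤ C :=
    mul_le_mul (pow_le_pow_right₀ (by norm_num) (by omega)) (hpow q (by omega))
      (by positivity) (by positivity)
  have hC0 : 0 ≤ C := by positivity
  -- the four nonlinear terms, all at most `(A + c m + B₀) * (c m)` up to a constant and `Λ ^ 2`;
  -- the Taylor remainder of `h`, the increments of `R` and of `z` due to the correction, and the
  -- increment of the new part `ζ` of the normal form due to the whole shift of the angles
  have T1 : DBd S Λ q (4 * C * Λ ^ 2 * (A + c * m) * (c * m))
      (fun x => h (x + (a x + w x)) - h (x + a x) - fderiv ℝ h x (w x)) := by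
    refine (DBd.increment_sub_linear hS hS' hΛ zero_le_one hA2 hc2
      (D.smooth.of_le (by norm_cast; omega)) (D.hess.mono_order (by omega)) hab hwb hsm
      D.margin_base).mono_bound hΛ0 ?_
    calc _ = 4 * (2 ^ q * 4 ^ ((q + 1) ^ 2)) * Λ ^ 2 * (A + c * m) * (c * m) := by ring
      _ ≤ _ := by gcongr
  have T2 : DBd S Λ q (2 * C * Λ ^ 2 * B₀ * (c * m))
      (fun x => R (x + (a x + w x)) - R (x + a x)) := by
    have hR : DBd S' Λ (q + 1) B₀ R := D.bound.mono_order (by omega)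
    refine (DBd.increment_of_margin hS hS' hΛ (by positivity) hA2 hc2 hR.1 (hR.fderiv hS')
      hab hwb hsm D.margin_base).mono_bound hΛ0 ?_
    calc _ = 2 * (4 ^ ((q + 1) ^ 2)) * Λ ^ 2 * B₀ * (c * m) := by ring
      _ ≤ _ := by gcongr
  have hangmaps : ∀ (y : Base → Base) (y' : Base → Base), (∀ x, (y x).2 = 0) →
      (∀ x, (y' x).2 = 0) → ∀ t ∈ Ioo (-1 : ℝ) 2, ∀ x ∈ S, x + (y x + t • y' x) ∈ S := by
    intro y y' hy hy' t _ x hx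
    refine ⟨mem_univ _, ?_⟩
    simpa [hy, hy'] using hx.2
  have hb2 : ∀ x, (b x).2 = 0 := fun x => angShift_snd _
  have hv2 : ∀ x, (v x).2 = 0 := fun x => angShift_snd _
  have T3 : DBd S Λ q (2 * C * Λ ^ 2 * A * (c * m))
      (fun x => z (x + (b x + v x)) - z (x + b x)) := by
    refine (DBd.increment hS hS hΛ (by positivity) hc2 hst.bd_z.1 (hst.bd_z.fderiv hS)
      (hbb.mono_bound hΛ0 (by linarith)) hvb (by linarith) (hangmaps b v hb2 hv2)).mono_bound
      hΛ0 ?_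
    calc _ = 2 * (4 ^ ((q + 1) ^ 2)) * Λ ^ 2 * A * (c * m) := by ring
      _ ≤ _ := by gcongr
  have T4 : DBd S Λ q (2 * C * Λ ^ 2 * (A + c * m) * (c * m))
      (fun x => ζ (x + (b x + v x)) - ζ x) := by
    have h1 := DBd.increment (a := fun _ => (0 : Base)) (w := fun x => b x + v x) hS hS hΛ
      (by positivity) (add_nonneg hA2 hc2) hζb.1 (hζb.fderiv hS)
      (DBd.zero hΛ0 (by positivity)) (hbb.add hvb hS) (by linarith)
      (hangmaps (fun _ => 0) (fun x => b x + v x) (fun _ => rfl)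
        (fun x => by simp [hb2, hv2]))
    simp only [zero_add, add_zero] at h1
    refine h1.mono_bound hΛ0 ?_
    calc _ = 2 * (4 ^ ((q + 1) ^ 2)) * Λ ^ 2 * (A + c * m) * (c * m) := by ring
      _ ≤ _ := by gcongr
  have hdχ : ∀ x ∈ S, DifferentiableAt ℝ χ x := fun x hx =>
    hst.bd_χ.differentiableAt hS (by omega) hx
  have hdu : ∀ x ∈ S, DifferentiableAt ℝ u x := fun x hx =>
    hub.differentiableAt hS (by omega) hx
  have hdsum : ∀ x ∈ S, fderiv ℝ (fun x => χ x + u x) x = fderiv ℝ χ x + fderiv ℝ u x :=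
    fun x hx => fderiv_fun_add (hdχ x hx) (hdu x hx)
  refine ⟨fun x => χ x + u x, fun x => z x + ζ x,
    fun x => (h (x + (a x + w x)) - h (x + a x) - fderiv ℝ h x (w x))
      + (R (x + (a x + w x)) - R (x + a x)) - (z (x + (b x + v x)) - z (x + b x))
      - (ζ (x + (b x + v x)) - ζ x),
    fun x => τ x + (f x - ζ x + fderiv ℝ u x (freqVec h x, 0)),
    { per_χ := fun φ I l hI => by simp only [hst.per_χ φ I l hI, hu φ I l hI]
      per_z := fun φ I l hI => by simp only [hst.per_z φ I l hI, hζ φ I l hI]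
      per_f := ?_
      slow_z := (hst.slow_z.mono_order (by omega)).add (hζs.mono_order (by omega))
      bd_χ := (hst.bd_χ.mono_order (by omega)).add (hub.mono_order (by omega)) hS
      bd_z := (hst.bd_z.mono_order (by omega)).add (hζb.mono_order (by omega)) hS
      bd_f := ?_
      bd_τ := hst.bd_τ.add htb hS
      eqn := ?_ }⟩
  · refine AngPeriodic.of_add_eq fun l x hx => ?_
    have e1 := hst.per_χ.fderiv D.isOpen l hx
    have e2 := hu.fderiv D.isOpen l hx
    have hax : a (x + (intVec l, 0)) = a x := by simp only [ha, e1]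
    have hwx : w (x + (intVec l, 0)) = w x := by simp only [hw, e2]
    have hbx : b (x + (intVec l, 0)) = b x := by simp only [hb, e1]
    have hvx : v (x + (intVec l, 0)) = v x := by simp only [hv, e2]
    have hxS : x ∈ S := ⟨mem_univ _, hx⟩
    have m1 : (x + (a x + w x)).2 ∈ W' := by
      refine (D.margin_base x hxS _ ?_).2
      have h1 := hab.norm_le hxS
      have h2 := hwb.norm_le hxS
      have := norm_add_le (a x) (w x)
      linarith
    have m2 : (x + a x).2 ∈ W' := by
      refine (D.margin_base x hxS _ ?_).2
      have h1 := hab.norm_le hxS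
      linarith
    have m3 : (x + (b x + v x)).2 ∈ W := by simpa [hb2, hv2] using hx
    have m4 : (x + b x).2 ∈ W := by simpa [hb2] using hx
    have hh : fderiv ℝ h (x + (intVec l, 0)) = fderiv ℝ h x := by
      rw [← fderiv_comp_add_right]
      congr 1
      funext y
      exact D.indep y _
    have s1 : ∀ y : Base, x + (intVec l, 0) + y = x + y + (intVec l, 0) := fun y =>
      add_right_comm _ _ _
    have r1 := D.periodic.add_eq l m1
    have r2 := D.periodic.add_eq l m2
    have r3 := hst.per_z.add_eq l m3
    have r4 := hst.per_z.add_eq l m4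
    have r5 := hζ.add_eq l m3
    have r6 := hζ.add_eq l hx
    beta_reduce
    rw [hax, hwx, hbx, hvx, hh, s1, s1, s1, s1, D.indep, D.indep, r1, r2, r3, r4, r5, r6]
  · refine ((((T1.add T2 hS).sub T3 hS).sub T4 hS)).mono_bound hΛ0 ?_
    have h1 : 0 ≤ C * Λ ^ 2 * A * (c * m) := by positivity
    have h2 : 0 ≤ C * Λ ^ 2 * (c * m) * (c * m) := by positivity
    have h3 : 0 ≤ C * Λ ^ 2 * B₀ * (c * m) := by positivity
    rw [stepConst, ← hC]
    nlinarith
  · intro x hx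
    have h0 := hst.eqn x hx
    have h1 := apply_freqVec h x (fderiv ℝ u x)
    simp only [hjDefect] at h0 ⊢
    rw [hdsum x hx, map_add, map_add, add_apply]
    simp only [h1]
    change h (x + a x) - h x + R (x + a x) + fderiv ℝ χ x (angDir 2) - z (x + b x) = _ at h0
    change h (x + (a x + w x)) - h x + R (x + (a x + w x)) +
      (fderiv ℝ χ x (angDir 2) + fderiv ℝ u x (angDir 2)) -
      (z (x + (b x + v x)) + ζ (x + (b x + v x))) = _
    have hwx : actShift (fderiv ℝ u x) = w x := rfl
    rw [hwx]
    linarith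

/-- The iteration: after `n` steps the smooth part of the defect has gained a factor `κ ^ n`. -/
theorem exists_iterStage (D : IterData k W W' Λ β B₀ M Q h R) {e : ℕ} {κ : ℝ} (n : ℕ)
    (hκ : κ = (n + 1) * 2 * stepConst Q * Λ ^ 2 * homCost β M Q ^ 2 * B₀) (hκ1 : κ ≤ 1)
    (hQ : e + 4 + n ≤ Q) :
    ∃ χ z f τ : Base → ℝ, IterStage k W Λ h R (Q - n) (n * (homCost β M Q * B₀))
      (B₀ * κ ^ n) (n * (tailFactor Λ M e * B₀)) χ z f τ := by
  have hΛ := D.one_le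
  have hΛ0 : 0 ≤ Λ := by linarith
  have hinv0 : 0 < Λ⁻¹ := inv_pos.2 (by linarith)
  have hB₀ := D.nonneg
  set c := homCost β M Q with hc
  have hc1 : 1 ≤ c := one_le_homCost D.pos D.le_one M Q
  have hcc : c ≤ c ^ 2 := by nlinarith
  have hS : IsOpen ((univ : Set Ang) ×ˢ W) := isOpen_univ.prod D.isOpen
  have hκ0 : 0 ≤ κ := by rw [hκ, stepConst]; positivity
  have hst10 : 10 ≤ stepConst Q := by
    rw [stepConst]
    have h1 : (1 : ℝ) ≤ 2 ^ Q * 4 ^ ((Q + 1) ^ 2) :=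
      one_le_mul_of_one_le_of_one_le (one_le_pow₀ (by norm_num)) (one_le_pow₀ (by norm_num))
    linarith
  have hτ0 := tailFactor_nonneg hΛ0 M e
  suffices H : ∀ i, i ≤ n → ∃ χ z f τ : Base → ℝ, IterStage k W Λ h R (Q - i)
      (i * (c * B₀)) (B₀ * κ ^ i) (i * (tailFactor Λ M e * B₀)) χ z f τ from H n le_rfl
  intro i
  induction i with
  | zero =>
    intro _
    refine ⟨fun _ => 0, fun _ => 0, R, fun _ => 0,
      { per_χ := fun _ _ _ _ => rfl
        per_z := fun _ _ _ _ => rfl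
        per_f := fun φ I l hI => D.periodic φ I l (D.subset hI)
        slow_z := isSlow_zero k
        bd_χ := DBd.zero hΛ0 (by simp)
        bd_z := DBd.zero hΛ0 (by simp)
        bd_f := ?_
        bd_τ := DBd.zero hΛ0 (by simp)
        eqn := ?_ }⟩
    · simpa using (D.bound.mono_set (prod_mono le_rfl D.subset)).mono_order (by omega)
    · intro x _
      simp [hjDefect]
  | succ i ih =>
    intro hi
    obtain ⟨χ, z, f, τ, hst⟩ := ih (by omega)
    obtain ⟨q, hq⟩ : ∃ q, Q - i = q + 1 := ⟨Q - i - 1, by omega⟩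
    rw [hq] at hst
    have hq' : Q - (i + 1) = q := by omega
    set m := B₀ * κ ^ i with hm
    have hm0 : 0 ≤ m := by positivity
    have hmB : m ≤ B₀ := mul_le_of_le_one_right hB₀ (pow_le_one₀ hκ0 hκ1)
    have hin : (i : ℝ) + 1 ≤ n := by exact_mod_cast hi
    have hcB : 0 ≤ c * B₀ := by positivity
    have hsum : i * (c * B₀) + c * m ≤ (i + 1) * (c * B₀) := by
      have : c * m ≤ c * B₀ := by gcongr
      linarith
    have hsum' : i * (c * B₀) + c * m ≤ n * (c * B₀) :=
      hsum.trans (mul_le_mul_of_nonneg_right hin hcB)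
    have hcB2 : c * B₀ ≤ c ^ 2 * B₀ := by gcongr
    have hsmall : 2 * Λ * (i * (c * B₀) + c * m) ≤ Λ⁻¹ / 4 := by
      have h1 : 8 * Λ ^ 2 * (i * (c * B₀) + c * m) ≤ 1 := by
        refine le_trans ?_ hκ1
        rw [hκ]
        calc 8 * Λ ^ 2 * (i * (c * B₀) + c * m)
            ≤ 8 * Λ ^ 2 * ((n + 1) * (c ^ 2 * B₀)) := by
              gcongr
              calc _ ≤ n * (c * B₀) := hsum'
                _ ≤ (n + 1) * (c ^ 2 * B₀) := by gcongr; linarith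
          _ = (n + 1) * 2 * 4 * Λ ^ 2 * c ^ 2 * B₀ := by ring
          _ ≤ _ := by gcongr; linarith
      have h2 : 2 * Λ * (i * (c * B₀) + c * m) = Λ⁻¹ / 4 *
          (8 * Λ ^ 2 * (i * (c * B₀) + c * m)) := by
        field_simp
        ring
      rw [h2]
      exact mul_le_of_le_one_right (by positivity) h1
    obtain ⟨χ', z', f', τ', hst'⟩ := IterStage.step D (e := e) (by omega) (by omega)
      (by positivity) hm0 hst hsmall
    refine ⟨χ', z', f', τ', ?_⟩
    rw [hq']
    push_cast
    refine { hst' with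
      bd_χ := hst'.bd_χ.mono_bound hΛ0 hsum
      bd_z := hst'.bd_z.mono_bound hΛ0 hsum
      bd_f := hst'.bd_f.mono_bound hΛ0 ?_
      bd_τ := hst'.bd_τ.mono_bound hΛ0 ?_ }
    · have h1 : i * (c * B₀) + c * m + B₀ ≤ (n + 1) * (c * B₀) := by
        have : B₀ ≤ c * B₀ := le_mul_of_one_le_left hB₀ hc1
        linarith
      calc _ ≤ stepConst Q * Λ ^ 2 * ((n + 1) * (c * B₀)) * (c * m) := by gcongr
        _ = (n + 1) * 1 * stepConst Q * Λ ^ 2 * c ^ 2 * B₀ * m := by ring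
        _ ≤ (n + 1) * 2 * stepConst Q * Λ ^ 2 * c ^ 2 * B₀ * m := by
            have : 0 ≤ stepConst Q := by linarith
            gcongr
            norm_num
        _ = κ * m := by rw [hκ]
        _ = _ := by rw [hm, pow_succ]; ring
    · have : tailFactor Λ M e * m ≤ tailFactor Λ M e * B₀ := by gcongr
      linarith

end Iteration

/-! ### The symplectic change of coordinates of a generating function -/

section GeneratingFunction

set_option synthInstance.maxHeartbeats 400000
set_option maxSynthPendingDepth 4

/-- The contraction principle on a complete subset of a normed group. -/
theorem exists_fixedPoint_of_contracting {E : Type} [NormedAddCommGroup E] {s : Set E}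
    (hs : IsComplete s) (hne : s.Nonempty) {f : E → E} (hf : MapsTo f s s)
    (hc : ∀ x ∈ s, ∀ y ∈ s, ‖f x - f y‖ ≤ 1 / 2 * ‖x - y‖) : ∃ y ∈ s, f y = y := by
  obtain ⟨x, hx⟩ := hne
  have h1 : ContractingWith (1 / 2 : NNReal) (hf.restrict f s s) := by
    refine ⟨by rw [← NNReal.coe_lt_coe]; norm_num, LipschitzWith.of_dist_le_mul fun a b => ?_⟩
    have := hc a.1 a.2 b.1 b.2
    rw [Subtype.dist_eq, Subtype.dist_eq, dist_eq_norm, dist_eq_norm]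
    simpa using this
  obtain ⟨y, hy, hfy, -⟩ := h1.exists_fixedPoint' hs hf hx (edist_ne_top _ _)
  exact ⟨y, hy, hfy⟩

theorem base_eq_sum (p : Base) : p = p.1 0 • angDir 0 + p.1 1 • angDir 1 + p.1 2 • angDir 2 +
    (p.2 0 • actDir 0 + p.2 1 • actDir 1) := by
  refine Prod.ext ?_ ?_
  · ext i
    fin_cases i <;> simp [angDir, actDir]
  · ext i
    fin_cases i <;> simp [angDir, actDir]

/-- The two partial maps `(φ, J, E) ↦ (φ, J + ∂_φ χ, E + ∂_t χ)` and
`(φ, J, E) ↦ (φ + ∂_J χ, J, E)` of a generating function pull the symplectic form back to the same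
form, by the symmetry of the second derivative `Q` of `χ`. -/
theorem sympForm_shift_eq {Q : Base →L[ℝ] Base →L[ℝ] ℝ} (hQ : ∀ p p', Q p p' = Q p' p)
    (p p' : Base) (E E' : ℝ) :
    sympForm (p + actShift (Q p), E + Q p (angDir 2)) (p' + actShift (Q p'), E' + Q p' (angDir 2))
      = sympForm (p + angShift (Q p), E) (p' + angShift (Q p'), E') := by
  have key : ∀ p p' : Base, Q p p' = p'.1 0 * Q p (angDir 0) + p'.1 1 * Q p (angDir 1)
      + p'.1 2 * Q p (angDir 2) + (p'.2 0 * Q p (actDir 0) + p'.2 1 * Q p (actDir 1)) := by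
    intro p p'
    conv_lhs => rw [base_eq_sum p']
    simp only [map_add, map_smul, smul_eq_mul]
  have h := hQ p p'
  rw [key p p', key p' p] at h
  simp only [sympForm, actShift_apply, angShift_apply, angDir, actDir, Prod.fst_add, Prod.snd_add,
    Prod.smul_fst, Prod.smul_snd, PiLp.add_apply, PiLp.smul_apply, PiLp.single_apply,
    smul_eq_mul, smul_zero, add_zero]
  simp only [angDir, actDir] at h
  simp
  linarith

/-- Differentiating `G = Id - (L ∘ Q ∘ g) G`, where `G` is the derivative of `g`, bounds the second
derivative of `g`. -/
theorem norm_le_of_hasFDerivAt_implicit {E F : Type*} [NormedAddCommGroup E] [NormedSpace ℝ E]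
    [NormedAddCommGroup F] [NormedSpace ℝ F] {L : F →L[ℝ] E} (hL : ‖L‖ ≤ 2)
    {Q : E → E →L[ℝ] F} {Q' : E →L[ℝ] E →L[ℝ] F} {g : E → E} {G : E → E →L[ℝ] E}
    {G' : E →L[ℝ] E →L[ℝ] E} {x : E} (hQ : HasFDerivAt Q Q' (g x)) (hg : HasFDerivAt g (G x) x)
    (hG : HasFDerivAt G G' x)
    (h : G =ᶠ[nhds x] fun z => ContinuousLinearMap.id ℝ E - (L.comp (Q (g z))).comp (G z))
    (hc : ‖L.comp (Q (g x))‖ ≤ 1 / 8) (hGx : ‖G x‖ ≤ 2) (hQ' : ‖Q'‖ ≤ 1) : ‖G'‖ ≤ 16 := by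
  have hdc : HasFDerivAt (fun z => L.comp (Q (g z)))
      ((ContinuousLinearMap.compL ℝ E F E L).comp (Q'.comp (G x))) x :=
    (ContinuousLinearMap.compL ℝ E F E L).hasFDerivAt.comp x (hQ.comp x hg)
  have h5 := hG.unique (((hdc.clm_comp hG).const_sub
    (ContinuousLinearMap.id ℝ E)).congr_of_eventuallyEq h)
  have key : ‖G'‖ ≤ 8 + 1 / 8 * ‖G'‖ := by
    refine ContinuousLinearMap.opNorm_le_bound _ (by positivity) fun v => ?_
    have h6 : G' v = -((L.comp (Q (g x))).comp (G' v) + (L.comp (Q' (G x v))).comp (G x)) := by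
      nth_rewrite 1 [h5]
      rfl
    have n1 : ‖(L.comp (Q (g x))).comp (G' v)‖ ≤ 1 / 8 * (‖G'‖ * ‖v‖) :=
      (ContinuousLinearMap.opNorm_comp_le _ _).trans
        (mul_le_mul hc (G'.le_opNorm v) (norm_nonneg _) (by norm_num))
    have n2 : ‖(L.comp (Q' (G x v))).comp (G x)‖ ≤ 8 * ‖v‖ := by
      have m1 : ‖G x v‖ ≤ 2 * ‖v‖ := ((G x).le_opNorm v).trans (by gcongr)
      have m2 : ‖Q' (G x v)‖ ≤ 1 * (2 * ‖v‖) := (Q'.le_opNorm _).trans (by gcongr)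
      have m3 := L.opNorm_comp_le (Q' (G x v))
      refine (ContinuousLinearMap.opNorm_comp_le _ _).trans ?_
      calc _ ≤ (2 * (1 * (2 * ‖v‖))) * 2 := by
            gcongr
            exact m3.trans (by gcongr)
        _ = _ := by ring
    rw [h6, norm_neg]
    refine (norm_add_le _ _).trans ((add_le_add n1 n2).trans (le_of_eq ?_))
    ring
  linarith [norm_nonneg G']

/-- The assumptions on a generating function `J · φ + χ(φ, J)`: `χ` is `C³`-small on
`𝕋³ × W'`, and `W'` contains the closed `δ`-neighbourhood of `W`. -/
structure GenFun (W W' : Set Act) (δ κ : ℝ) (χ : Base → ℝ) : Prop where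
  isOpen : IsOpen W
  isOpen' : IsOpen W'
  margin : ∀ J ∈ W, ∀ d : Act, ‖d‖ ≤ δ → J + d ∈ W'
  small : κ ≤ 1 / 16
  small_δ : 4 * κ ≤ δ
  smooth : ContDiffOn ℝ 3 χ (univ ×ˢ W')
  periodic : AngPeriodic W' χ
  bd₁ : ∀ x : Base, x.2 ∈ W' → ‖fderiv ℝ χ x‖ ≤ κ
  bd₂ : ∀ x : Base, x.2 ∈ W' → ‖fderiv ℝ (fderiv ℝ χ) x‖ ≤ κ
  bd₃ : ∀ x : Base, x.2 ∈ W' → ‖fderiv ℝ (fderiv ℝ (fderiv ℝ χ)) x‖ ≤ 1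

/-- `g` maps the new coordinates `(ψ, J)` to the mixed coordinates `(φ, J)`, where
`ψ = φ + ∂_J χ(φ, J)`. -/
structure IsMixedCoord (W : Set Act) (χ : Base → ℝ) (g : Base → Base) : Prop where
  snd : ∀ x : Base, x.2 ∈ W → (g x).2 = x.2
  eqn : ∀ x : Base, x.2 ∈ W → g x + angShift (fderiv ℝ χ (g x)) = x
  uniq : ∀ x y : Base, x.2 ∈ W → y.2 = x.2 → y + angShift (fderiv ℝ χ y) = x → g x = y

/-- The change of coordinates `(ψ, J) ↦ (φ, J + ∂_φ χ)`, in terms of the mixed coordinates. -/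
def genMap (χ : Base → ℝ) (g : Base → Base) (x : Base) : Base :=
  g x + actShift (fderiv ℝ χ (g x))

/-- The energy shift `∂_t χ`, in terms of the mixed coordinates. -/
def genShift (χ : Base → ℝ) (g : Base → Base) (x : Base) : ℝ :=
  fderiv ℝ χ (g x) (angDir 2)

variable {W W' : Set Act} {δ κ : ℝ} {χ : Base → ℝ} {g : Base → Base}

namespace GenFun

theorem nonneg (D : GenFun W W' δ κ χ) {J : Act} (hJ : J ∈ W') : 0 ≤ κ :=
  (norm_nonneg _).trans (D.bd₁ (0, J) hJ)

theorem subset (D : GenFun W W' δ κ χ) (hδ : 0 ≤ δ) : W ⊆ W' :=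
  fun J hJ => by simpa using D.margin J hJ 0 (by simpa)

theorem contDiffOn_fderiv (D : GenFun W W' δ κ χ) :
    ContDiffOn ℝ 2 (fderiv ℝ χ) (univ ×ˢ W') :=
  D.smooth.fderiv_of_isOpen (isOpen_univ.prod D.isOpen') (by norm_num)

theorem contDiffAt_fderiv (D : GenFun W W' δ κ χ) {x : Base} (hx : x.2 ∈ W') :
    ContDiffAt ℝ 2 (fderiv ℝ χ) x :=
  D.contDiffOn_fderiv.contDiffAt ((isOpen_univ.prod D.isOpen').mem_nhds ⟨mem_univ _, hx⟩)

theorem hasFDerivAt_fderiv (D : GenFun W W' δ κ χ) {x : Base} (hx : x.2 ∈ W') :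
    HasFDerivAt (fderiv ℝ χ) (fderiv ℝ (fderiv ℝ χ) x) x :=
  ((D.contDiffAt_fderiv hx).differentiableAt (by norm_num)).hasFDerivAt

theorem norm_shift_sub_le (D : GenFun W W' δ κ χ) {s : Set Base} (hs : Convex ℝ s)
    (hsW : ∀ x ∈ s, x.2 ∈ W') (L : (Base →L[ℝ] ℝ) →L[ℝ] Base) (hL : ‖L‖ ≤ 2) {x y : Base}
    (hx : x ∈ s) (hy : y ∈ s) :
    ‖L (fderiv ℝ χ x) - L (fderiv ℝ χ y)‖ ≤ 1 / 2 * ‖x - y‖ := by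
  have hκ := D.nonneg (hsW x hx)
  have hd : ∀ z ∈ s, HasFDerivAt (fun z => L (fderiv ℝ χ z))
      (L.comp (fderiv ℝ (fderiv ℝ χ) z)) z := fun z hz =>
    L.hasFDerivAt.comp z (D.hasFDerivAt_fderiv (hsW z hz))
  refine hs.norm_image_sub_le_of_norm_fderiv_le (𝕜 := ℝ) (f := fun z => L (fderiv ℝ χ z))
    (fun z hz => (hd z hz).differentiableAt) (fun z hz => ?_) hy hx
  rw [(hd z hz).fderiv]
  refine (L.opNorm_comp_le _).trans ?_
  have h1 := D.bd₂ z (hsW z hz)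
  have h2 := D.small
  calc ‖L‖ * ‖fderiv ℝ (fderiv ℝ χ) z‖ ≤ 2 * κ := by gcongr
    _ ≤ 1 / 2 := by linarith

theorem convex_fibre (J : Act) : Convex ℝ {y : Base | y.2 = J} := by
  have : {y : Base | y.2 = J} = univ ×ˢ {J} := by ext; simp
  rw [this]
  exact convex_univ.prod (convex_singleton J)

theorem isClosed_fibre (J : Act) : IsClosed {y : Base | y.2 = J} :=
  isClosed_eq continuous_snd continuous_const

/-- On each fibre `J = const` the map `φ ↦ φ + ∂_J χ` is a perturbation of the identity by a
contraction, hence bijective. -/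
theorem exists_isMixedCoord (D : GenFun W W' δ κ χ) (hδ : 0 ≤ δ) :
    ∃ g : Base → Base, IsMixedCoord W χ g := by
  have hex : ∀ x : Base, x.2 ∈ W → ∃ y : Base, y.2 = x.2 ∧ y + angShift (fderiv ℝ χ y) = x := by
    intro x hx
    have hW : ∀ y ∈ {y : Base | y.2 = x.2}, y.2 ∈ W' := fun y hy => by
      have : y.2 = x.2 := hy
      rw [this]; exact D.subset hδ hx
    obtain ⟨y, hy, hfy⟩ := exists_fixedPoint_of_contracting (isClosed_fibre x.2).isComplete
      ⟨x, rfl⟩ (f := fun y => x - angShift (fderiv ℝ χ y))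
      (fun y _ => by simp [angShift_snd]) (fun y hy z hz => by
        have := D.norm_shift_sub_le (convex_fibre x.2) hW angShift norm_angShift_le hz hy
        rw [sub_sub_sub_cancel_left, norm_sub_rev y z]
        exact this)
    refine ⟨y, hy, ?_⟩
    nth_rewrite 1 [← hfy]
    exact sub_add_cancel _ _
  have huniq : ∀ x y y' : Base, x.2 ∈ W → y.2 = x.2 → y'.2 = x.2 →
      y + angShift (fderiv ℝ χ y) = x → y' + angShift (fderiv ℝ χ y') = x → y = y' := by
    intro x y y' hx hy hy' h h'
    have h1 := D.norm_shift_sub_le (convex_fibre x.2) (fun y hy => by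
      have : y.2 = x.2 := hy
      rw [this]; exact D.subset hδ hx) angShift norm_angShift_le hy hy'
    have h2 : angShift (fderiv ℝ χ y) - angShift (fderiv ℝ χ y') = -(y - y') := by
      have e1 : angShift (fderiv ℝ χ y) = x - y := by rw [← h]; abel
      have e2 : angShift (fderiv ℝ χ y') = x - y' := by rw [← h']; abel
      rw [e1, e2]; abel
    rw [h2, norm_neg] at h1
    have h3 : ‖y - y'‖ = 0 := by linarith [norm_nonneg (y - y')]
    exact sub_eq_zero.1 (norm_eq_zero.1 h3)
  classical
  refine ⟨fun x => if hx : x.2 ∈ W then (hex x hx).choose else x, ⟨fun x hx => ?_, fun x hx => ?_,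
    fun x y hx hy h => ?_⟩⟩
  · simp only [dif_pos hx]
    exact (hex x hx).choose_spec.1
  · simp only [dif_pos hx]
    exact (hex x hx).choose_spec.2
  · simp only [dif_pos hx]
    exact huniq x _ y hx (hex x hx).choose_spec.1 hy (hex x hx).choose_spec.2 h

theorem norm_comp_le (D : GenFun W W' δ κ χ) (L : (Base →L[ℝ] ℝ) →L[ℝ] Base) (hL : ‖L‖ ≤ 2)
    {x : Base} (hx : x.2 ∈ W') : ‖L.comp (fderiv ℝ (fderiv ℝ χ) x)‖ ≤ 2 * κ := by
  refine (L.opNorm_comp_le _).trans ?_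
  have h1 := D.bd₂ x hx
  have h2 := D.nonneg hx
  gcongr

/-- The mixed coordinates are given locally by the inverse function theorem. -/
theorem contDiffAt_mixedCoord (D : GenFun W W' δ κ χ) (hδ : 0 ≤ δ) (hg : IsMixedCoord W χ g)
    {x : Base} (hx : x.2 ∈ W) : ContDiffAt ℝ 2 g x := by
  set y := g x with hy
  have hyW : y.2 ∈ W' := by rw [hy, hg.snd x hx]; exact D.subset hδ hx
  set Ψ : Base → Base := fun y => y + angShift (fderiv ℝ χ y) with hΨ
  set A := angShift.comp (fderiv ℝ (fderiv ℝ χ) y) with hA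
  have hAn : ‖-A‖ < 1 := by
    rw [norm_neg]
    have := D.norm_comp_le angShift norm_angShift_le hyW
    linarith [D.small]
  have hΨc : ContDiffAt ℝ 2 Ψ y :=
    contDiffAt_id.add (angShift.contDiff.contDiffAt.comp y (D.contDiffAt_fderiv hyW))
  set f' : Base ≃L[ℝ] Base := ContinuousLinearEquiv.ofUnit (Units.oneSub (-A) hAn) with hf'
  have hΨd : HasFDerivAt Ψ (f' : Base →L[ℝ] Base) y := by
    have h1 : HasFDerivAt Ψ (ContinuousLinearMap.id ℝ Base + A) y :=
      (hasFDerivAt_id y).add (angShift.hasFDerivAt.comp y (D.hasFDerivAt_fderiv hyW))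
    refine h1.congr_fderiv ?_
    refine ContinuousLinearMap.ext fun v => ?_
    change v + A v = (1 - -A : Base →L[ℝ] Base) v
    simp
  have hloc := hΨc.to_localInverse hΨd two_ne_zero
  have hΨy : Ψ y = x := hg.eqn x hx
  rw [hΨy] at hloc
  refine hloc.congr_of_eventuallyEq ?_
  have hst := hΨc.hasStrictFDerivAt' hΨd two_ne_zero
  have hr := hst.eventually_right_inverse
  rw [hΨy] at hr
  filter_upwards [hr, (isOpen_univ.prod D.isOpen).mem_nhds
    (⟨mem_univ x.1, hx⟩ : x ∈ (univ : Set Ang) ×ˢ W)] with z hz hzW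
  refine hg.uniq z _ hzW.2 ?_ hz
  have := congrArg Prod.snd hz
  simp only [hΨ, Prod.snd_add, angShift_snd, add_zero] at this
  exact this

theorem hasFDerivAt_mixedCoord (D : GenFun W W' δ κ χ) (hδ : 0 ≤ δ) (hg : IsMixedCoord W χ g)
    {x : Base} (hx : x.2 ∈ W) : HasFDerivAt g (fderiv ℝ g x) x :=
  ((D.contDiffAt_mixedCoord hδ hg hx).differentiableAt two_ne_zero).hasFDerivAt

theorem mem_of_mixedCoord (D : GenFun W W' δ κ χ) (hδ : 0 ≤ δ) (hg : IsMixedCoord W χ g)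
    {x : Base} (hx : x.2 ∈ W) : (g x).2 ∈ W' := by
  rw [hg.snd x hx]; exact D.subset hδ hx

theorem hasFDerivAt_fderiv_comp (D : GenFun W W' δ κ χ) (hδ : 0 ≤ δ) (hg : IsMixedCoord W χ g)
    {x : Base} (hx : x.2 ∈ W) : HasFDerivAt (fun x => fderiv ℝ χ (g x))
      ((fderiv ℝ (fderiv ℝ χ) (g x)).comp (fderiv ℝ g x)) x :=
  (D.hasFDerivAt_fderiv (D.mem_of_mixedCoord hδ hg hx)).comp x
    (D.hasFDerivAt_mixedCoord hδ hg hx)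

/-- The implicit equation for the derivative of the mixed coordinates. It is not solved for the
derivative: in this form it also bounds the second derivative. -/
theorem fderiv_mixedCoord (D : GenFun W W' δ κ χ) (hδ : 0 ≤ δ) (hg : IsMixedCoord W χ g)
    {x : Base} (hx : x.2 ∈ W) : fderiv ℝ g x = ContinuousLinearMap.id ℝ Base -
      (angShift.comp (fderiv ℝ (fderiv ℝ χ) (g x))).comp (fderiv ℝ g x) := by
  have h1 := (D.hasFDerivAt_mixedCoord hδ hg hx).add
    (angShift.hasFDerivAt.comp x (D.hasFDerivAt_fderiv_comp hδ hg hx))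
  have h2 : HasFDerivAt (fun z : Base => z) (ContinuousLinearMap.id ℝ Base) x := hasFDerivAt_id x
  have h3 : (g + angShift ∘ fun x => fderiv ℝ χ (g x)) =ᶠ[nhds x] fun z => z := by
    filter_upwards [(isOpen_univ.prod D.isOpen).mem_nhds
      (⟨mem_univ x.1, hx⟩ : x ∈ (univ : Set Ang) ×ˢ W)] with z hz
    exact hg.eqn z hz.2
  have h4 := (h2.congr_of_eventuallyEq h3).unique h1
  rw [h4]
  refine ContinuousLinearMap.ext fun v => ?_
  simp

theorem norm_fderiv_mixedCoord_le (D : GenFun W W' δ κ χ) (hδ : 0 ≤ δ) (hg : IsMixedCoord W χ g)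
    {x : Base} (hx : x.2 ∈ W) : ‖fderiv ℝ g x‖ ≤ 2 := by
  have h1 := D.fderiv_mixedCoord hδ hg hx
  have h2 := D.norm_comp_le angShift norm_angShift_le (D.mem_of_mixedCoord hδ hg hx)
  have h3 := ContinuousLinearMap.opNorm_comp_le
    (angShift.comp (fderiv ℝ (fderiv ℝ χ) (g x))) (fderiv ℝ g x)
  have h4 := norm_sub_le (ContinuousLinearMap.id ℝ Base)
    ((angShift.comp (fderiv ℝ (fderiv ℝ χ) (g x))).comp (fderiv ℝ g x))
  rw [← h1] at h4
  have h5 := ContinuousLinearMap.norm_id_le (𝕜 := ℝ) (E := Base)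
  have h6 := D.small
  nlinarith [norm_nonneg (fderiv ℝ g x)]

theorem norm_fderiv_fderiv_mixedCoord_le (D : GenFun W W' δ κ χ) (hδ : 0 ≤ δ)
    (hg : IsMixedCoord W χ g) {x : Base} (hx : x.2 ∈ W) :
    ‖fderiv ℝ (fderiv ℝ g) x‖ ≤ 16 := by
  have hyW := D.mem_of_mixedCoord hδ hg hx
  have hd3 : HasFDerivAt (fderiv ℝ (fderiv ℝ χ)) (fderiv ℝ (fderiv ℝ (fderiv ℝ χ)) (g x))
      (g x) := by
    have h1 : ContDiffAt ℝ 1 (fderiv ℝ (fderiv ℝ χ)) (g x) :=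
      (D.contDiffAt_fderiv hyW).fderiv_right (by norm_num)
    exact (h1.differentiableAt one_ne_zero).hasFDerivAt
  have hdd : HasFDerivAt (fderiv ℝ g) (fderiv ℝ (fderiv ℝ g) x) x := by
    have h1 : ContDiffAt ℝ 1 (fderiv ℝ g) x :=
      (D.contDiffAt_mixedCoord hδ hg hx).fderiv_right (by norm_num)
    exact (h1.differentiableAt one_ne_zero).hasFDerivAt
  refine norm_le_of_hasFDerivAt_implicit norm_angShift_le hd3
    (D.hasFDerivAt_mixedCoord hδ hg hx) hdd ?_ ?_ (D.norm_fderiv_mixedCoord_le hδ hg hx)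
    (D.bd₃ (g x) hyW)
  · filter_upwards [(isOpen_univ.prod D.isOpen).mem_nhds
      (⟨mem_univ x.1, hx⟩ : x ∈ (univ : Set Ang) ×ˢ W)] with z hz
    exact D.fderiv_mixedCoord hδ hg hz.2
  · have := D.norm_comp_le angShift norm_angShift_le hyW
    linarith [D.small]

theorem mixedCoord_add (D : GenFun W W' δ κ χ) (hδ : 0 ≤ δ) (hg : IsMixedCoord W χ g)
    (l : Fin 3 → ℤ) {x : Base} (hx : x.2 ∈ W) :
    g (x + (intVec l, 0)) = g x + (intVec l, 0) := by
  refine hg.uniq _ _ (by simpa using hx) (by simp [hg.snd x hx]) ?_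
  rw [D.periodic.fderiv D.isOpen' l (D.mem_of_mixedCoord hδ hg hx)]
  rw [add_right_comm, hg.eqn x hx]

theorem genMap_snd_sub (D : GenFun W W' δ κ χ) (hδ : 0 ≤ δ) (hg : IsMixedCoord W χ g)
    {x : Base} (hx : x.2 ∈ W) : ‖(actShift (fderiv ℝ χ (g x)))‖ ≤ 2 * κ := by
  have h1 := D.bd₁ (g x) (D.mem_of_mixedCoord hδ hg hx)
  have h2 := D.nonneg (D.mem_of_mixedCoord hδ hg hx)
  refine (actShift.le_opNorm _).trans ?_
  have := norm_actShift_le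
  gcongr

theorem genMap_mem (D : GenFun W W' δ κ χ) (hδ : 0 ≤ δ) (hg : IsMixedCoord W χ g)
    {x : Base} (hx : x.2 ∈ W) : (genMap χ g x).2 ∈ W' := by
  have h1 := D.genMap_snd_sub hδ hg hx
  have h2 := D.nonneg (D.mem_of_mixedCoord hδ hg hx)
  rw [genMap, Prod.snd_add, hg.snd x hx]
  refine D.margin _ hx _ ((norm_snd_le _).trans (h1.trans ?_))
  linarith [D.small_δ]

theorem contDiffOn_fderiv_comp (D : GenFun W W' δ κ χ) (hδ : 0 ≤ δ) (hg : IsMixedCoord W χ g) :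
    ContDiffOn ℝ 2 (fun x => fderiv ℝ χ (g x)) (univ ×ˢ W) := fun x hx =>
  ((D.contDiffAt_fderiv (D.mem_of_mixedCoord hδ hg hx.2)).comp x
    (D.contDiffAt_mixedCoord hδ hg hx.2)).contDiffWithinAt

theorem contDiffOn_mixedCoord (D : GenFun W W' δ κ χ) (hδ : 0 ≤ δ) (hg : IsMixedCoord W χ g) :
    ContDiffOn ℝ 2 g (univ ×ˢ W) := fun _ hx =>
  (D.contDiffAt_mixedCoord hδ hg hx.2).contDiffWithinAt

/-- Both `z ↦ (genMap, E + genShift)` and the identity are expressed by the mixed coordinates,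
through the two partial maps of the generating function; `sympForm_shift_eq` compares them. -/
theorem isSymplecticChange (D : GenFun W W' δ κ χ) (hδ : 0 ≤ δ) (hg : IsMixedCoord W χ g) :
    IsSymplecticChange W (genMap χ g) (genShift χ g) where
  smooth := (D.contDiffOn_mixedCoord hδ hg).add
    (actShift.contDiff.comp_contDiffOn (D.contDiffOn_fderiv_comp hδ hg))
  smooth_e := (D.contDiffOn_fderiv_comp hδ hg).clm_apply contDiffOn_const
  injOn := by
    intro x hx x' hx' h
    set y := g x with hy
    set y' := g x' with hy'
    have hκ := D.nonneg (D.mem_of_mixedCoord hδ hg hx.2)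
    have h1 := D.genMap_snd_sub hδ hg hx.2
    have h2 := D.genMap_snd_sub hδ hg hx'.2
    have h3 : y - y' = actShift (fderiv ℝ χ y') - actShift (fderiv ℝ χ y) := by
      have : y + actShift (fderiv ℝ χ y) = y' + actShift (fderiv ℝ χ y') := h
      rw [sub_eq_sub_iff_add_eq_add, this, add_comm]
    -- two points with the same image are close, so that the segment between them stays in `W'`
    have h4 : ‖y - y'‖ ≤ δ := by
      rw [h3]
      have := norm_sub_le (actShift (fderiv ℝ χ y')) (actShift (fderiv ℝ χ y))
      linarith [D.small_δ]
    have hyW : y.2 ∈ W := by rw [hy, hg.snd x hx.2]; exact hx.2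
    have hcv : Convex ℝ ((univ : Set Ang) ×ˢ Metric.closedBall y.2 δ) :=
      convex_univ.prod (convex_closedBall _ _)
    have hin : ∀ z ∈ (univ : Set Ang) ×ˢ Metric.closedBall y.2 δ, z.2 ∈ W' := by
      intro z hz
      have := D.margin y.2 hyW (z.2 - y.2) (by simpa [dist_eq_norm] using hz.2)
      simpa using this
    have hym : y ∈ (univ : Set Ang) ×ˢ Metric.closedBall y.2 δ :=
      ⟨mem_univ _, Metric.mem_closedBall_self hδ⟩
    have hym' : y' ∈ (univ : Set Ang) ×ˢ Metric.closedBall y.2 δ := by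
      refine ⟨mem_univ _, ?_⟩
      rw [Metric.mem_closedBall, dist_comm, dist_eq_norm]
      exact (norm_snd_le (y - y')).trans h4
    have h5 := D.norm_shift_sub_le hcv hin actShift norm_actShift_le hym' hym
    rw [← h3, norm_sub_rev y' y] at h5
    have h6 : ‖y - y'‖ = 0 := by linarith [norm_nonneg (y - y')]
    have h7 : y = y' := sub_eq_zero.1 (norm_eq_zero.1 h6)
    rw [← hg.eqn x hx.2, ← hg.eqn x' hx'.2, ← hy, ← hy', h7]
  equivariant := by
    intro φ I l hI
    have h1 : ((φ + intVec l, I) : Base) = (φ, I) + (intVec l, 0) := by simp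
    rw [h1, genMap, D.mixedCoord_add hδ hg l hI,
      D.periodic.fderiv D.isOpen' l (D.mem_of_mixedCoord hδ hg hI), genMap, add_right_comm]
  periodic_e := by
    intro φ I l hI
    have h1 : ((φ + intVec l, I) : Base) = (φ, I) + (intVec l, 0) := by simp
    rw [h1, genShift, D.mixedCoord_add hδ hg l hI,
      D.periodic.fderiv D.isOpen' l (D.mem_of_mixedCoord hδ hg hI), genShift]
  time := by
    intro _ hx
    have h1 := congrArg (fun z : Base => z.1 2) (hg.eqn _ hx)
    simp only [Prod.fst_add, PiLp.add_apply, angShift_apply, angDir, Prod.smul_fst,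
      PiLp.smul_apply] at h1
    simp at h1
    simp [genMap, actShift_fst, h1]
  symplectic := by
    intro z hz u v
    set y := g z.1 with hy
    set Q := fderiv ℝ (fderiv ℝ χ) y with hQ
    set G := fderiv ℝ g z.1 with hG
    have hyW : y.2 ∈ W' := D.mem_of_mixedCoord hδ hg hz
    have hsymm : ∀ p p', Q p p' = Q p' p := by
      have h1 : ContDiffAt ℝ 3 χ y :=
        D.smooth.contDiffAt ((isOpen_univ.prod D.isOpen').mem_nhds ⟨mem_univ _, hyW⟩)
      have h2 := h1.isSymmSndFDerivAt (by simp; norm_num)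
      exact fun p p' => h2 p p'
    have hfst : HasFDerivAt (fun z : Ext => z.1) (ContinuousLinearMap.fst ℝ Base ℝ) z :=
      hasFDerivAt_fst
    have hsnd : HasFDerivAt (fun z : Ext => z.2) (ContinuousLinearMap.snd ℝ Base ℝ) z :=
      hasFDerivAt_snd
    have hgd := D.hasFDerivAt_mixedCoord hδ hg hz
    have hχd := D.hasFDerivAt_fderiv_comp hδ hg hz
    have hd1 : HasFDerivAt (genMap χ g) (G + actShift.comp (Q.comp G)) z.1 :=
      hgd.add (actShift.hasFDerivAt.comp z.1 hχd)
    have hd2 : HasFDerivAt (genShift χ g)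
        ((ContinuousLinearMap.apply ℝ ℝ (angDir 2)).comp (Q.comp G)) z.1 :=
      (ContinuousLinearMap.apply ℝ ℝ (angDir 2)).hasFDerivAt.comp z.1 hχd
    have hd : HasFDerivAt (extMap (genMap χ g) (genShift χ g))
        (((G + actShift.comp (Q.comp G)).comp (ContinuousLinearMap.fst ℝ Base ℝ)).prod
          (ContinuousLinearMap.snd ℝ Base ℝ +
            ((ContinuousLinearMap.apply ℝ ℝ (angDir 2)).comp (Q.comp G)).comp
              (ContinuousLinearMap.fst ℝ Base ℝ))) z :=
      (hd1.comp z hfst).prodMk (hsnd.add (hd2.comp z hfst))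
    have hid : ∀ u : Base, G u + angShift (Q (G u)) = u := by
      intro u
      have h1 := congrArg (fun L => L u) (D.fderiv_mixedCoord hδ hg hz)
      simp only [sub_apply, ContinuousLinearMap.id_apply, ContinuousLinearMap.comp_apply] at h1
      rw [← hG, ← hy, ← hQ] at h1
      nth_rewrite 1 [h1]
      exact sub_add_cancel _ _
    rw [hd.fderiv]
    have h1 := sympForm_shift_eq hsymm (G u.1) (G v.1) u.2 v.2
    rw [hid, hid] at h1
    exact h1

/-- The displacement is a linear function of `Dχ` in the mixed coordinates. -/
theorem displacement_eq (hg : IsMixedCoord W χ g) {x : Base} (hx : x.2 ∈ W) :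
    displacement (genMap χ g) (genShift χ g) x =
      ((actShift - angShift).prod (ContinuousLinearMap.apply ℝ ℝ (angDir 2)))
        (fderiv ℝ χ (g x)) := by
  have h1 := hg.eqn x hx
  refine Prod.ext ?_ rfl
  change genMap χ g x - x = actShift (fderiv ℝ χ (g x)) - angShift (fderiv ℝ χ (g x))
  rw [genMap]
  nth_rewrite 3 [← h1]
  abel

theorem ckNormLE_displacement (D : GenFun W W' δ κ χ) (hδ : 0 ≤ δ) (hg : IsMixedCoord W χ g) :
    CkNormLE 1 (displacement (genMap χ g) (genShift χ g)) (univ ×ˢ W) (8 * κ) := by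
  set L : (Base →L[ℝ] ℝ) →L[ℝ] Ext :=
    (actShift - angShift).prod (ContinuousLinearMap.apply ℝ ℝ (angDir 2)) with hL
  have hLn : ‖L‖ ≤ 4 := by
    refine ContinuousLinearMap.opNorm_le_bound _ (by norm_num) fun ℓ => ?_
    rw [hL, ContinuousLinearMap.prod_apply, Prod.norm_def]
    refine max_le ?_ ?_
    · have h1 := actShift.le_opNorm ℓ
      have h2 := angShift.le_opNorm ℓ
      have h3 := norm_sub_le (actShift ℓ) (angShift ℓ)
      have h4 := norm_actShift_le
      have h5 := norm_angShift_le
      simp only [sub_apply]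
      nlinarith [norm_nonneg ℓ]
    · have h1 := ℓ.le_opNorm (angDir 2)
      have h2 := norm_angDir 2
      rw [ContinuousLinearMap.apply_apply]
      nlinarith [norm_nonneg ℓ]
  intro i hi x hx
  have hyW := D.mem_of_mixedCoord hδ hg hx.2
  have hκ := D.nonneg hyW
  interval_cases i
  · rw [norm_iteratedFDeriv_zero, displacement_eq hg hx.2]
    refine (L.le_opNorm _).trans ?_
    have := D.bd₁ _ hyW
    calc ‖L‖ * ‖fderiv ℝ χ (g x)‖ ≤ 4 * κ := by gcongr
      _ ≤ _ := by linarith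
  · rw [norm_iteratedFDeriv_one]
    have h1 : HasFDerivAt (displacement (genMap χ g) (genShift χ g))
        (L.comp ((fderiv ℝ (fderiv ℝ χ) (g x)).comp (fderiv ℝ g x))) x := by
      refine (L.hasFDerivAt.comp x (D.hasFDerivAt_fderiv_comp hδ hg hx.2)).congr_of_eventuallyEq ?_
      filter_upwards [(isOpen_univ.prod D.isOpen).mem_nhds hx] with z hz
      exact displacement_eq hg hz.2
    rw [h1.fderiv]
    have h2 := D.bd₂ _ hyW
    have h3 := D.norm_fderiv_mixedCoord_le hδ hg hx.2
    refine (L.opNorm_comp_le _).trans ?_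
    have h4 := (fderiv ℝ (fderiv ℝ χ) (g x)).opNorm_comp_le (fderiv ℝ g x)
    calc _ ≤ 4 * (κ * 2) := by
          gcongr
          exact h4.trans (by gcongr)
      _ = _ := by ring

/-- The range of the change of coordinates contains every point whose `δ`-neighbourhood in the
actions lies in the domain. -/
theorem mem_image (D : GenFun W W' δ κ χ) (hδ : 0 ≤ δ) (hg : IsMixedCoord W χ g) {x : Base}
    (hx : ∀ d : Act, ‖d‖ ≤ δ → x.2 + d ∈ W) : x ∈ genMap χ g '' (univ ×ˢ W) := by
  set s : Set Base := {x.1} ×ˢ Metric.closedBall x.2 δ with hs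
  have hsc : IsClosed s := isClosed_singleton.prod Metric.isClosed_closedBall
  have hcv : Convex ℝ s := (convex_singleton _).prod (convex_closedBall _ _)
  have hsW : ∀ y ∈ s, y.2 ∈ W := by
    intro y hy
    have := hx (y.2 - x.2) (by simpa [dist_eq_norm] using hy.2)
    simpa using this
  have hsW' : ∀ y ∈ s, y.2 ∈ W' := fun y hy => D.subset hδ (hsW y hy)
  obtain ⟨y, hy, hfy⟩ := exists_fixedPoint_of_contracting hsc.isComplete
    ⟨x, rfl, Metric.mem_closedBall_self hδ⟩ (f := fun y => x - actShift (fderiv ℝ χ y))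
    (fun y hy => by
      refine ⟨by simp [actShift_fst], ?_⟩
      have h1 := D.bd₁ y (hsW' y hy)
      have hκ := D.nonneg (hsW' y hy)
      have h2 := (actShift.le_opNorm (fderiv ℝ χ y))
      have h3 := norm_actShift_le
      have h4 : ‖actShift (fderiv ℝ χ y)‖ ≤ 2 * κ := h2.trans (by gcongr)
      have h5 := norm_snd_le (actShift (fderiv ℝ χ y))
      simp only [Metric.mem_closedBall, dist_eq_norm, Prod.snd_sub, sub_sub_cancel_left, norm_neg]
      linarith [D.small_δ])
    (fun y hy z hz => by
      have := D.norm_shift_sub_le hcv hsW' actShift norm_actShift_le hz hy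
      rw [sub_sub_sub_cancel_left, norm_sub_rev y z]
      exact this)
  refine ⟨y + angShift (fderiv ℝ χ y), ⟨mem_univ _, ?_⟩, ?_⟩
  · simpa [angShift_snd] using hsW y hy
  · have h1 : g (y + angShift (fderiv ℝ χ y)) = y :=
      hg.uniq _ y (by simpa [angShift_snd] using hsW y hy) (by simp [angShift_snd]) rfl
    rw [genMap, h1]
    nth_rewrite 1 [← hfy]
    exact sub_add_cancel _ _

end GenFun
end GeneratingFunction

/-! ### Rescaling the actions -/

section Rescaling

section General

variable {E E' F : Type} [NormedAddCommGroup E] [NormedSpace ℝ E] [NormedAddCommGroup E']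
  [NormedSpace ℝ E'] [NormedAddCommGroup F] [NormedSpace ℝ F]
  {T : Set E'} {Λ Λ' ℓ B : ℝ} {p : ℕ} {f : E' → F}

/-- Derivatives of `f (c + L x)` on an open set, without smoothness of `f` elsewhere. -/
theorem norm_iteratedFDeriv_comp_affine_le (hT : IsOpen T) (hf : ContDiffOn ℝ p f T) (c : E')
    (L : E →L[ℝ] E') {x : E} (hx : c + L x ∈ T) {i : ℕ} (hi : i ≤ p) :
    ‖iteratedFDeriv ℝ i (fun x => f (c + L x)) x‖ ≤
      ‖iteratedFDeriv ℝ i f (c + L x)‖ * ‖L‖ ^ i := by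
  set T' : Set E' := (fun y => c + y) ⁻¹' T with hT'
  have hT'o : IsOpen T' := hT.preimage (by fun_prop)
  have hf' : ContDiffOn ℝ p (fun y => f (c + y)) T' :=
    hf.comp (contDiff_const.add contDiff_id).contDiffOn fun y hy => hy
  have h1 := L.iteratedFDerivWithin_comp_right hf' hT'o.uniqueDiffOn
    (hT'o.preimage L.continuous).uniqueDiffOn (x := x) hx (i := i) (by exact_mod_cast hi)
  rw [iteratedFDerivWithin_of_isOpen i (hT'o.preimage L.continuous) hx,
    iteratedFDerivWithin_of_isOpen i hT'o hx, iteratedFDeriv_comp_add_left] at h1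
  change ‖iteratedFDeriv ℝ i ((fun y => f (c + y)) ∘ L) x‖ ≤ _
  rw [h1]
  refine (ContinuousMultilinearMap.norm_compContinuousLinearMap_le _ _).trans (le_of_eq ?_)
  simp

theorem DBd.comp_affine (hf : DBd T Λ p B f) (hT : IsOpen T) (c : E') (L : E →L[ℝ] E')
    (hL : ‖L‖ ≤ ℓ) (hΛ : 0 ≤ Λ) (hB : 0 ≤ B) :
    DBd ((fun x => c + L x) ⁻¹' T) (Λ * ℓ) p B (fun x => f (c + L x)) := by
  refine ⟨hf.1.comp (contDiff_const.add L.contDiff).contDiffOn fun x hx => hx,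
    fun i hi x hx => (norm_iteratedFDeriv_comp_affine_le hT hf.1 c L hx hi).trans ?_⟩
  have h1 := hf.2 i hi _ hx
  rw [mul_pow, ← mul_assoc]
  gcongr

theorem DBd.mono_rate (hf : DBd T Λ p B f) (hΛ : 0 ≤ Λ) (hΛ' : Λ ≤ Λ') : DBd T Λ' p B f :=
  ⟨hf.1, fun i hi x hx => (hf.2 i hi x hx).trans
    (mul_le_mul_of_nonneg_left (pow_le_pow_left₀ hΛ hΛ' i) (hf.nonneg hx))⟩

theorem norm_compL_apply_le (v : E) :
    ‖ContinuousLinearMap.compL ℝ E (E →L[ℝ] ℝ) ℝ (ContinuousLinearMap.apply ℝ ℝ v)‖ ≤ ‖v‖ := by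
  refine ContinuousLinearMap.opNorm_le_bound _ (norm_nonneg _) fun T => ?_
  refine ContinuousLinearMap.opNorm_le_bound _ (by positivity) fun x => ?_
  simp only [ContinuousLinearMap.compL_apply, ContinuousLinearMap.comp_apply,
    ContinuousLinearMap.apply_apply]
  calc ‖T x v‖ ≤ ‖T x‖ * ‖v‖ := (T x).le_opNorm v
    _ ≤ ‖T‖ * ‖x‖ * ‖v‖ := by gcongr; exact T.le_opNorm x
    _ = _ := by ring

theorem DBd.const_mul {f : E' → ℝ} (hf : DBd T Λ p B f) (hT : IsOpen T) {c : ℝ} (hc : 0 ≤ c) :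
    DBd T Λ p (c * B) (fun x => c * f x) := by
  refine ⟨contDiffOn_const.mul hf.1, fun i hi x hx => ?_⟩
  have h1 : iteratedFDeriv ℝ i (fun x => c * f x) x = c • iteratedFDeriv ℝ i f x :=
    iteratedFDeriv_const_smul_apply (a := c)
      ((hf.contDiffAt hT hx).of_le (by exact_mod_cast hi))
  rw [h1, norm_smul, Real.norm_of_nonneg hc, mul_assoc]
  exact mul_le_mul_of_nonneg_left (hf.2 i hi x hx) hc

end General

/-- The rescaling `(φ, J) ↦ (φ, s J)`. -/
def actScale (s : ℝ) : Base →L[ℝ] Base :=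
  (ContinuousLinearMap.fst ℝ Ang Act).prod (s • ContinuousLinearMap.snd ℝ Ang Act)

@[simp]
theorem actScale_apply (s : ℝ) (x : Base) : actScale s x = (x.1, s • x.2) := rfl

theorem norm_actScale_le {s ℓ : ℝ} (hℓ : 1 ≤ ℓ) (hs : |s| ≤ ℓ) : ‖actScale s‖ ≤ ℓ := by
  refine ContinuousLinearMap.opNorm_le_bound _ (by linarith) fun x => ?_
  rw [actScale_apply, Prod.norm_def]
  refine max_le ?_ ?_
  · exact (norm_fst_le x).trans (le_mul_of_one_le_left (norm_nonneg _) hℓ)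
  · rw [norm_smul, Real.norm_eq_abs]
    exact mul_le_mul hs (norm_snd_le x) (norm_nonneg _) (by linarith)

theorem rescale_eq (s : ℝ) (I₀ : Act) (x : Base) :
    rescale s I₀ x = ((0, I₀) : Base) + actScale s x := by
  simp [rescale]

theorem norm_smul_snd_le {s : ℝ} (hs : 0 ≤ s) :
    ‖s • ContinuousLinearMap.snd ℝ Ang Act‖ ≤ s := by
  rw [norm_smul, Real.norm_of_nonneg hs]
  exact mul_le_of_le_one_right hs (ContinuousLinearMap.norm_snd_le ℝ Ang Act)

theorem gradient_apply {H : Act → ℝ} {I : Act} (i : Fin 2) :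
    gradient H I i = fderiv ℝ H I (EuclideanSpace.single i 1) := by
  have h : inner ℝ (gradient H I) (EuclideanSpace.single i 1)
      = fderiv ℝ H I (EuclideanSpace.single i 1) := by
    rw [gradient, InnerProductSpace.toDual_symm_apply]
  rw [← h, EuclideanSpace.inner_single_right]
  simp

end Rescaling

section Scale

/-- The data of the normal form at the scale `s` of the actions around the set `Z`: bounds for `H`
and `R` on the `3 s`-neighbourhood of `Z`, and a lower bound `β` for the divisors on its `2
s`-neighbourhood. The rate `Λ` already bounds the derivatives of `R` in unscaled actions. The last
two conditions say that in rescaled actions `H` is nearly affine, so that its frequencies vary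
slowly compared with the divisors. -/
structure ScaleData (k : Fin 3 → ℤ) (Z : Set Act) (s Λ β A K : ℝ) (M Q : ℕ)
    (H : Act → ℝ) (R : Base → ℝ) : Prop where
  gcd_ne : Finset.univ.gcd k ≠ 0
  one_le : 1 ≤ Λ
  pos_s : 0 < s
  s_le_one : s ≤ 1
  pos : 0 < β
  le_one : β ≤ 1
  one_le_M : 1 ≤ M
  nonneg : 0 ≤ A
  nonneg_K : 0 ≤ K
  bound_H : DBd (Metric.thickening (3 * s) Z) 1 (Q + 2) K H
  bound_R : DBd (univ ×ˢ Metric.thickening (3 * s) Z) Λ (Q + 1) A R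
  periodic : AngPeriodic (Metric.thickening (3 * s) Z) R
  divisor : ∀ k' ∈ box M, ¬ IsMultiple k k' → ∀ I ∈ Metric.thickening (2 * s) Z,
    β ≤ |kdot k' (gradient H I)|
  small₁ : s * K ≤ 1
  small₂ : 2 * M * (s * K) ≤ β * Λ

variable {k : Fin 3 → ℤ} {Z : Set Act} {s Λ β A K : ℝ} {M Q : ℕ} {H : Act → ℝ} {R : Base → ℝ}

theorem norm_smul_actDir_le {k' : Fin 3 → ℤ} (hk' : k' ∈ box M) :
    ‖(k' 0 : ℝ) • actDir 0 + (k' 1 : ℝ) • actDir 1‖ ≤ 2 * M := by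
  have h : ∀ i, |(k' i : ℝ)| ≤ M := fun i => by
    simp only [box, Fintype.mem_piFinset, Finset.mem_Icc] at hk'
    rw [abs_le]
    exact ⟨by exact_mod_cast (hk' i).1, by exact_mod_cast (hk' i).2⟩
  have h1 : ∀ (i : Fin 3) (j : Fin 2), ‖(k' i : ℝ) • actDir j‖ ≤ M := fun i j => by
    rw [norm_smul, Real.norm_eq_abs]
    exact (mul_le_of_le_one_right (abs_nonneg _) (norm_actDir j)).trans (h i)
  refine (norm_add_le _ _).trans ?_
  linarith [h1 0 0, h1 1 1]

theorem mem_thickening_add {a b : ℝ} {J d : Act} (hJ : J ∈ Metric.thickening a Z)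
    (hd : ‖d‖ ≤ b) : J + d ∈ Metric.thickening (a + b) Z := by
  rw [Metric.mem_thickening_iff] at hJ ⊢
  obtain ⟨z, hz, hJz⟩ := hJ
  refine ⟨z, hz, ?_⟩
  have h1 : dist (J + d) J ≤ b := by simpa [dist_eq_norm] using hd
  linarith [dist_triangle (J + d) J z]

set_option maxHeartbeats 1000000 in
/-- The rescaled Hamiltonian satisfies the assumptions of the iteration. -/
theorem ScaleData.iterData (D : ScaleData k Z s Λ β A K M Q H R) :
    IterData k ((fun y => s • y) ⁻¹' Metric.thickening (2 * s) Z)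
      ((fun y => s • y) ⁻¹' Metric.thickening (3 * s) Z) Λ β (A / s) M Q
      (fun x => s⁻¹ * H (s • x.2)) (fun x => s⁻¹ * R (actScale s x)) := by
  have hs := D.pos_s
  have hsi : 0 ≤ s⁻¹ := inv_nonneg.2 hs.le
  have hΛ0 : 0 ≤ Λ := by linarith [D.one_le]
  have hA := D.nonneg
  have hK := D.nonneg_K
  have hcont : Continuous fun y : Act => s • y := continuous_const_smul s
  set W := (fun y : Act => s • y) ⁻¹' Metric.thickening (2 * s) Z with hW
  set W' := (fun y : Act => s • y) ⁻¹' Metric.thickening (3 * s) Z with hW'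
  have hWo : IsOpen W := Metric.isOpen_thickening.preimage hcont
  have hWo' : IsOpen W' := Metric.isOpen_thickening.preimage hcont
  have hS : IsOpen ((univ : Set Ang) ×ˢ W) := isOpen_univ.prod hWo
  have hS' : IsOpen ((univ : Set Ang) ×ˢ W') := isOpen_univ.prod hWo'
  have hsub : W ⊆ W' := preimage_mono (Metric.thickening_mono (by linarith) Z)
  -- the integrable part
  have hh : DBd (univ ×ˢ W') s (Q + 2) (s⁻¹ * K) (fun x : Base => s⁻¹ * H (s • x.2)) := by
    have h1 := (D.bound_H.comp_affine Metric.isOpen_thickening 0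
      (s • ContinuousLinearMap.snd ℝ Ang Act) (norm_smul_snd_le hs.le) zero_le_one hK)
    have h2 : (fun x : Base => (0 : Act) + (s • ContinuousLinearMap.snd ℝ Ang Act) x) ⁻¹'
        Metric.thickening (3 * s) Z = univ ×ˢ W' := by
      ext x; simp [hW']
    rw [h2, one_mul] at h1
    refine (h1.const_mul hS' hsi).congr hS' fun x _ => by simp
  have hD2 : DBd (univ ×ˢ W') Λ Q (s * K)
      (fderiv ℝ (fderiv ℝ fun x : Base => s⁻¹ * H (s • x.2))) := by
    have h1 := ((hh.fderiv hS').fderiv hS').mono_rate hs.le (D.s_le_one.trans D.one_le)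
    refine h1.mono_bound hΛ0 (le_of_eq ?_)
    field_simp
  refine ⟨hWo, hWo', fun J hJ d hd => ?_, D.gcd_ne, D.one_le, D.pos, D.le_one, D.one_le_M,
    div_nonneg hA hs.le, fun x ψ => by simp, hh.1, hD2.mono_bound hΛ0 D.small₁, ?_, ?_, ?_⟩
  · have h1 : ‖s • d‖ ≤ s := by
      rw [norm_smul, Real.norm_of_nonneg hs.le]
      exact mul_le_of_le_one_right hs.le hd
    have h2 := mem_thickening_add hJ h1
    rw [hW', mem_preimage, smul_add]
    convert h2 using 2
    ring
  · have h1 := D.bound_R.comp_affine (isOpen_univ.prod Metric.isOpen_thickening) 0 (actScale s)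
      (norm_actScale_le le_rfl (by rw [abs_of_pos hs]; exact D.s_le_one)) hΛ0 hA
    have h2 : (fun x : Base => (0 : Base) + actScale s x) ⁻¹'
        ((univ : Set Ang) ×ˢ Metric.thickening (3 * s) Z) = univ ×ˢ W' := by
      ext x; simp [hW']
    rw [h2, mul_one] at h1
    refine ((h1.const_mul hS' hsi).congr hS' fun x _ => by simp).mono_bound hΛ0 (le_of_eq ?_)
    rw [div_eq_inv_mul]
  · intro φ I l hI
    simp only [actScale_apply]
    rw [D.periodic φ (s • I) l hI]
  · intro k' hk' hnk
    set v : Base := (k' 0 : ℝ) • actDir 0 + (k' 1 : ℝ) • actDir 1 with hv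
    set L : (Base →L[ℝ] ℝ) →L[ℝ] ℝ := ContinuousLinearMap.apply ℝ ℝ v with hL
    set h : Base → ℝ := fun x => s⁻¹ * H (s • x.2) with hhdef
    have hslow : (fun x => slow k' (freqVec h x)) = fun x => L (fderiv ℝ h x) + k' 2 := by
      funext x
      simp [slow, Fin.sum_univ_three, freqVec, hL, hv]
    have hder : ∀ x ∈ (univ : Set Ang) ×ˢ W', HasFDerivAt (fun x => L (fderiv ℝ h x) + (k' 2 : ℝ))
        (ContinuousLinearMap.compL ℝ Base (Base →L[ℝ] ℝ) ℝ L (fderiv ℝ (fderiv ℝ h) x)) x := by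
      intro x hx
      have h1 : HasFDerivAt (fderiv ℝ h) (fderiv ℝ (fderiv ℝ h) x) x :=
        ((hh.fderiv hS').differentiableAt hS' (by omega) hx).hasFDerivAt
      exact (L.hasFDerivAt.comp x h1).add_const _
    have hSS : (univ : Set Ang) ×ˢ W ⊆ univ ×ˢ W' := prod_mono subset_rfl hsub
    refine ⟨?_, ?_, ?_⟩
    · rw [hslow]
      exact fun x hx => (hder x (hSS hx)).differentiableAt.differentiableWithinAt
    · rw [hslow]
      refine (((hD2.clm_comp hS' (ContinuousLinearMap.compL ℝ Base (Base →L[ℝ] ℝ) ℝ L)).congr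
        hS' fun x hx => (hder x hx).fderiv).mono_set hSS).mono_bound hΛ0 (le_trans ?_ D.small₂)
      have h2 := (norm_compL_apply_le v).trans (norm_smul_actDir_le hk')
      exact mul_le_mul_of_nonneg_right h2 (by positivity)
    · intro x hx
      have hI : s • x.2 ∈ Metric.thickening (3 * s) Z := hsub hx.2
      have hdH : DifferentiableAt ℝ H (s • x.2) :=
        D.bound_H.differentiableAt Metric.isOpen_thickening (by omega) hI
      have hdh : HasFDerivAt h (s⁻¹ • ((fderiv ℝ H (s • x.2)).comp
          (s • ContinuousLinearMap.snd ℝ Ang Act))) x := by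
        have h1 : HasFDerivAt (fun x : Base => s • x.2) (s • ContinuousLinearMap.snd ℝ Ang Act) x :=
          (s • ContinuousLinearMap.snd ℝ Ang Act).hasFDerivAt
        have h2 : HasFDerivAt (fun x : Base => H (s • x.2)) _ x :=
          HasFDerivAt.comp x (g := H) hdH.hasFDerivAt h1
        exact h2.const_mul _
      have h1 : ∀ j, fderiv ℝ h x (actDir j) = gradient H (s • x.2) j := by
        intro j
        rw [hdh.fderiv, gradient_apply]
        simp only [actDir, smul_apply, ContinuousLinearMap.comp_apply,
          ContinuousLinearMap.coe_snd', map_smul, smul_eq_mul]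
        field_simp
      have h2 : slow k' (freqVec h x) = kdot k' (gradient H (s • x.2)) := by
        simp [slow, Fin.sum_univ_three, freqVec, h1, kdot]
      rw [h2]
      exact D.divisor k' hk' hnk _ hx.2

/-- The defect of the Hamilton-Jacobi equation is homogeneous under rescaling of the actions, of the
Hamiltonian and of the generating function. -/
theorem hjDefect_unscale (hs0 : s ≠ 0) {χ z : Base → ℝ} {x : Base}
    (hdχ : DifferentiableAt ℝ χ (actScale s⁻¹ x)) :
    hjDefect (fun x => H x.2) R (fun x => s * χ (actScale s⁻¹ x))
      (fun x => s * z (actScale s⁻¹ x)) x =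
    s * hjDefect (fun x => s⁻¹ * H (s • x.2)) (fun x => s⁻¹ * R (actScale s x)) χ z
      (actScale s⁻¹ x) := by
  set y := actScale s⁻¹ x with hy
  have hd : HasFDerivAt (fun x => s * χ (actScale s⁻¹ x))
      (s • (fderiv ℝ χ y).comp (actScale s⁻¹)) x :=
    (hdχ.hasFDerivAt.comp x (actScale s⁻¹).hasFDerivAt).const_mul s
  have hang : ∀ j, fderiv ℝ (fun x => s * χ (actScale s⁻¹ x)) x (angDir j)
      = s * fderiv ℝ χ y (angDir j) := by
    intro j
    rw [hd.fderiv]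
    simp [angDir]
  have hact : ∀ j, fderiv ℝ (fun x => s * χ (actScale s⁻¹ x)) x (actDir j)
      = fderiv ℝ χ y (actDir j) := by
    intro j
    have h1 : actScale s⁻¹ (actDir j) = s⁻¹ • actDir j := by simp [actDir]
    rw [hd.fderiv, smul_apply, ContinuousLinearMap.comp_apply, h1, map_smul]
    simp [hs0]
  have h1 : actScale s⁻¹ (x + actShift (fderiv ℝ (fun x => s * χ (actScale s⁻¹ x)) x))
      = y + actShift (fderiv ℝ χ y) := by
    rw [map_add, ← hy, actShift_apply, actShift_apply, hang, hang]
    simp [actDir, smul_smul, hs0]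
  have h2 : actScale s⁻¹ (x + angShift (fderiv ℝ (fun x => s * χ (actScale s⁻¹ x)) x))
      = y + angShift (fderiv ℝ χ y) := by
    rw [map_add, ← hy, angShift_apply, angShift_apply, hact, hact]
    simp [angDir]
  have hxs : ∀ w : Base, actScale s (actScale s⁻¹ w) = w := fun w => by
    simp [smul_smul, hs0]
  have hxs2 : ∀ w : Base, s • (actScale s⁻¹ w).2 = w.2 := fun w => by
    simp [smul_smul, hs0]
  simp only [hjDefect]
  rw [hang, h2, ← h1, hxs, hxs2, hy, hxs2]
  field_simp

set_option maxHeartbeats 1000000 in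
/-- The approximate solution of the Hamilton-Jacobi equation, in the original variables. -/
theorem ScaleData.exists_hamiltonJacobi (D : ScaleData k Z s Λ β A K M Q H R) {n e : ℕ} {κ : ℝ}
    (hκ : κ = (n + 1) * 2 * stepConst Q * Λ ^ 2 * homCost β M Q ^ 2 * (A / s)) (hκ1 : κ ≤ 1)
    (hQ : e + 4 + n ≤ Q) :
    ∃ χ z err : Base → ℝ, AngPeriodic (Metric.thickening (2 * s) Z) χ ∧
      IsSlow k (Metric.thickening (2 * s) Z) (Q - n) z ∧
      DBd (univ ×ˢ Metric.thickening (2 * s) Z) (Λ / s) (Q - n) (n * (homCost β M Q * A)) χ ∧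
      DBd (univ ×ˢ Metric.thickening (2 * s) Z) (Λ / s) (Q - n) (n * (homCost β M Q * A)) z ∧
      DBd (univ ×ˢ Metric.thickening (2 * s) Z) (Λ / s) 2
        (A * κ ^ n + n * (tailFactor Λ M e * A)) err ∧
      ∀ x : Base, x.2 ∈ Metric.thickening (2 * s) Z →
        hjDefect (fun x => H x.2) R χ z x = err x := by
  have hs := D.pos_s
  have hs0 := hs.ne'
  have hA := D.nonneg
  have hΛ0 : 0 ≤ Λ := by linarith [D.one_le]
  obtain ⟨χ, z, f, τ, hst⟩ := exists_iterStage D.iterData n hκ hκ1 hQ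
  set W := (fun y : Act => s • y) ⁻¹' Metric.thickening (2 * s) Z with hW
  set T := Metric.thickening (2 * s) Z with hT
  have hTo : IsOpen T := Metric.isOpen_thickening
  have hWo : IsOpen W := hTo.preimage (continuous_const_smul s)
  have hS : IsOpen ((univ : Set Ang) ×ˢ W) := isOpen_univ.prod hWo
  have hS' : IsOpen ((univ : Set Ang) ×ˢ T) := isOpen_univ.prod hTo
  have hmem : ∀ {J : Act}, J ∈ T → s⁻¹ • J ∈ W := fun {J} hJ => by
    simpa [hW, smul_smul, hs0] using hJ
  have hpre : (fun x : Base => (0 : Base) + actScale s⁻¹ x) ⁻¹' ((univ : Set Ang) ×ˢ W)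
      = univ ×ˢ T := by
    ext x; simp [hW, smul_smul, hs0]
  have hnorm : ‖actScale s⁻¹‖ ≤ s⁻¹ :=
    norm_actScale_le ((one_le_inv₀ hs).2 D.s_le_one) (by rw [abs_of_pos (inv_pos.2 hs)])
  have hκ0 : 0 ≤ κ := by
    have := zero_le_one.trans (one_le_homCost D.pos D.le_one M Q)
    rw [hκ]; unfold stepConst; positivity
  have huns : ∀ {g : Base → ℝ} {p : ℕ} {b b' : ℝ}, 0 ≤ b → s * b = b' →
      DBd (univ ×ˢ W) Λ p b g →
      DBd (univ ×ˢ T) (Λ / s) p b' (fun x => s * g (actScale s⁻¹ x)) := by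
    intro g p b b' hb hbb hg
    have h1 := hg.comp_affine hS 0 (actScale s⁻¹) hnorm hΛ0 hb
    rw [hpre, ← div_eq_mul_inv] at h1
    rw [← hbb]
    exact (h1.const_mul hS' hs.le).congr hS' fun x _ => by simp
  have hc0 := zero_le_one.trans (one_le_homCost D.pos D.le_one M Q)
  have htf := tailFactor_nonneg hΛ0 M e
  have hsA : s * (A / s) = A := mul_div_cancel₀ A hs0
  refine ⟨fun x => s * χ (actScale s⁻¹ x), fun x => s * z (actScale s⁻¹ x),
    fun x => s * (f (actScale s⁻¹ x) + τ (actScale s⁻¹ x)), ?_, ?_, ?_, ?_, ?_, ?_⟩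
  · intro φ I l hI
    simp only [actScale_apply]
    rw [hst.per_χ φ _ l (hmem hI)]
  · obtain ⟨ζ, h1, h2, h3⟩ := hst.slow_z
    refine ⟨fun a J => s * ζ a (s⁻¹ • J), fun x hx => ?_, fun a J hJ => ?_, ?_⟩
    · exact congrArg (s * ·) (h1 (actScale s⁻¹ x) (hmem hx))
    · exact congrArg (s * ·) (h2 a _ (hmem hJ))
    · have h4 : ContDiff ℝ (Q - n : ℕ) (fun y : ℝ × Act => (y.1, s⁻¹ • y.2)) :=
        contDiff_fst.prodMk (contDiff_snd.const_smul s⁻¹)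
      have h5 : ContDiffOn ℝ (Q - n : ℕ) (fun y : ℝ × Act => ζ y.1 (s⁻¹ • y.2)) (univ ×ˢ T) :=
        ContDiffOn.comp (g := fun y : ℝ × Act => ζ y.1 y.2) h3 h4.contDiffOn
          fun y hy => ⟨mem_univ _, hmem hy.2⟩
      exact contDiffOn_const.mul h5
  · exact huns (g := χ) (by positivity) (by linear_combination n * homCost β M Q * hsA) hst.bd_χ
  · exact huns (g := z) (by positivity) (by linear_combination n * homCost β M Q * hsA) hst.bd_z
  · have h1 := (hst.bd_f.mono_order (show 2 ≤ Q - n by omega)).add hst.bd_τ hS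
    exact huns (g := fun y => f y + τ y) (by positivity)
      (by linear_combination (κ ^ n + n * tailFactor Λ M e) * hsA) h1
  · intro x hx
    have hyW : actScale s⁻¹ x ∈ (univ : Set Ang) ×ˢ W := ⟨mem_univ _, hmem hx⟩
    rw [hjDefect_unscale hs0 (hst.bd_χ.differentiableAt hS (by omega) hyW), hst.eqn _ hyW]

end Scale

/-! ### The normal form from a solution of the Hamilton-Jacobi equation -/

section NormalForm

theorem CkNormLE.comp_rescale {F : Type} [NormedAddCommGroup F] [NormedSpace ℝ F] {W : Set Act}
    (hW : IsOpen W) {f : Base → F} {p : ℕ} {B σ : ℝ} (hf : ContDiffOn ℝ p f (univ ×ˢ W))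
    (h : CkNormLE p f (univ ×ˢ W) B) (hσ : 0 ≤ σ) (hσ1 : σ ≤ 1) (I₀ : Act) :
    CkNormLE p (f ∘ rescale σ I₀) (rescale σ I₀ ⁻¹' (univ ×ˢ W)) B := by
  intro i hi x hx
  have h1 : f ∘ rescale σ I₀ = fun x => f (((0, I₀) : Base) + actScale σ x) := by
    funext x
    rw [Function.comp_apply, rescale_eq]
  have hx' : ((0, I₀) : Base) + actScale σ x ∈ (univ : Set Ang) ×ˢ W := by
    rw [← rescale_eq]; exact hx
  rw [h1]
  refine (norm_iteratedFDeriv_comp_affine_le (isOpen_univ.prod hW) hf _ _ hx' hi).trans ?_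
  have h2 : ‖actScale σ‖ ^ i ≤ 1 :=
    pow_le_one₀ (norm_nonneg _) (norm_actScale_le le_rfl (by rwa [abs_of_nonneg hσ]))
  exact (mul_le_of_le_one_right (norm_nonneg _) h2).trans (h i hi _ hx')

/-- The rescaling divides the displacement of the actions and of the energy by `σ`, and the
derivatives do not increase, as `σ ≤ 1`. -/
theorem ckNormLE_rescaledDisplacement {W : Set Act} (hW : IsOpen W) {Φ : Base → Base}
    {e : Base → ℝ} (hΦ : IsSymplecticChange W Φ e) {B σ : ℝ}
    (h : CkNormLE 1 (displacement Φ e) (univ ×ˢ W) B) (hσ : 0 < σ) (hσ1 : σ ≤ 1) (I₀ : Act) :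
    CkNormLE 1 (rescaledDisplacement σ I₀ Φ e) (rescale σ I₀ ⁻¹' (univ ×ˢ W)) (σ⁻¹ * B) := by
  have hsm : ContDiffOn ℝ 1 (displacement Φ e) (univ ×ˢ W) :=
    ((hΦ.smooth.of_le (by norm_num)).sub contDiffOn_id).prodMk (hΦ.smooth_e.of_le (by norm_num))
  set L : Ext →L[ℝ] Ext := ((actScale σ⁻¹).comp (ContinuousLinearMap.fst ℝ Base ℝ)).prod
    (σ⁻¹ • ContinuousLinearMap.snd ℝ Base ℝ) with hL
  have hσi : 1 ≤ σ⁻¹ := (one_le_inv₀ hσ).2 hσ1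
  have hLn : ‖L‖ ≤ σ⁻¹ := by
    refine ContinuousLinearMap.opNorm_le_bound _ (by linarith) fun z => ?_
    rw [hL, ContinuousLinearMap.prod_apply, Prod.norm_def]
    refine max_le ?_ ?_
    · have h1 := norm_actScale_le hσi (le_of_eq (abs_of_pos (inv_pos.2 hσ)))
      rw [ContinuousLinearMap.comp_apply]
      exact ((actScale σ⁻¹).le_opNorm _).trans
        (mul_le_mul h1 (norm_fst_le z) (norm_nonneg _) (by linarith))
    · rw [smul_apply, norm_smul, Real.norm_of_nonneg (by linarith)]
      exact mul_le_mul_of_nonneg_left (norm_snd_le z) (by linarith)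
  have hcomp := CkNormLE.comp_rescale hW hsm h hσ.le hσ1 I₀
  have hcs : ContDiffOn ℝ 1 (displacement Φ e ∘ rescale σ I₀) (rescale σ I₀ ⁻¹' (univ ×ˢ W)) := by
    refine hsm.comp ?_ fun x hx => hx
    have : rescale σ I₀ = fun x => ((0, I₀) : Base) + actScale σ x := funext (rescale_eq σ I₀)
    rw [this]
    exact (contDiff_const.add (actScale σ).contDiff).contDiffOn
  have hopen : IsOpen (rescale σ I₀ ⁻¹' ((univ : Set Ang) ×ˢ W)) := by
    refine (isOpen_univ.prod hW).preimage ?_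
    have : rescale σ I₀ = fun x => ((0, I₀) : Base) + actScale σ x := funext (rescale_eq σ I₀)
    rw [this]
    exact continuous_const.add (actScale σ).continuous
  intro i hi x hx
  have h1 := L.norm_iteratedFDeriv_comp_left (n := i) (hcs.contDiffAt (hopen.mem_nhds hx))
    (by exact_mod_cast hi)
  refine h1.trans (mul_le_mul hLn (hcomp i hi x hx) (norm_nonneg _) (by linarith))

variable {k : Fin 3 → ℤ} {Z : Set Act} {s Λ a b κ : ℝ} {H : Act → ℝ} {R χ z err : Base → ℝ}

theorem CkNormLE.of_dBd {W : Set Act} {f : Base → ℝ} {p : ℕ} {B : ℝ} (h : DBd (univ ×ˢ W) Λ p B f)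
    (hΛ : 1 ≤ Λ) : CkNormLE p f (univ ×ˢ W) (B * Λ ^ p) := fun i hi x hx =>
  (h.2 i hi x hx).trans
    (mul_le_mul_of_nonneg_left (pow_le_pow_right₀ hΛ hi) (h.nonneg hx))

set_option synthInstance.maxHeartbeats 400000 in
/-- Weighted bounds of order three make `χ` a generating function on the `s`-neighbourhood of `Z`.
-/
theorem genFun_of_dBd (hs : 0 < s) (hΛ : 1 ≤ Λ)
    (hχp : AngPeriodic (Metric.thickening (2 * s) Z) χ)
    (hχ : DBd (univ ×ˢ Metric.thickening (2 * s) Z) Λ 3 a χ) (h₂ : a * Λ ^ 2 ≤ κ)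
    (h₃ : a * Λ ^ 3 ≤ 1) (hκ : κ ≤ 1 / 16) (hκs : 8 * κ ≤ s) :
    GenFun (Metric.thickening s Z) (Metric.thickening (2 * s) Z) (s / 2) κ χ := by
  have hS : IsOpen ((univ : Set Ang) ×ˢ Metric.thickening (2 * s) Z) :=
    isOpen_univ.prod Metric.isOpen_thickening
  have h1 := hχ.fderiv hS
  have h2 := h1.fderiv hS
  have h3 := h2.fderiv hS
  refine ⟨Metric.isOpen_thickening, Metric.isOpen_thickening, fun J hJ d hd => ?_, hκ,
    by linarith, hχ.1, hχp, fun x hx => ?_, fun x hx => ?_, fun x hx => ?_⟩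
  · exact Metric.thickening_mono (by linarith) Z (mem_thickening_add hJ hd)
  · have ha : 0 ≤ a := hχ.nonneg (x := x) ⟨mem_univ _, hx⟩
    refine (h1.norm_le ⟨mem_univ _, hx⟩).trans (le_trans ?_ h₂)
    calc a * Λ = a * Λ ^ 1 := by ring
      _ ≤ a * Λ ^ 2 := by gcongr; norm_num
  · refine (h2.norm_le ⟨mem_univ _, hx⟩).trans (le_trans (le_of_eq ?_) h₂)
    ring
  · refine (h3.norm_le ⟨mem_univ _, hx⟩).trans (le_trans (le_of_eq ?_) h₃)
    ring

/-- The remainder, expressed in the new coordinates; `4096 = 2 ^ (2 ^ 2) * 16 ^ 2` is the constant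
of `DBd.comp` with the bound `16` for the first derivative and order `2`. -/
theorem GenFun.dBd_comp_mixedCoord {W W' : Set Act} {δ : ℝ} {g : Base → Base}
    (D : GenFun W W' δ κ χ) (hδ : 0 ≤ δ) (hg : IsMixedCoord W χ g) (hΛ : 1 ≤ Λ) (hb : 0 ≤ b)
    (h : DBd (univ ×ˢ W') Λ 2 b err) :
    DBd (univ ×ˢ W) Λ 2 (4096 * b) (fun x => err (g x)) := by
  have hS : IsOpen ((univ : Set Ang) ×ˢ W) := isOpen_univ.prod D.isOpen
  have hS' : IsOpen ((univ : Set Ang) ×ˢ W') := isOpen_univ.prod D.isOpen'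
  have hc := D.contDiffOn_mixedCoord hδ hg
  have h1 : DBd (univ ×ˢ W) Λ 1 16 (fderiv ℝ g) := by
    refine ⟨hc.fderiv_of_isOpen hS (by norm_num), fun i hi x hx => ?_⟩
    interval_cases i
    · rw [norm_iteratedFDeriv_zero]
      linarith [D.norm_fderiv_mixedCoord_le hδ hg hx.2]
    · rw [norm_iteratedFDeriv_one]
      linarith [D.norm_fderiv_fderiv_mixedCoord_le hδ hg hx.2]
  refine (DBd.comp hS hS' (by linarith) (by norm_num : (1 : ℝ) ≤ 16)
    (fun x hx => ⟨mem_univ _, D.mem_of_mixedCoord hδ hg hx.2⟩) 2 hb h hc.continuousOn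
    fun j hj => ⟨hc.differentiableOn (by norm_num), h1.mono_order (by omega)⟩).mono_bound
    (by linarith) (le_of_eq (by norm_num))

set_option maxHeartbeats 1000000 in
/-- A generating function that solves the Hamilton-Jacobi equation up to an error gives a change of
coordinates to a resonant normal form with a small remainder. -/
theorem exists_normalForm_of_hamiltonJacobi (hs : 0 < s) (hΛ : 1 ≤ Λ) (hb : 0 ≤ b)
    (hR : AngPeriodic (Metric.thickening (2 * s) Z) R)
    (hχp : AngPeriodic (Metric.thickening (2 * s) Z) χ)
    (hzs : IsSlow k (Metric.thickening (2 * s) Z) 2 z)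
    (hχ : DBd (univ ×ˢ Metric.thickening (2 * s) Z) Λ 3 a χ)
    (hz : DBd (univ ×ˢ Metric.thickening (2 * s) Z) Λ 2 a z)
    (he : DBd (univ ×ˢ Metric.thickening (2 * s) Z) Λ 2 b err)
    (heq : ∀ x : Base, x.2 ∈ Metric.thickening (2 * s) Z →
      hjDefect (fun x => H x.2) R χ z x = err x)
    (h₂ : a * Λ ^ 2 ≤ κ) (h₃ : a * Λ ^ 3 ≤ 1) (hκ : κ ≤ 1 / 16) (hκs : 8 * κ ≤ s) :
    ∃ (Φ : Base → Base) (e : Base → ℝ) (ζ : ℝ → Act → ℝ) (Rk : Base → ℝ),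
      IsSymplecticChange (Metric.thickening s Z) Φ e ∧
      (∀ x : Base, x.2 ∈ Metric.thickening s Z → (Φ x).2 ∈ Metric.thickening (2 * s) Z) ∧
      univ ×ˢ Z ⊆ Φ '' (univ ×ˢ Metric.thickening s Z) ∧
      (∀ x : Base, x.2 ∈ Metric.thickening s Z →
        H (Φ x).2 + R (Φ x) + e x = H x.2 + ζ (slow k x.1) x.2 + Rk x) ∧
      (∀ (t : ℝ) (J : Act), J ∈ Metric.thickening s Z →
        ζ (t + (Finset.univ.gcd k : ℤ)) J = ζ t J) ∧
      AngPeriodic (Metric.thickening s Z) Rk ∧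
      ContDiffOn ℝ 2 (fun y : ℝ × Act => ζ y.1 y.2) (univ ×ˢ Metric.thickening s Z) ∧
      ContDiffOn ℝ 2 Rk (univ ×ˢ Metric.thickening s Z) ∧
      CkNormLE 2 (onSlow k ζ) (univ ×ˢ Metric.thickening s Z) (a * Λ ^ 2) ∧
      CkNormLE 2 Rk (univ ×ˢ Metric.thickening s Z) (4096 * b * Λ ^ 2) ∧
      CkNormLE 1 (displacement Φ e) (univ ×ˢ Metric.thickening s Z) (8 * κ) := by
  have D := genFun_of_dBd hs hΛ hχp hχ h₂ h₃ hκ hκs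
  have hδ : 0 ≤ s / 2 := by linarith
  obtain ⟨g, hg⟩ := D.exists_isMixedCoord hδ
  obtain ⟨ζ, hζ, hζp, hζc⟩ := hzs
  have hsub : Metric.thickening s Z ⊆ Metric.thickening (2 * s) Z :=
    Metric.thickening_mono (by linarith) Z
  have hS : IsOpen ((univ : Set Ang) ×ˢ Metric.thickening s Z) :=
    isOpen_univ.prod Metric.isOpen_thickening
  have hSS : (univ : Set Ang) ×ˢ Metric.thickening s Z ⊆ univ ×ˢ Metric.thickening (2 * s) Z :=
    prod_mono subset_rfl hsub
  have hsymp := D.isSymplecticChange hδ hg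
  have hRk := D.dBd_comp_mixedCoord hδ hg hΛ hb he
  have hmain : ∀ x : Base, x.2 ∈ Metric.thickening s Z →
      H (genMap χ g x).2 + R (genMap χ g x) + genShift χ g x =
        H x.2 + ζ (slow k x.1) x.2 + err (g x) := by
    intro x hx
    have h1 := heq (g x) (D.mem_of_mixedCoord hδ hg hx)
    simp only [hjDefect] at h1
    rw [hg.eqn x hx, hζ x (hsub hx), hg.snd x hx] at h1
    rw [← h1]
    simp only [genMap, genShift]
    ring
  refine ⟨genMap χ g, genShift χ g, ζ, fun x => err (g x), hsymp,
    fun x hx => D.genMap_mem hδ hg hx, ?_, hmain, fun t J hJ => hζp t J (hsub hJ), ?_,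
    hζc.mono (prod_mono subset_rfl hsub), hRk.1, ?_, CkNormLE.of_dBd hRk hΛ,
    D.ckNormLE_displacement hδ hg⟩
  · intro x hx
    refine D.mem_image hδ hg fun d hd => ?_
    rw [Metric.mem_thickening_iff]
    exact ⟨x.2, hx.2, by simpa [dist_eq_norm] using lt_of_le_of_lt hd (by linarith)⟩
  -- the remainder is periodic because all the other terms of the transformed Hamiltonian are
  · intro φ I l hI
    have h1 := hmain (φ + intVec l, I) hI
    have h2 := hmain (φ, I) hI
    have h3 : genMap χ g (φ + intVec l, I) = ((genMap χ g (φ, I)).1 + intVec l,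
        (genMap χ g (φ, I)).2) := by
      rw [hsymp.equivariant φ I l hI]
      exact Prod.ext rfl (add_zero _)
    have h4 : ζ (slow k (φ + intVec l)) I = ζ (slow k φ) I := by
      obtain ⟨j, hj⟩ : ((Finset.univ.gcd k : ℤ)) ∣ ∑ i, k i * l i :=
        Finset.dvd_sum fun i hi => Dvd.dvd.mul_right (Finset.gcd_dvd hi) _
      have hper : Function.Periodic (fun t => ζ t I) ((Finset.univ.gcd k : ℤ) : ℝ) :=
        fun t => hζp t I (hsub hI)
      have h5 := hper.int_mul j (slow k φ)
      rw [slow_add, slow_intVec, hj]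
      push_cast
      rw [mul_comm]
      exact h5
    rw [h3, hR _ _ l (D.genMap_mem (x := (φ, I)) hδ hg hI), hsymp.periodic_e φ I l hI] at h1
    simp only [h4] at h1
    have h6 : H (genMap χ g (φ, I)).2 + R (genMap χ g (φ, I)) + genShift χ g (φ, I)
        = H I + ζ (slow k φ) I + err (g (φ + intVec l, I)) := h1
    rw [h2] at h6
    simpa using h6.symm
  · have h1 : EqOn (onSlow k ζ) z (univ ×ˢ Metric.thickening s Z) := fun x hx =>
      (hζ x (hsub hx.2)).symm
    exact CkNormLE.of_dBd ((hz.mono_set hSS).congr hS h1) hΛ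

end NormalForm

/-! ### The frequency map of a strictly convex Hamiltonian -/

section FrequencyMap

variable {U : Set Act} {H : Act → ℝ} {K D η : ℝ}

theorem norm_gradient_sub (I J : Act) :
    ‖gradient H I - gradient H J‖ = ‖fderiv ℝ H I - fderiv ℝ H J‖ := by
  rw [gradient, gradient, ← map_sub, LinearIsometryEquiv.norm_map]

theorem hasFDerivAt_fderiv_of_contDiffOn (hU : IsOpen U) (hH : ContDiffOn ℝ 2 H U) {I : Act}
    (hI : I ∈ U) : HasFDerivAt (fderiv ℝ H) (fderiv ℝ (fderiv ℝ H) I) I := by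
  have h1 : ContDiffAt ℝ 1 (fderiv ℝ H) I :=
    (hH.contDiffAt (hU.mem_nhds hI)).fderiv_right (by norm_num)
  exact (h1.differentiableAt one_ne_zero).hasFDerivAt

theorem norm_gradient_sub_le (hU : IsOpen U) (hc : Convex ℝ U) (hH : ContDiffOn ℝ 2 H U)
    (hK : CkNormLE 2 H U K) {I J : Act} (hI : I ∈ U) (hJ : J ∈ U) :
    ‖gradient H I - gradient H J‖ ≤ K * ‖I - J‖ := by
  rw [norm_gradient_sub]
  refine hc.norm_image_sub_le_of_norm_fderiv_le (𝕜 := ℝ)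
    (fun z hz => (hasFDerivAt_fderiv_of_contDiffOn hU hH hz).differentiableAt)
    (fun z hz => ?_) hJ hI
  have h1 := hK 2 le_rfl z hz
  have h2 : ‖iteratedFDeriv ℝ 1 (fderiv ℝ H) z‖ = ‖iteratedFDeriv ℝ (1 + 1) H z‖ :=
    norm_iteratedFDeriv_fderiv
  rw [norm_iteratedFDeriv_one] at h2
  rw [h2]
  exact h1

/-- The frequency map of a strictly convex Hamiltonian is expanding up to a factor. -/
theorem norm_sub_le_norm_gradient_sub (hU : IsOpen U) (hc : Convex ℝ U)
    (hH : ContDiffOn ℝ 2 H U) (hD : 0 < D) (hHess : HessianBounds H U D) {I J : Act}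
    (hI : I ∈ U) (hJ : J ∈ U) : ‖I - J‖ ≤ D * ‖gradient H I - gradient H J‖ := by
  set v := I - J with hv
  have hmem : ∀ t ∈ Icc (0 : ℝ) 1, J + t • v ∈ U := fun t ht =>
    hc.add_smul_sub_mem hJ hI ht
  set f : ℝ → ℝ := fun t => fderiv ℝ H (J + t • v) v with hf
  have hd : ∀ t ∈ Icc (0 : ℝ) 1, HasDerivAt f (fderiv ℝ (fderiv ℝ H) (J + t • v) v v) t := by
    intro t ht
    have h1 : HasDerivAt (fun t : ℝ => J + t • v) v t := by
      simpa using ((hasDerivAt_id t).smul_const v).const_add J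
    have h2 := (hasFDerivAt_fderiv_of_contDiffOn hU hH (hmem t ht)).comp_hasDerivAt t h1
    exact (ContinuousLinearMap.apply ℝ ℝ v).hasFDerivAt.comp_hasDerivAt t h2
  have hmv := (convex_Icc (0 : ℝ) 1).mul_sub_le_image_sub_of_le_deriv (f := f)
    (C := D⁻¹ * ‖v‖ ^ 2) (fun t ht => (hd t ht).continuousAt.continuousWithinAt)
    (fun t ht => (hd t (interior_subset ht)).differentiableAt.differentiableWithinAt)
    (fun t ht => by
      rw [(hd t (interior_subset ht)).deriv]
      have h1 := (hHess _ (hmem t (interior_subset ht)) v).1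
      rw [iteratedFDeriv_two_apply] at h1
      simpa using h1) 0 (left_mem_Icc.2 zero_le_one) 1 (right_mem_Icc.2 zero_le_one) zero_le_one
  have h1 : f 1 - f 0 = (fderiv ℝ H I - fderiv ℝ H J) v := by
    simp [hf, hv]
  have h2 := (fderiv ℝ H I - fderiv ℝ H J).le_opNorm v
  rw [← norm_gradient_sub, Real.norm_eq_abs] at h2
  have h3 := (le_abs_self _).trans h2
  rw [← h1] at h3
  have h4 : D⁻¹ * ‖v‖ ^ 2 ≤ ‖gradient H I - gradient H J‖ * ‖v‖ := by linarith
  rcases eq_or_lt_of_le (norm_nonneg v) with h0 | h0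
  · rw [← h0]; positivity
  · have h5 : D⁻¹ * ‖v‖ ≤ ‖gradient H I - gradient H J‖ := by
      refine le_of_mul_le_mul_right ?_ h0
      calc _ = D⁻¹ * ‖v‖ ^ 2 := by ring
        _ ≤ _ := h4
    calc ‖v‖ = D * (D⁻¹ * ‖v‖) := by field_simp
      _ ≤ _ := by gcongr

/-- If the image of the frequency map contains the ball of radius `η` around the frequency of `I₀`,
the domain contains a ball around `I₀`: no boundary point of the domain can be reached there, since
the limit of the frequencies along the way is the frequency of a point of the domain. -/
theorem ball_subset_of_ball_subset_image (hU : IsOpen U) (hc : Convex ℝ U)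
    (hH : ContDiffOn ℝ 2 H U) (hD : 0 < D) (hK0 : 0 < K) (hK : CkNormLE 2 H U K)
    (hHess : HessianBounds H U D) {I₀ : Act} (hI₀ : I₀ ∈ U) (hη : 0 < η)
    (hball : Metric.ball (gradient H I₀) η ⊆ gradient H '' U) :
    Metric.ball I₀ (η / K) ⊆ U := by
  refine (convex_ball I₀ (η / K)).isPreconnected.subset_of_closure_inter_subset hU
    ⟨I₀, Metric.mem_ball_self (by positivity), hI₀⟩ fun J hJ => ?_
  obtain ⟨x, hx, hxJ⟩ := mem_closure_iff_seq_limit.1 hJ.1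
  have hcau : CauchySeq fun n => gradient H (x n) := by
    rw [Metric.cauchySeq_iff']
    intro ε hε
    obtain ⟨N, hN⟩ := Metric.cauchySeq_iff'.1 hxJ.cauchySeq (ε / K) (by positivity)
    refine ⟨N, fun n hn => ?_⟩
    have h1 := norm_gradient_sub_le hU hc hH hK (hx n) (hx N)
    have h2 := hN n hn
    rw [dist_eq_norm] at h2 ⊢
    rw [lt_div_iff₀ hK0] at h2
    linarith
  obtain ⟨ω, hω⟩ := cauchySeq_tendsto_of_complete hcau
  have hωball : ω ∈ Metric.ball (gradient H I₀) η := by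
    have h1 : ‖ω - gradient H I₀‖ ≤ K * ‖J - I₀‖ :=
      le_of_tendsto_of_tendsto' (hω.sub_const _).norm ((hxJ.sub_const I₀).norm.const_mul K)
        fun n => norm_gradient_sub_le hU hc hH hK (hx n) hI₀
    have h2 := hJ.2
    rw [Metric.mem_ball, dist_eq_norm, lt_div_iff₀ hK0] at h2
    rw [Metric.mem_ball, dist_eq_norm]
    linarith
  obtain ⟨J', hJ', hJω⟩ := hball hωball
  have h0 : ‖J - J'‖ ≤ D * ‖ω - ω‖ :=
    le_of_tendsto_of_tendsto' (hxJ.sub_const J').norm ((hω.sub_const ω).norm.const_mul D)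
      fun n => by rw [← hJω]; exact norm_sub_le_norm_gradient_sub hU hc hH hD hHess (hx n) hJ'
  rw [sub_self, norm_zero, mul_zero] at h0
  rw [sub_eq_zero.1 (norm_eq_zero.1 (le_antisymm h0 (norm_nonneg _)))]
  exact hJ'

end FrequencyMap

/-! ### Small divisors near a strong double resonance -/

section Divisors

variable {k k' k'' : Fin 3 → ℤ}

/-- Vanishing minors give a rational multiple; the integer factor comes from a Bézout relation for
`gcd k`. -/
theorem isMultiple_of_minors (h₀₁ : k' 0 * k 1 = k' 1 * k 0) (h₀₂ : k' 0 * k 2 = k' 2 * k 0)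
    (h₁₂ : k' 1 * k 2 = k' 2 * k 1) : IsMultiple k k' := by
  obtain ⟨a, ha⟩ := Finset.gcd_eq_sum_mul Finset.univ k
  refine ⟨∑ i, k' i * a i, fun i => ?_⟩
  rw [ha, Fin.sum_univ_three, Fin.sum_univ_three]
  fin_cases i
  · change (k 0 * a 0 + k 1 * a 1 + k 2 * a 2) * k' 0 = (k' 0 * a 0 + k' 1 * a 1 + k' 2 * a 2) * k 0
    linear_combination a 1 * h₀₁ + a 2 * h₀₂
  · change (k 0 * a 0 + k 1 * a 1 + k 2 * a 2) * k' 1 = (k' 0 * a 0 + k' 1 * a 1 + k' 2 * a 2) * k 1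
    linear_combination -a 0 * h₀₁ + a 2 * h₁₂
  · change (k 0 * a 0 + k 1 * a 1 + k 2 * a 2) * k' 2 = (k' 0 * a 0 + k' 1 * a 1 + k' 2 * a 2) * k 2
    linear_combination -a 0 * h₀₂ - a 1 * h₁₂

theorem len_sq (k : Fin 3 → ℤ) : len k ^ 2 = (k 0 : ℝ) ^ 2 + (k 1 : ℝ) ^ 2 + (k 2 : ℝ) ^ 2 := by
  rw [len, Real.sq_sqrt (by positivity), Fin.sum_univ_three]

theorem len_nonneg (k : Fin 3 → ℤ) : 0 ≤ len k := Real.sqrt_nonneg _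

theorem abs_minor_le (k k'' : Fin 3 → ℤ) :
    |(k 0 * k'' 1 - k 1 * k'' 0 : ℝ)| ≤ len k * len k'' := by
  refine abs_le_of_sq_le_sq ?_ (mul_nonneg (len_nonneg k) (len_nonneg k''))
  rw [mul_pow, len_sq, len_sq]
  nlinarith [sq_nonneg ((k 0 : ℝ) * k'' 0 + k 1 * k'' 1), sq_nonneg ((k 2 : ℝ) * k'' 2),
    sq_nonneg ((k 2 : ℝ) * k'' 0), sq_nonneg ((k 2 : ℝ) * k'' 1), sq_nonneg ((k 0 : ℝ) * k'' 2),
    sq_nonneg ((k 1 : ℝ) * k'' 2)]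

/-- A strong double resonance has a short second resonant vector, still transversal to `k`. -/
theorem exists_short_of_isStrongDR {ω : Act} (h : IsStrongDR k k' ω) :
    ∃ k'' : Fin 3 → ℤ, k 0 * k'' 1 - k 1 * k'' 0 ≠ 0 ∧ kdot k'' ω = 0 ∧
      len k'' ≤ len k ^ thetaPar := by
  obtain ⟨h1, h2, h3, k'', h4, h5, h6⟩ := h
  obtain ⟨a, b, rfl⟩ := AddSubgroup.mem_closure_pair.1 h4
  have hb : b ≠ 0 := by
    rintro rfl
    exact h5 (AddSubgroup.mem_zmultiples_iff.2 ⟨a, by simp⟩)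
  refine ⟨_, ?_, ?_, h6⟩
  · simp only [Pi.add_apply, Pi.smul_apply, smul_eq_mul]
    have : k 0 * (a * k 1 + b * k' 1) - k 1 * (a * k 0 + b * k' 0)
        = b * (k 0 * k' 1 - k 1 * k' 0) := by ring
    rw [this]
    exact mul_ne_zero hb h1
  · simp only [kdot, Pi.add_apply, Pi.smul_apply, smul_eq_mul] at h2 h3 ⊢
    push_cast
    linear_combination a * h2 + b * h3

/-- At a double resonance `ω` of `k` and `k''`, an integer vector `k'` that is not a multiple of `k`
either is not resonant, and then its divisor is at least `1 / (|k| |k''|)`, since a determinant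
of integers is not zero; or it is resonant, and then its divisor at another frequency on the
resonant line of `k` is comparable to the distance from `ω`. -/
theorem divisor_dichotomy {ω : Act} (hnk : ¬ IsMultiple k k')
    (hk : k 0 * k'' 1 - k 1 * k'' 0 ≠ 0) (hkω : kdot k ω = 0) (hk''ω : kdot k'' ω = 0) :
    1 ≤ len k * len k'' * |kdot k' ω| ∨
      ∀ ω' : Act, kdot k ω' = 0 → ‖ω' - ω‖ ≤ len k * |kdot k' ω'| := by
  set n := k 0 * k'' 1 - k 1 * k'' 0 with hn
  set d := n * k' 2 - (k 0 * k'' 2 - k 2 * k'' 0) * k' 1 + (k 1 * k'' 2 - k 2 * k'' 1) * k' 0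
    with hd
  have hdet : (d : ℝ) = n * kdot k' ω := by
    simp only [kdot] at hkω hk''ω ⊢
    rw [hd, hn]
    push_cast
    linear_combination (k' 1 * k'' 0 - k' 0 * k'' 1 : ℝ) * hkω
      + (k 1 * k' 0 - k 0 * k' 1 : ℝ) * hk''ω
  by_cases hd0 : d = 0
  · right
    have hk'ω : kdot k' ω = 0 := by
      rw [hd0, Int.cast_zero] at hdet
      have : (n : ℝ) ≠ 0 := by exact_mod_cast hk
      exact (mul_eq_zero.1 hdet.symm).resolve_left this
    set m := k 0 * k' 1 - k 1 * k' 0 with hm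
    have hm0 : m ≠ 0 := by
      intro h0
      refine hnk (isMultiple_of_minors (by linarith) ?_ ?_)
      · refine mul_left_cancel₀ hk ?_
        rw [hd] at hd0
        linear_combination -k 0 * hd0 - (k 0 * k'' 2 - k 2 * k'' 0) * h0
      · refine mul_left_cancel₀ hk ?_
        rw [hd] at hd0
        linear_combination -k 1 * hd0 - (k 1 * k'' 2 - k 2 * k'' 1) * h0
    intro ω' hω'
    have hm1 : (1 : ℝ) ≤ |(m : ℝ)| := by exact_mod_cast Int.one_le_abs hm0
    set y := kdot k' ω' with hy
    have e1 : (m : ℝ) * (ω' - ω) 0 = - k 1 * y := by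
      simp only [kdot] at hkω hk'ω hω' hy
      simp only [PiLp.sub_apply]
      rw [hy, hm]; push_cast
      linear_combination (k' 1 : ℝ) * (hω' - hkω) + (k 1 : ℝ) * hk'ω
    have e2 : (m : ℝ) * (ω' - ω) 1 = k 0 * y := by
      simp only [kdot] at hkω hk'ω hω' hy
      simp only [PiLp.sub_apply]
      rw [hy, hm]; push_cast
      linear_combination -(k' 0 : ℝ) * (hω' - hkω) - (k 0 : ℝ) * hk'ω
    refine (le_mul_of_one_le_left (norm_nonneg _) hm1).trans
      ((pow_le_pow_iff_left₀ (by positivity)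
        (mul_nonneg (len_nonneg k) (abs_nonneg y)) two_ne_zero).1 ?_)
    have h1 : ‖ω' - ω‖ ^ 2 = (ω' - ω) 0 ^ 2 + (ω' - ω) 1 ^ 2 := by
      rw [EuclideanSpace.real_norm_sq_eq, Fin.sum_univ_two]
    rw [mul_pow, mul_pow, sq_abs, sq_abs, h1, len_sq]
    calc (m : ℝ) ^ 2 * ((ω' - ω) 0 ^ 2 + (ω' - ω) 1 ^ 2)
        = (m * (ω' - ω) 0) ^ 2 + (m * (ω' - ω) 1) ^ 2 := by ring
      _ = ((k 0 : ℝ) ^ 2 + k 1 ^ 2) * y ^ 2 := by rw [e1, e2]; ring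
      _ ≤ _ := by
        refine mul_le_mul_of_nonneg_right ?_ (sq_nonneg y)
        linarith [sq_nonneg (k 2 : ℝ)]
  · left
    have hd1 : (1 : ℝ) ≤ |(d : ℝ)| := by exact_mod_cast Int.one_le_abs hd0
    rw [hdet, abs_mul] at hd1
    refine hd1.trans (mul_le_mul_of_nonneg_right ?_ (abs_nonneg _))
    rw [hn]
    push_cast
    exact abs_minor_le k k''

theorem abs_kdot_sub_le {M : ℕ} (hk' : k' ∈ box M) (ω ω' : Act) :
    |kdot k' ω - kdot k' ω'| ≤ 2 * M * ‖ω - ω'‖ := by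
  have h : ∀ i, |(k' i : ℝ)| ≤ M := fun i => by
    simp only [box, Fintype.mem_piFinset, Finset.mem_Icc] at hk'
    rw [abs_le]
    exact ⟨by exact_mod_cast (hk' i).1, by exact_mod_cast (hk' i).2⟩
  have h1 : ∀ j, |(ω - ω') j| ≤ ‖ω - ω'‖ := fun j => PiLp.norm_apply_le (ω - ω') j
  have h2 : kdot k' ω - kdot k' ω' = k' 0 * (ω - ω') 0 + k' 1 * (ω - ω') 1 := by
    simp only [kdot, PiLp.sub_apply]; ring
  rw [h2]
  refine (abs_add_le _ _).trans ?_
  rw [abs_mul, abs_mul]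
  have h3 : |(k' 0 : ℝ)| * |(ω - ω') 0| ≤ M * ‖ω - ω'‖ :=
    mul_le_mul (h 0) (h1 0) (abs_nonneg _) (by positivity)
  have h4 : |(k' 1 : ℝ)| * |(ω - ω') 1| ≤ M * ‖ω - ω'‖ :=
    mul_le_mul (h 1) (h1 1) (abs_nonneg _) (by positivity)
  linarith

end Divisors

/-! ### The single resonance zone -/

section Zone

variable {U : Set Act} {H : Act → ℝ} {S : Set Act} {K D c ρ μ s : ℝ} {k k₁ k₂ : Fin 3 → ℤ}
  {I₁ I₂ : Act}

/-- Points of the zone are close to the resonant segment. The infimum distance need not be attained,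
whence the factor `2`. -/
theorem exists_near_actSegment {σ : ℝ} (hσ : σ = c * ρ ^ ((mPar : ℝ) + (thetaPar : ℝ) / 3 + 1))
    (hσ0 : 0 < σ) (hI₁ : I₁ ∈ actSegment U H S) {z : Act}
    (hz : z ∈ zoneActions U H S c ρ μ I₁ I₂) : ∃ J ∈ actSegment U H S, dist z J < 2 * σ := by
  refine (Metric.infDist_lt_iff ⟨I₁, hI₁⟩).1 (lt_of_le_of_lt hz.2 ?_)
  rw [← hσ]
  linarith

/-- The divisors are bounded below near the single resonance zone. A divisor that does not vanish at
the double resonance is large there, and the zone lies close to the double resonance; a divisor that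
vanishes there is bounded below at the distance of the zone from the double resonance. -/
theorem le_divisor_of_mem_thickening (hU : IsOpen U) (hc : Convex ℝ U) (hH : ContDiffOn ℝ 2 H U)
    (hD : 0 < D) (hK0 : 0 < K) (hK : CkNormLE 2 H U K) (hHess : HessianBounds H U D)
    (hS : ∀ x ∈ S, kdot k x = 0)
    (hI₁ : I₁ ∈ actSegment U H S) (hI₂ : I₂ ∈ actSegment U H S)
    (hk₁ : IsStrongDR k k₁ (gradient H I₁)) (hk₂ : IsStrongDR k k₂ (gradient H I₂))
    {σ : ℝ} (hσ : σ = c * ρ ^ ((mPar : ℝ) + (thetaPar : ℝ) / 3 + 1)) (hσ0 : 0 < σ)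
    (hZU : Metric.thickening (2 * s) (zoneActions U H S c ρ μ I₁ I₂) ⊆ U)
    {X β : ℝ} (hX : 0 < X) (hkX : len k ≤ X) {M : ℕ}
    (h₁ : β + 2 * M * (K * (μ + 2 * s)) ≤ (X ^ (1 + thetaPar))⁻¹)
    (h₂ : β + 2 * M * (K * (2 * σ + 2 * s)) ≤ (c * ρ ^ mPar - 2 * σ) / (D * X))
    {k' : Fin 3 → ℤ} (hk' : k' ∈ box M) (hnk : ¬ IsMultiple k k') {I : Act}
    (hI : I ∈ Metric.thickening (2 * s) (zoneActions U H S c ρ μ I₁ I₂)) :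
    β ≤ |kdot k' (gradient H I)| := by
  have hIU : I ∈ U := hZU hI
  obtain ⟨z, hz, hIz⟩ := Metric.mem_thickening_iff.1 hI
  obtain ⟨J, hJ, hzJ⟩ := exists_near_actSegment hσ hσ0 hI₁ hz
  -- passing from a nearby point to `I` changes the divisor by a small amount
  have hmove : ∀ (P : Act) (d : ℝ), P ∈ U → dist I P ≤ d →
      |kdot k' (gradient H P)| - 2 * M * (K * d) ≤ |kdot k' (gradient H I)| := by
    intro P d hP hd
    have h1 := abs_kdot_sub_le hk' (gradient H P) (gradient H I)
    have h2 := norm_gradient_sub_le hU hc hH hK hP hIU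
    rw [dist_comm, dist_eq_norm] at hd
    have h3 := abs_sub_abs_le_abs_sub (kdot k' (gradient H P)) (kdot k' (gradient H I))
    have h4 : 2 * (M : ℝ) * ‖gradient H P - gradient H I‖ ≤ 2 * M * (K * d) :=
      mul_le_mul_of_nonneg_left (h2.trans (by gcongr)) (by positivity)
    linarith
  have key : ∀ (I₀ : Act) (k₀ : Fin 3 → ℤ), I₀ ∈ actSegment U H S →
      IsStrongDR k k₀ (gradient H I₀) → z ∈ annulus U c ρ μ I₀ →
      β ≤ |kdot k' (gradient H I)| := by
    intro I₀ k₀ hI₀ hk₀ hz₀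
    obtain ⟨k'', hmin, hk''ω, hlen⟩ := exists_short_of_isStrongDR hk₀
    rcases divisor_dichotomy hnk hmin hk₀.2.1 hk''ω with h | h
    · have h1 : len k * len k'' ≤ X ^ (1 + thetaPar) := by
        rw [pow_add, pow_one]
        exact mul_le_mul hkX (hlen.trans (pow_le_pow_left₀ (len_nonneg k) hkX _))
          (len_nonneg k'') hX.le
      have h2 : (X ^ (1 + thetaPar))⁻¹ ≤ |kdot k' (gradient H I₀)| := by
        rw [inv_le_iff_one_le_mul₀' (by positivity)]
        exact h.trans (mul_le_mul_of_nonneg_right h1 (abs_nonneg _))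
      have h3 := hmove I₀ (μ + 2 * s) hI₀.1
        (by linarith [dist_triangle I z I₀, hz₀.2.2])
      linarith
    · have h1 := h _ (hS _ hJ.2)
      have h2 := norm_sub_le_norm_gradient_sub hU hc hH hD hHess hJ.1 hI₀.1
      have h3 : c * ρ ^ mPar - 2 * σ ≤ ‖J - I₀‖ := by
        rw [← dist_eq_norm]
        linarith [dist_triangle z J I₀, hz₀.2.1]
      have h4 : (c * ρ ^ mPar - 2 * σ) / (D * X) ≤ |kdot k' (gradient H J)| := by
        rw [div_le_iff₀ (by positivity)]
        calc c * ρ ^ mPar - 2 * σ ≤ D * (len k * |kdot k' (gradient H J)|) :=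
              h3.trans (h2.trans (by gcongr))
          _ ≤ D * (X * |kdot k' (gradient H J)|) := by gcongr
          _ = _ := by ring
      have h5 := hmove J (2 * σ + 2 * s) hJ.1 (by linarith [dist_triangle I z J])
      linarith
  rcases hz.1 with h | h
  · exact key I₁ k₁ hI₁ hk₁ h
  · exact key I₂ k₂ hI₂ hk₂ h

/-- A neighbourhood of the zone is close to the torus of the previous Diophantine frequency. -/
theorem thickening_subset_nearDioph (hU : IsOpen U) (hc : Convex ℝ U) (hH : ContDiffOn ℝ 2 H U)
    (hD : 0 < D) (hK0 : 0 < K) (hK : CkNormLE 2 H U K) (hHess : HessianBounds H U D)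
    (hI₁ : I₁ ∈ actSegment U H S)
    {σ : ℝ} (hσ : σ = c * ρ ^ ((mPar : ℝ) + (thetaPar : ℝ) / 3 + 1)) (hσ0 : 0 < σ)
    {η τ ρ' : ℝ} (hη : 0 < η) {ω' : Act} (hω' : ω' ∈ DiophU U H η τ)
    (hS : S ⊆ Metric.ball ω' (3 * ρ'))
    (h₁ : 3 * s + 2 * σ ≤ 2 * D * ρ') (h₂ : 5 * D * ρ' ≤ η / K) :
    Metric.thickening (3 * s) (zoneActions U H S c ρ μ I₁ I₂) ⊆
      nearDioph U H η τ (5 * D * ρ') := by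
  intro J hJ
  obtain ⟨I', hI', rfl⟩ := hω'.2 (Metric.mem_ball_self hη)
  obtain ⟨z, hz, hJz⟩ := Metric.mem_thickening_iff.1 hJ
  obtain ⟨P, hP, hzP⟩ := exists_near_actSegment hσ hσ0 hI₁ hz
  have h3 := norm_sub_le_norm_gradient_sub hU hc hH hD hHess hP.1 hI'
  have h4 := hS hP.2
  rw [Metric.mem_ball, dist_eq_norm] at h4
  have h5 : dist P I' ≤ 3 * D * ρ' := by
    rw [dist_eq_norm]
    nlinarith
  have h6 : dist J I' < 5 * D * ρ' := by
    linarith [dist_triangle J z I', dist_triangle z P I']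
  exact ⟨ball_subset_of_ball_subset_image hU hc hH hD hK0 hK hHess hI' hη hω'.2
    (Metric.mem_ball.2 (h6.trans_le h₂)), I', hI', hω', h6⟩

end Zone

/-! ### Sizes in powers of the order of resonance -/

section Sizes

/-- The constants that depend on the number of derivatives only. -/
def orderConst (Q : ℕ) : ℝ := 4096 + 2 ^ Q * 2 ^ 4 ^ Q + 602 * stepConst Q + sumInvSq

variable {X : ℝ} {Q r : ℕ}

theorem stepConst_nonneg (Q : ℕ) : 0 ≤ stepConst Q := by
  unfold stepConst; positivity

theorem le_of_orderConst_le (hX : orderConst Q ≤ X) : 4096 ≤ X ∧ 2 ^ Q * 2 ^ 4 ^ Q ≤ X ∧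
    602 * stepConst Q ≤ X ∧ sumInvSq ≤ X := by
  have h1 := stepConst_nonneg Q
  have h2 := sumInvSq_nonneg
  have h3 : (0 : ℝ) ≤ 2 ^ Q * 2 ^ 4 ^ Q := by positivity
  unfold orderConst at hX
  refine ⟨?_, ?_, ?_, ?_⟩ <;> linarith

/-- The size of the box of harmonics. The exponent has to be large enough for the Fourier tail to
beat `ρ ^ (q (r + 1)) ≈ X ^ (-756 (r + 1))` with about `3 r` derivatives at the cost `X ^ 3` each,
which needs `3 (400 - 3) > 756`. -/
def boxSize (X : ℝ) : ℕ := ⌈X ^ (400 : ℤ)⌉₊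

theorem le_boxSize (X : ℝ) : X ^ (400 : ℤ) ≤ boxSize X := Nat.le_ceil _

theorem boxSize_le (hX : 4096 ≤ X) : 2 * (boxSize X : ℝ) + 1 ≤ X ^ (401 : ℤ) := by
  have hX0 : 0 < X := by linarith
  have h1 : (1 : ℝ) ≤ X ^ (400 : ℤ) := one_le_zpow₀ (by linarith) (by norm_num)
  have h2 := Nat.ceil_lt_add_one (show 0 ≤ X ^ (400 : ℤ) by linarith)
  have h3 : X ^ (401 : ℤ) = X ^ (400 : ℤ) * X := zpow_add_one₀ hX0.ne' 400
  rw [h3]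
  unfold boxSize
  nlinarith

/-- Solving a homological equation costs `X ^ (3 · 401)` harmonics, divisors `X ^ (-2276)`, and one
factor `X` for the constants. -/
theorem homCost_le (hX : orderConst Q ≤ X) :
    homCost (X ^ (-2276 : ℤ)) (boxSize X) Q ≤ X ^ (3480 : ℤ) := by
  obtain ⟨h0, h1, -, -⟩ := le_of_orderConst_le hX
  have hX0 : 0 < X := by linarith
  have h2 := boxSize_le h0
  rw [homCost, ← zpow_neg]
  calc (2 * (boxSize X : ℝ) + 1) ^ 3 * (2 ^ Q * (2 ^ 4 ^ Q * X ^ (-(-2276) : ℤ)))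
      = (2 * (boxSize X : ℝ) + 1) ^ 3 * (2 ^ Q * 2 ^ 4 ^ Q) * X ^ (-(-2276) : ℤ) := by ring
    _ ≤ (X ^ (401 : ℤ)) ^ 3 * X * X ^ (-(-2276) : ℤ) := by gcongr
    _ = X ^ (3480 : ℤ) := by
        rw [← zpow_natCast, ← zpow_mul, ← zpow_add_one₀ hX0.ne', ← zpow_add₀ hX0.ne']
        norm_num

theorem tailFactor_le (hX : orderConst Q ≤ X) (e : ℕ) :
    tailFactor (X ^ (3 : ℤ)) (boxSize X) e ≤ X ^ (1210 - 397 * e : ℤ) := by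
  obtain ⟨h0, -, -, h1⟩ := le_of_orderConst_le hX
  have hX0 : 0 < X := by linarith
  have h2 := boxSize_le h0
  have h3 := le_boxSize X
  have h4 := sumInvSq_nonneg
  have h5 : 0 < X ^ (400 : ℤ) := by positivity
  rw [tailFactor]
  calc (2 * (boxSize X : ℝ) + 1) ^ 3 *
        (sumInvSq * (X ^ (3 : ℤ)) ^ (e + 2) / (boxSize X : ℝ) ^ e)
      ≤ (X ^ (401 : ℤ)) ^ 3 * (X * (X ^ (3 : ℤ)) ^ (e + 2) / (X ^ (400 : ℤ)) ^ e) := by gcongr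
    _ = X ^ (1210 - 397 * e : ℤ) := by
        rw [← zpow_natCast, ← zpow_natCast, ← zpow_natCast, ← zpow_mul, ← zpow_mul, ← zpow_mul,
          ← zpow_one_add₀ hX0.ne', ← zpow_sub₀ hX0.ne', ← zpow_add₀ hX0.ne']
        congr 1
        push_cast
        ring

variable {k : Fin 3 → ℤ} {Z : Set Act} {K : ℝ} {H : Act → ℝ} {R : Base → ℝ}

/-- The normal form, with sizes in powers of `X`: the scale of the actions is `X ^ (-2680)`, the
perturbation is of size `X ^ (-(8 r + 1000))`, and the 300 steps of the iteration gain a factor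
`X ^ (8647 - 8 r)` each. -/
theorem exists_normalForm_of_scaleData (hr : 2018 ≤ r) (hQ : Q + 3 = 3 * r)
    (hX : orderConst Q ≤ X)
    (D : ScaleData k Z (X ^ (-2680 : ℤ)) (X ^ (3 : ℤ)) (X ^ (-2276 : ℤ))
      (X ^ (-(8 * r + 1000) : ℤ)) K (boxSize X) Q H R) :
    ∃ (Φ : Base → Base) (e : Base → ℝ) (ζ : ℝ → Act → ℝ) (Rk : Base → ℝ),
      IsSymplecticChange (Metric.thickening (X ^ (-2680 : ℤ)) Z) Φ e ∧
      (∀ x : Base, x.2 ∈ Metric.thickening (X ^ (-2680 : ℤ)) Z →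
        (Φ x).2 ∈ Metric.thickening (2 * X ^ (-2680 : ℤ)) Z) ∧
      univ ×ˢ Z ⊆ Φ '' (univ ×ˢ Metric.thickening (X ^ (-2680 : ℤ)) Z) ∧
      (∀ x : Base, x.2 ∈ Metric.thickening (X ^ (-2680 : ℤ)) Z →
        H (Φ x).2 + R (Φ x) + e x = H x.2 + ζ (slow k x.1) x.2 + Rk x) ∧
      (∀ (t : ℝ) (J : Act), J ∈ Metric.thickening (X ^ (-2680 : ℤ)) Z →
        ζ (t + (Finset.univ.gcd k : ℤ)) J = ζ t J) ∧
      AngPeriodic (Metric.thickening (X ^ (-2680 : ℤ)) Z) Rk ∧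
      ContDiffOn ℝ 2 (fun y : ℝ × Act => ζ y.1 y.2)
        (univ ×ˢ Metric.thickening (X ^ (-2680 : ℤ)) Z) ∧
      ContDiffOn ℝ 2 Rk (univ ×ˢ Metric.thickening (X ^ (-2680 : ℤ)) Z) ∧
      CkNormLE 2 (onSlow k ζ) (univ ×ˢ Metric.thickening (X ^ (-2680 : ℤ)) Z)
        (X ^ (7847 - 8 * r : ℤ)) ∧
      CkNormLE 2 Rk (univ ×ˢ Metric.thickening (X ^ (-2680 : ℤ)) Z)
        (X ^ (-(756 * (r + 1)) : ℤ)) ∧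
      CkNormLE 1 (displacement Φ e) (univ ×ˢ Metric.thickening (X ^ (-2680 : ℤ)) Z)
        (X ^ (7848 - 8 * r : ℤ)) := by
  obtain ⟨h0, -, hstep, -⟩ := le_of_orderConst_le hX
  have hX0 : 0 < X := by linarith
  have hX1 : 1 ≤ X := by linarith
  have hc1 := homCost_le hX
  have htail := tailFactor_le hX
  -- the powers of `X` are used only through the following rules, which keeps the large exponents
  -- opaque
  obtain ⟨P, hP⟩ : ∃ P : ℤ → ℝ, ∀ i, X ^ i = P i := ⟨fun i => X ^ i, fun _ => rfl⟩
  have hmono : ∀ {i j : ℤ}, i ≤ j → P i ≤ P j := fun h => by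
    rw [← hP, ← hP]; exact zpow_le_zpow_right₀ hX1 h
  have hadd : ∀ i j : ℤ, P i * P j = P (i + j) := fun i j => by
    rw [← hP, ← hP, ← hP, zpow_add₀ hX0.ne']
  have hone : ∀ i : ℤ, X * P i = P (i + 1) := fun i => by
    rw [← hP, ← hP, zpow_add_one₀ hX0.ne', mul_comm]
  have hpow : ∀ (i : ℤ) (n : ℕ), P i ^ n = P (i * n) := fun i n => by
    rw [← hP, ← hP, ← zpow_natCast, ← zpow_mul]
  have hdiv : ∀ i j : ℤ, P i / P j = P (i - j) := fun i j => by
    rw [← hP, ← hP, ← hP, zpow_sub₀ hX0.ne']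
  have hpos : ∀ i : ℤ, 0 < P i := fun i => by rw [← hP]; exact zpow_pos hX0 i
  have hzero : P 0 = 1 := by rw [← hP, zpow_zero]
  have hneg : P (-1) ≤ 1 / 4096 := by
    rw [← hP, zpow_neg_one, one_div]
    gcongr
  simp only [hP] at D hc1 htail ⊢
  set A : ℝ := P (-(8 * r + 1000) : ℤ) with hA
  set c := homCost (P (-2276)) (boxSize X) Q with hc
  have hcle : c ≤ P (3480 : ℤ) := hc1
  have hc0 : 0 ≤ c := zero_le_one.trans (one_le_homCost D.pos D.le_one _ _)
  -- the derivatives left for the decay of the Fourier tail after 300 steps: `e + 4 + 300 = Q`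
  obtain ⟨e, he⟩ : ∃ e, e + 307 = 3 * r := ⟨3 * r - 307, by omega⟩
  set κ : ℝ := ((300 : ℕ) + 1) * 2 * stepConst Q * P (3 : ℤ) ^ 2 * c ^ 2 *
    (A / P (-2680 : ℤ)) with hκ
  have hst0 := stepConst_nonneg Q
  have hκle : κ ≤ P (8647 - 8 * r : ℤ) := by
    calc κ = 602 * stepConst Q * P (3 : ℤ) ^ 2 * c ^ 2 * (A / P (-2680 : ℤ)) := by
          rw [hκ]; norm_num
      _ ≤ X * P (3 : ℤ) ^ 2 * P (3480 : ℤ) ^ 2 * (A / P (-2680 : ℤ)) := by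
          have := (hpos (-2680)).le
          have := (hpos (-(8 * r + 1000))).le
          gcongr
      _ = P (8647 - 8 * r : ℤ) := by
          simp only [hA, hpow, hdiv, hone, hadd]
          exact congrArg P (by push_cast; ring)
  have hκ0 : 0 ≤ κ := by
    have := (hpos (-2680)).le
    have := (hpos (-(8 * r + 1000))).le
    rw [hκ]; positivity
  have hκ1 : κ ≤ 1 := by
    refine hκle.trans ?_
    rw [← hzero]
    exact hmono (by omega)
  obtain ⟨χ, z, err, hχp, hzs, hχ, hz, herr, heq⟩ :=
    D.exists_hamiltonJacobi (n := 300) (e := e) hκ hκ1 (by omega)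
  -- in the original actions a derivative costs `Λ / s = X ^ 3 / X ^ (-2680)`
  have hrate1 : 1 ≤ P 2683 := by
    rw [← hzero]
    exact hmono (by norm_num)
  set a : ℝ := (300 : ℕ) * (c * A) with ha
  have hale : a ≤ P (2481 - 8 * r : ℤ) := by
    calc a ≤ X * (P (3480 : ℤ) * A) := by
          have := (hpos (-(8 * r + 1000))).le
          rw [ha]; push_cast
          gcongr
          linarith only [h0]
      _ = _ := by
          simp only [hA, hadd, hone]
          exact congrArg P (by ring)
  have hrate : P (3 : ℤ) / P (-2680 : ℤ) = P (2683 : ℤ) := by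
    rw [hdiv]; norm_num
  rw [hrate] at hχ hz herr
  set b : ℝ := A * κ ^ 300 + (300 : ℕ) * (tailFactor (P (3 : ℤ)) (boxSize X) e * A) with hb
  have htf0 := tailFactor_nonneg (hpos 3).le (boxSize X) e
  have hb0 : 0 ≤ b := by
    have := (hpos (-(8 * r + 1000))).le
    rw [hb]; positivity
  have hble : 4096 * b * P (2683 : ℤ) ^ 2 ≤ P (-(756 * (r + 1)) : ℤ) := by
    have h1 : A * κ ^ 300 ≤ P (-756 * r - 6124 : ℤ) := by
      calc A * κ ^ 300 ≤ A * P (8647 - 8 * r : ℤ) ^ 300 := by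
            have := (hpos (-(8 * r + 1000))).le
            gcongr
        _ = P (-(8 * r + 1000) + (8647 - 8 * r) * (300 : ℕ) : ℤ) := by simp only [hA, hpow, hadd]
        _ ≤ _ := hmono (by push_cast; omega)
    have h2 : (300 : ℕ) * (tailFactor (P (3 : ℤ)) (boxSize X) e * A) ≤
        P (-756 * r - 6124 : ℤ) := by
      calc _ ≤ X * (P (1210 - 397 * e : ℤ) * A) := by
            have := (hpos (-(8 * r + 1000))).le
            have := htail e
            push_cast
            gcongr
            linarith only [h0]
        _ = P (1210 - 397 * e + -(8 * r + 1000) + 1 : ℤ) := by simp only [hA, hadd, hone]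
        _ ≤ _ := hmono (by omega)
    have h3 : b ≤ P (-756 * r - 6123 : ℤ) := by
      have h4 := hone (-756 * r - 6124 : ℤ)
      have h5 : (-756 * r - 6124 + 1 : ℤ) = -756 * r - 6123 := by ring
      rw [h5] at h4
      rw [← h4]
      refine (add_le_add h1 h2).trans ?_
      rw [← two_mul]
      exact mul_le_mul_of_nonneg_right (by linarith only [h0]) (hpos _).le
    calc 4096 * b * P (2683 : ℤ) ^ 2
        ≤ X * P (-756 * r - 6123 : ℤ) * P (2683 : ℤ) ^ 2 := by gcongr
      _ = _ := by
          simp only [hone, hpow, hadd]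
          exact congrArg P (by push_cast; ring)
  have h₂ : a * P (2683 : ℤ) ^ 2 ≤ P (7847 - 8 * r : ℤ) := by
    calc _ ≤ P (2481 - 8 * r : ℤ) * P (2683 : ℤ) ^ 2 := by gcongr
      _ = _ := by
          simp only [hpow, hadd]
          exact congrArg P (by push_cast; ring)
  have h₃ : a * P (2683 : ℤ) ^ 3 ≤ 1 := by
    calc _ ≤ P (2481 - 8 * r : ℤ) * P (2683 : ℤ) ^ 3 := by gcongr
      _ = P (2481 - 8 * r + 2683 * (3 : ℕ) : ℤ) := by simp only [hpow, hadd]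
      _ ≤ P (0 : ℤ) := hmono (by push_cast; omega)
      _ = 1 := hzero
  have h8 : 8 * P (7847 - 8 * r : ℤ) ≤ P (7848 - 8 * r : ℤ) := by
    have h4 := hone (7847 - 8 * r : ℤ)
    have h5 : (7847 - 8 * r + 1 : ℤ) = 7848 - 8 * r := by ring
    rw [h5] at h4
    rw [← h4]
    exact mul_le_mul_of_nonneg_right (by linarith only [h0]) (hpos _).le
  have h16 : P (7847 - 8 * r : ℤ) ≤ 1 / 16 := by
    have h1 : P (7848 - 8 * r : ℤ) ≤ P (-1 : ℤ) := hmono (by omega)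
    linarith only [h1, hneg, h8, hpos (7847 - 8 * r : ℤ)]
  have h8s : 8 * P (7847 - 8 * r : ℤ) ≤ P (-2680 : ℤ) := h8.trans (hmono (by omega))
  obtain ⟨Φ, en, ζ, Rk, g1, g2, g3, g4, g5, g6, g7, g8, g9, g10, g11⟩ :=
    exists_normalForm_of_hamiltonJacobi (hpos (-2680)) hrate1 hb0
      (fun φ I l hI => D.periodic φ I l
        (Metric.thickening_mono (by linarith only [hpos (-2680)]) Z hI))
      hχp (hzs.mono_order (by omega)) (hχ.mono_order (by omega)) (hz.mono_order (by omega))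
      herr heq h₂ h₃ h16 h8s
  exact ⟨Φ, en, ζ, Rk, g1, g2, g3, g4, g5, g6, g7, g8,
    fun i hi x hx => (g9 i hi x hx).trans h₂, fun i hi x hx => (g10 i hi x hx).trans hble,
    fun i hi x hx => (g11 i hi x hx).trans h8⟩

end Sizes

/-! ### The orders of resonance and the sizes of the zone -/

section Orders

variable {τ R₀ X : ℝ}

theorem le_Rgen (hτ : 0 ≤ τ) (hR₀ : 1 ≤ R₀) (n : ℕ) : R₀ ≤ Rgen τ R₀ n := by
  induction n with
  | zero => exact le_rfl
  | succ n ih =>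
    refine ih.trans ?_
    rw [Rgen]
    exact Real.self_le_rpow_of_one_le (hR₀.trans ih) (by linarith)

/-- The previous `ρ` in terms of the present order of resonance: since `R_{n+1} = R_n ^ (1 + 2τ)`,
it is nearly `R_{n+1} ^ (-3)`. -/
theorem rho_eq_rpow_Rgen_succ (hτ : 0 ≤ τ) (hR₀ : 1 ≤ R₀) (n : ℕ) :
    rho τ R₀ n = Rgen τ R₀ (n + 1) ^ (-((3 - 5 * τ) / (1 + 2 * τ))) := by
  have h1 : 0 ≤ Rgen τ R₀ n := by linarith [le_Rgen hτ hR₀ n]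
  rw [rho, Rgen, ← Real.rpow_mul h1]
  congr 1
  field_simp

theorem rpow_rpow_le_zpow (hX : 1 ≤ X) {a y : ℝ} {z : ℤ} (h : a * y ≤ z) :
    (X ^ a) ^ y ≤ X ^ z := by
  rw [← Real.rpow_mul (by linarith), ← Real.rpow_intCast]
  exact Real.rpow_le_rpow_of_exponent_le hX h

theorem zpow_le_rpow_rpow (hX : 1 ≤ X) {a y : ℝ} {z : ℤ} (h : z ≤ a * y) :
    X ^ z ≤ (X ^ a) ^ y := by
  rw [← Real.rpow_mul (by linarith), ← Real.rpow_intCast]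
  exact Real.rpow_le_rpow_of_exponent_le hX h

end Orders

section Parameters

variable {U : Set Act} {r Q n : ℕ} {η τ ε D K lam₀ c B R₀ ρ μ X : ℝ} {H : Act → ℝ} {R : Base → ℝ}
  {k k₁ k₂ : Fin 3 → ℤ} {ω ω' : Act} {S : Set Act} {I₁ I₂ : Act}

/-- The lower bound for the orders of resonance. Each summand is a constant that is absorbed by one
factor `X`; the sum is used instead of a maximum for convenience. -/
def orderBound (Q : ℕ) (η D K lam₀ c B : ℝ) : ℝ :=
  orderConst Q + 4 * K + c + 4 * D / c + B + K * (5 * D) ^ (Q + 3) + 5 * D / lam₀ + 5 * D * K / η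

theorem le_of_orderBound_le (hη : 0 < η) (hD : 0 < D) (hK : 0 < K) (hlam : 0 < lam₀) (hc : 0 < c)
    (hB : 0 < B) (hX : orderBound Q η D K lam₀ c B ≤ X) :
    orderConst Q ≤ X ∧ 4 * K ≤ X ∧ c ≤ X ∧ 4 * D / c ≤ X ∧ B ≤ X ∧ K * (5 * D) ^ (Q + 3) ≤ X ∧
      5 * D / lam₀ ≤ X ∧ 5 * D * K / η ≤ X := by
  have h0 : 0 ≤ orderConst Q := by
    have := stepConst_nonneg Q
    have := sumInvSq_nonneg
    unfold orderConst; positivity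
  have h1 : 0 < 4 * D / c := by positivity
  have h2 : 0 < K * (5 * D) ^ (Q + 3) := by positivity
  have h3 : 0 < 5 * D / lam₀ := by positivity
  have h4 : 0 < 5 * D * K / η := by positivity
  unfold orderBound at hX
  refine ⟨?_, ?_, ?_, ?_, ?_, ?_, ?_, ?_⟩ <;> linarith

/-- The order of smoothness `⌊3 r - 2 τ⌋` is `3 r - 1`. -/
theorem floor_order (hτ : 0 < τ) (hτ1 : τ < 1 / 1000000) (hr : 2018 ≤ r) (hQ : Q + 3 = 3 * r) :
    ⌊3 * (r : ℝ) - 2 * τ⌋₊ = Q + 2 := by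
  have h1 : (Q : ℝ) + 3 = 3 * r := by exact_mod_cast hQ
  have h2 : (2018 : ℝ) ≤ r := by exact_mod_cast hr
  rw [Nat.floor_eq_iff (by linarith)]
  push_cast
  constructor <;> linarith

/-- The perturbation is small near the previous Diophantine frequency. -/
theorem IsPoschelNormalForm.dBd_perturbation (hN : IsPoschelNormalForm U r η τ ε D K lam₀ H R)
    (hτ : 0 < τ) (hτ1 : τ < 1 / 1000000) (hr : 2018 ≤ r) (hQ : Q + 3 = 3 * r) (hD : 1 ≤ D)
    (hK : 0 < K) (hX1 : 1 ≤ X) (hKX : K * (5 * D) ^ (Q + 3) ≤ X) {ρ' : ℝ}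
    (hρ' : ρ' = X ^ (-((3 - 5 * τ) / (1 + 2 * τ)))) (hlam : 5 * D * ρ' ≤ lam₀)
    {T : Set Act} (hT : T ⊆ nearDioph U H η τ (5 * D * ρ')) :
    DBd (univ ×ˢ T) (X ^ (3 : ℤ)) (Q + 1) (X ^ (-(8 * r + 1000) : ℤ)) R := by
  have hX0 : 0 < X := by linarith
  have hr' : (2018 : ℝ) ≤ r := by exact_mod_cast hr
  have hQ' : (Q : ℝ) + 3 = 3 * r := by exact_mod_cast hQ
  have hρ0 : 0 < ρ' := hρ' ▸ Real.rpow_pos_of_pos hX0 _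
  set a := (3 - 5 * τ) / (1 + 2 * τ) with ha
  have ha3 : a ≤ 3 := by rw [ha, div_le_iff₀ (by linarith)]; linarith
  have ha2 : 2.99 ≤ a := by rw [ha, le_div_iff₀ (by linarith)]; linarith
  set lam := 5 * D * ρ' with hlamdef
  have hlam0 : 0 < lam := by positivity
  have hinv : lam⁻¹ ≤ X ^ (3 : ℤ) := by
    have h1 : X ^ (-3 : ℤ) ≤ lam := by
      have h2 : X ^ (-3 : ℤ) ≤ ρ' := by
        rw [hρ', ← Real.rpow_intCast]
        exact Real.rpow_le_rpow_of_exponent_le hX1 (by push_cast; linarith)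
      refine h2.trans (le_mul_of_one_le_left hρ0.le (by linarith))
    rw [zpow_neg] at h1
    exact inv_le_of_inv_le₀ (by positivity) h1
  have hmain : K * lam ^ (3 * (r : ℝ) - 2 * τ) ≤ X ^ (-(8 * r + 1000) : ℤ) := by
    have h1 : ρ' ^ (3 * (r : ℝ) - 2 * τ) ≤ X ^ (-(8 * r + 1000) - 1 : ℤ) := by
      rw [hρ']
      refine rpow_rpow_le_zpow hX1 ?_
      push_cast
      nlinarith
    have h2 : (5 * D) ^ (3 * (r : ℝ) - 2 * τ) ≤ (5 * D) ^ (Q + 3) := by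
      rw [← Real.rpow_natCast]
      refine Real.rpow_le_rpow_of_exponent_le (by linarith) ?_
      push_cast
      linarith
    rw [hlamdef, Real.mul_rpow (by linarith) hρ0.le]
    calc K * ((5 * D) ^ (3 * (r : ℝ) - 2 * τ) * ρ' ^ (3 * (r : ℝ) - 2 * τ))
        ≤ K * ((5 * D) ^ (Q + 3) * X ^ (-(8 * r + 1000) - 1 : ℤ)) := by gcongr
      _ = (K * (5 * D) ^ (Q + 3)) * X ^ (-(8 * r + 1000) - 1 : ℤ) := by ring
      _ ≤ X * X ^ (-(8 * r + 1000) - 1 : ℤ) := by gcongr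
      _ = _ := by rw [mul_comm, ← zpow_add_one₀ hX0.ne']; simp
  have hsm : ContDiffOn ℝ (Q + 1 : ℕ) R (univ ×ˢ U) := by
    have := hN.smooth_R
    rw [floor_order hτ hτ1 hr hQ] at this
    exact this.of_le (by norm_cast; omega)
  refine ⟨hsm.mono (prod_mono subset_rfl fun J hJ => (hT hJ).1), fun i hi x hx => ?_⟩
  have h1 := hN.bound_R lam hlam0 hlam i (by rw [floor_order hτ hτ1 hr hQ]; omega) i le_rfl x
    ⟨mem_univ _, hT hx.2⟩
  refine h1.trans ?_
  have h2 : (0 : ℝ) ≤ lam ^ (3 * (r : ℝ) - 2 * τ) := by positivity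
  rw [Real.rpow_sub_natCast hlam0.ne', div_eq_mul_inv, ← inv_pow, ← mul_assoc]
  have h3 : K * ε * lam ^ (3 * (r : ℝ) - 2 * τ) ≤ X ^ (-(8 * r + 1000) : ℤ) := by
    refine le_trans ?_ hmain
    have := hN.eps_le
    have := hN.eps_pos
    calc K * ε * lam ^ (3 * (r : ℝ) - 2 * τ) ≤ K * 1 * lam ^ (3 * (r : ℝ) - 2 * τ) := by gcongr
      _ = _ := by ring
  have h4 : (lam⁻¹) ^ i ≤ (X ^ (3 : ℤ)) ^ i := pow_le_pow_left₀ (by positivity) hinv i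
  exact mul_le_mul h3 h4 (by positivity) (by positivity)

/-- The assumptions of the theorem provide the data of the normal form at the scale
`X ^ (-2680)` of the actions, where `X` is the order of resonance of the present generation. -/
theorem IsPoschelNormalForm.scaleData (hN : IsPoschelNormalForm U r η τ ε D K lam₀ H R)
    (hτ : 0 < τ) (hτ1 : τ < 1 / 1000000) (hr : 2018 ≤ r) (hQ : Q + 3 = 3 * r)
    (hη : 0 < η) (hD : 1 ≤ D) (hK : 0 < K) (hlam : 0 < lam₀) (hc : 0 < c) (hB : 1 ≤ B)
    (hR₀ : 1 ≤ R₀) (hXdef : X = Rgen τ R₀ n) (hX : orderBound Q η D K lam₀ c B ≤ X)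
    (hseg : IsDirichletSegment U H η τ R₀ n k ω ω' S)
    (hDR : AreConsecutiveStrongDR U H S k k₁ k₂ I₁ I₂) (hρ : ρ = X ^ (-(3 - 5 * τ)))
    (hμ : μ ≤ B * ρ ^ ((2 * (thetaPar : ℝ) - 1) * ((1 + 2 * τ) / (3 - 5 * τ)))) :
    ScaleData k (zoneActions U H S c ρ μ I₁ I₂) (X ^ (-2680 : ℤ)) (X ^ (3 : ℤ)) (X ^ (-2276 : ℤ))
      (X ^ (-(8 * r + 1000) : ℤ)) K (boxSize X) Q H R ∧
    Metric.thickening (2 * X ^ (-2680 : ℤ)) (zoneActions U H S c ρ μ I₁ I₂) ⊆ U := by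
  have hD0 : 0 < D := by linarith
  obtain ⟨x1, x2, x3, x4, x5, x6, x7, x8⟩ :=
    le_of_orderBound_le hη hD0 hK hlam hc (by linarith) hX
  have hX4 : 4096 ≤ X := (le_of_orderConst_le x1).1
  have hX0 : 0 < X := by linarith
  have hX1 : 1 ≤ X := by linarith
  obtain ⟨hI₁, hI₂, -, hk₁, hk₂, -⟩ := hDR
  have hfl := floor_order hτ hτ1 hr hQ
  have hHs : ContDiffOn ℝ (Q + 2 : ℕ) H U := by
    have := hN.smooth_H
    rwa [hfl] at this
  have hHb : CkNormLE (Q + 2) H U K := by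
    have := hN.bound_H
    rwa [hfl] at this
  have hH2 : ContDiffOn ℝ 2 H U := hHs.of_le (by norm_cast; omega)
  have hHb2 : CkNormLE 2 H U K := fun i hi => hHb i (by omega)
  set Z := zoneActions U H S c ρ μ I₁ I₂ with hZ
  -- sizes, in powers of `X`
  obtain ⟨n', hn'⟩ : ∃ n', n = n' + 1 := ⟨n - 1, by have := hseg.one_le; omega⟩
  have hρ' : rho τ R₀ (n - 1) = X ^ (-((3 - 5 * τ) / (1 + 2 * τ))) := by
    rw [hXdef, hn', Nat.add_sub_cancel]
    exact rho_eq_rpow_Rgen_succ hτ.le hR₀ n'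
  set ρ' := rho τ R₀ (n - 1) with hρ'def
  have hρ'0 : 0 < ρ' := hρ' ▸ Real.rpow_pos_of_pos hX0 _
  have hρ'3 : X ^ (-3 : ℤ) ≤ ρ' := by
    rw [hρ', ← Real.rpow_intCast]
    refine Real.rpow_le_rpow_of_exponent_le hX1 ?_
    have : (3 - 5 * τ) / (1 + 2 * τ) ≤ 3 := by rw [div_le_iff₀ (by linarith)]; linarith
    push_cast
    linarith
  have hρ'1 : ρ' ≤ X⁻¹ := by
    rw [hρ', ← Real.rpow_neg_one]
    refine Real.rpow_le_rpow_of_exponent_le hX1 ?_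
    have : 1 ≤ (3 - 5 * τ) / (1 + 2 * τ) := by rw [le_div_iff₀ (by linarith)]; linarith
    linarith
  have hle_of : ∀ y t : ℝ, 0 < t → y / t ≤ X → y * ρ' ≤ t := by
    intro y t ht hy
    rw [div_le_iff₀ ht] at hy
    calc y * ρ' ≤ (X * t) * X⁻¹ := by gcongr
      _ = t := by field_simp
  have hlam' : 5 * D * ρ' ≤ lam₀ := hle_of _ _ hlam x7
  have hηK : 5 * D * ρ' ≤ η / K := by
    rw [le_div_iff₀ hK]
    calc 5 * D * ρ' * K = 5 * D * K * ρ' := by ring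
      _ ≤ η := hle_of _ _ hη x8
  set σ := c * ρ ^ ((mPar : ℝ) + (thetaPar : ℝ) / 3 + 1) with hσ
  have hρ0 : 0 < ρ := hρ ▸ Real.rpow_pos_of_pos hX0 _
  have hσ0 : 0 < σ := by positivity
  -- the powers of `X` are used only through the following rules
  obtain ⟨P, hP⟩ : ∃ P : ℤ → ℝ, ∀ i, X ^ i = P i := ⟨fun i => X ^ i, fun _ => rfl⟩
  have hmono : ∀ {i j : ℤ}, i ≤ j → P i ≤ P j := fun h => by
    rw [← hP, ← hP]; exact zpow_le_zpow_right₀ hX1 h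
  have hadd : ∀ i j : ℤ, P i * P j = P (i + j) := fun i j => by
    rw [← hP, ← hP, ← hP, zpow_add₀ hX0.ne']
  have hone : ∀ i : ℤ, X * P i = P (i + 1) := fun i => by
    rw [← hP, ← hP, zpow_add_one₀ hX0.ne', mul_comm]
  have hpos : ∀ i : ℤ, 0 < P i := fun i => by rw [← hP]; exact zpow_pos hX0 i
  have hzero : P 0 = 1 := by rw [← hP, zpow_zero]
  have htwo : ∀ i : ℤ, 4 * P i ≤ P (i + 1) := fun i => by
    rw [← hone]
    exact mul_le_mul_of_nonneg_right (by linarith only [hX4]) (hpos i).le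
  have hM : 2 * (boxSize X : ℝ) ≤ P 401 := by
    rw [← hP]
    linarith only [boxSize_le hX4]
  -- with `m = 758` and `θ = 757`: the width of the zone is nearly `X ^ (-3 (758 + 757 / 3 + 1))`,
  -- the outer radius `X ^ (-(2 * 757 - 1))` and the inner radius `X ^ (-3 * 758)`
  have hσle : σ ≤ P (-3032) := by
    have h1 : ρ ^ ((mPar : ℝ) + (thetaPar : ℝ) / 3 + 1) ≤ P (-3033) := by
      rw [hρ, ← hP]
      refine rpow_rpow_le_zpow hX1 ?_
      norm_num [mPar, thetaPar, qPar]
      linarith only [hτ1]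
    calc σ ≤ X * P (-3033) := by
          have := (hpos (-3033)).le
          rw [hσ]; gcongr
      _ = P (-3032) := hone _
  have hμle : μ ≤ P (-1512) := by
    have h1 : ρ ^ ((2 * (thetaPar : ℝ) - 1) * ((1 + 2 * τ) / (3 - 5 * τ))) ≤ P (-1513) := by
      rw [hρ, ← hP]
      refine rpow_rpow_le_zpow hX1 ?_
      have h2 : 3 - 5 * τ ≠ 0 := by linarith
      have h3 : -(3 - 5 * τ) * ((2 * (thetaPar : ℝ) - 1) * ((1 + 2 * τ) / (3 - 5 * τ)))
          = -((2 * (thetaPar : ℝ) - 1) * (1 + 2 * τ)) := by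
        field_simp
      rw [h3]
      norm_num [thetaPar, qPar]
      linarith only [hτ]
    calc μ ≤ X * P (-1513) := by
          have := (hpos (-1513)).le
          refine hμ.trans ?_
          gcongr
      _ = P (-1512) := hone _
  have hρm : P (-2274) ≤ ρ ^ mPar := by
    rw [← Real.rpow_natCast, hρ, ← hP]
    refine zpow_le_rpow_rpow hX1 ?_
    norm_num [mPar, thetaPar, qPar]
    linarith only [hτ]
  have hrho3 : P (-3) ≤ ρ' := by rw [← hP]; exact hρ'3
  simp only [hP]
  set s := P (-2680) with hs
  have hs0 : 0 < s := hpos _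
  have hσs : σ ≤ s := hσle.trans (hmono (by norm_num))
  have hsmall : 3 * s + 2 * σ ≤ 2 * D * ρ' := by
    have h1 : s ≤ P (-5) := hmono (by norm_num)
    have h2 := htwo (-5)
    have h3 := htwo (-4)
    norm_num at h2 h3
    nlinarith only [h1, h2, h3, hrho3, hσs, hD, hρ'0, hs0]
  have hnear := thickening_subset_nearDioph (μ := μ) (I₂ := I₂) hN.isOpen hN.convex hH2 hD0 hK hHb2
    hN.hessian_H hI₁ hσ hσ0 hη hseg.mem' hseg.subset_ball hsmall hηK
  have hU3 : Metric.thickening (3 * s) Z ⊆ U := fun J hJ => (hnear hJ).1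
  have hU2 : Metric.thickening (2 * s) Z ⊆ U :=
    (Metric.thickening_mono (by linarith only [hs0]) Z).trans hU3
  refine ⟨⟨?_, ?_, hs0, ?_, hpos _, ?_, ?_, (hpos _).le, hK.le, ?_, ?_, ?_, ?_, ?_, ?_⟩, hU2⟩
  · intro h0
    rw [Finset.gcd_eq_zero_iff] at h0
    rcases hseg.isResVec with h | h
    · exact h (h0 0 (Finset.mem_univ _))
    · exact h (h0 1 (Finset.mem_univ _))
  · rw [← hzero]; exact hmono (by norm_num)
  · rw [← hzero]; exact hmono (by norm_num)
  · rw [← hzero]; exact hmono (by norm_num)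
  · have h1 := le_boxSize X
    have h2 : (1 : ℝ) ≤ X ^ (400 : ℤ) := one_le_zpow₀ hX1 (by norm_num)
    exact_mod_cast h2.trans h1
  · exact ⟨hHs.mono hU3, fun i hi x hx => by simpa using hHb i hi x (hU3 hx)⟩
  · have h1 := hN.dBd_perturbation hτ hτ1 hr hQ hD hK hX1 x6 hρ' hlam' hnear
    simpa only [hP] using h1
  · exact fun φ I l hI => hN.periodic_R φ I l (hU3 hI)
  · -- the bound of the divisors: the size of the zone is far below the determinant bound, and the
    -- core of the double resonance is far larger than the errors
    have hMK : ∀ d : ℝ, 0 ≤ d → 2 * (boxSize X : ℝ) * (K * (4 * d)) ≤ P 402 * d := by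
      intro d hd
      calc 2 * (boxSize X : ℝ) * (K * (4 * d)) = (2 * (boxSize X : ℝ)) * (4 * K) * d := by ring
        _ ≤ P 401 * X * d := by gcongr; exact (hpos 401).le
        _ = P 402 * d := by rw [mul_comm (P 401), hone]; norm_num
    intro k' hk' hnk I hI
    refine le_divisor_of_mem_thickening hN.isOpen hN.convex hH2 hD0 hK hHb2 hN.hessian_H
      hseg.resonant hI₁ hI₂ hk₁ hk₂ hσ hσ0 hU2 hX0 (hXdef ▸ hseg.len_le) ?_ ?_ hk' hnk hI
    · have h1 : s ≤ P (-1512) := hmono (by norm_num)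
      have h2 : 2 * (boxSize X : ℝ) * (K * (μ + 2 * s)) ≤ P 402 * P (-1512) := by
        refine le_trans ?_ (hMK _ (hpos _).le)
        have h3 := hpos (-1512)
        have h4 : μ + 2 * s ≤ 4 * P (-1512) := by linarith only [h1, h3, hμle]
        gcongr
      have h5 : (X ^ (1 + thetaPar))⁻¹ = P (-758) := by
        rw [← hP, zpow_neg]
        norm_num [thetaPar, qPar]
      rw [hadd] at h2
      have h6 : P (-2276) ≤ P (-1110) := hmono (by norm_num)
      have h7 := htwo (-1110)
      have h8 : P (-1110 + 1) ≤ P (-758) := hmono (by norm_num)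
      have h9 := hpos (-1110)
      norm_num at h2
      rw [h5]
      linarith only [h2, h6, h7, h8, h9]
    · have h2 : 2 * (boxSize X : ℝ) * (K * (2 * σ + 2 * s)) ≤ P 402 * s := by
        refine le_trans ?_ (hMK _ hs0.le)
        have h4 : 2 * σ + 2 * s ≤ 4 * s := by linarith only [hσs]
        gcongr
      rw [hs, hadd] at h2
      have h6 : P (402 + -2680) ≤ P (-2276) := hmono (by norm_num)
      rw [← hs] at h2
      rw [le_div_iff₀ (by positivity)]
      have h10 : 4 * D ≤ X * c := by rwa [div_le_iff₀ hc] at x4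
      have h11 : D * (X * P (-2276)) ≤ c * ρ ^ mPar / 4 := by
        have e1 : X * P (-2276) = P (-2275) := hone _
        have e2 : X * P (-2275) = P (-2274) := hone _
        rw [e1]
        have h12 := hpos (-2275)
        calc D * P (-2275) = 4 * D * P (-2275) / 4 := by ring
          _ ≤ X * c * P (-2275) / 4 := by gcongr
          _ = c * P (-2274) / 4 := by rw [← e2]; ring
          _ ≤ c * ρ ^ mPar / 4 := by gcongr
      have h13 : 2 * σ ≤ D * (X * P (-2276)) := by
        have h14 : σ ≤ P (-2276) := hσle.trans (hmono (by norm_num))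
        have h15 := hpos (-2276)
        have h16 : P (-2276) * 2 ≤ X * P (-2276) := by
          rw [mul_comm]; gcongr; linarith only [hX4]
        have h17 : 0 < X * P (-2276) := by positivity
        nlinarith only [h14, h16, h17, hD]
      have h18 : (P (-2276) + 2 * (boxSize X : ℝ) * (K * (2 * σ + 2 * s))) * (D * X) ≤
          2 * P (-2276) * (D * X) := by
        gcongr
        linarith only [h2, h6]
      have h19 : 0 < D * (X * P (-2276)) := by have := hpos (-2276); positivity
      nlinarith only [h11, h13, h18, h19]
  · have h1 : K ≤ X := by linarith only [x2, hK]
    calc s * K ≤ s * X := by gcongr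
      _ = P (-2679) := by rw [mul_comm, hs, hone]; norm_num
      _ ≤ 1 := by rw [← hzero]; exact hmono (by norm_num)
  · have h1 : K ≤ X := by linarith only [x2, hK]
    calc 2 * (boxSize X : ℝ) * (s * K) ≤ P 401 * (s * X) := by
          have := (hpos 401).le
          gcongr
      _ = P (-2278) := by rw [mul_comm s, hs, hone, hadd]; norm_num
      _ ≤ P (-2276) * P 3 := by rw [hadd]; exact hmono (by norm_num)

end Parameters

end SRNF

end

theorem mainTheorem7 :
    ∃ τ₀ : ℝ, 0 < τ₀ ∧ ∀ (τ : ℝ), 0 < τ → τ < τ₀ →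
    ∀ (r : ℕ), SRNF.mPar + 5 * SRNF.qPar ≤ r →
    ∀ (η D₀ K lam₀ c B : ℝ), 0 < η → 1 ≤ D₀ → 0 < K → 0 < lam₀ → 0 < c → 1 ≤ B →
    ∃ C D R_star : ℝ, 1 ≤ C ∧ 1 ≤ D ∧ 1 < R_star ∧
    ∀ (U : Set SRNF.Act) (ε : ℝ) (H : SRNF.Act → ℝ) (R : SRNF.Base → ℝ),
      SRNF.IsPoschelNormalForm U r η τ ε D₀ K lam₀ H R →
    ∀ (R₀ : ℝ), R_star ≤ R₀ →
    ∀ (n : ℕ) (k k₁ k₂ : Fin 3 → ℤ) (ω ω' : SRNF.Act) (S : Set SRNF.Act) (I₁ I₂ : SRNF.Act)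
      (ρ μ : ℝ),
      SRNF.IsDirichletSegment U H η τ R₀ n k ω ω' S →
      SRNF.AreConsecutiveStrongDR U H S k k₁ k₂ I₁ I₂ →
      ρ = SRNF.rho τ R₀ n →
      B⁻¹ * ρ ^ ((2 * (SRNF.thetaPar : ℝ) - 1) * ((1 + 2 * τ) / (3 - 5 * τ))) ≤ μ →
      μ ≤ B * ρ ^ ((2 * (SRNF.thetaPar : ℝ) - 1) * ((1 + 2 * τ) / (3 - 5 * τ))) →
    ∃ (W : Set SRNF.Act) (Φ : SRNF.Base → SRNF.Base) (e : SRNF.Base → ℝ)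
      (Hk : SRNF.Act → ℝ) (Z : ℝ → SRNF.Act → ℝ) (Rk : SRNF.Base → ℝ),
      -- the domain of the change of coordinates; the zone lies in its source and in its range
      (IsOpen W ∧ W ⊆ U ∧ SRNF.zone U H S c ρ μ I₁ I₂ ⊆ Set.univ ×ˢ W ∧
        SRNF.IsSymplecticChange W Φ e ∧ Set.MapsTo Φ (Set.univ ×ˢ W) (Set.univ ×ˢ U) ∧
        SRNF.zone U H S c ρ μ I₁ I₂ ⊆ Φ '' (Set.univ ×ˢ W)) ∧
      -- the transformed Hamiltonian; the energy shift comes from the extended phase space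
      (∀ x : SRNF.Base, x.2 ∈ W →
        H (Φ x).2 + R (Φ x) + e x = Hk x.2 + Z (SRNF.slow k x.1) x.2 + Rk x) ∧
      -- periodicity and regularity of the terms
      (∀ (s : ℝ) (J : SRNF.Act), J ∈ W → Z (s + (Finset.univ.gcd k : ℤ)) J = Z s J) ∧
      (∀ (φ : SRNF.Ang) (J : SRNF.Act) (l : Fin 3 → ℤ), J ∈ W →
        Rk (φ + SRNF.intVec l, J) = Rk (φ, J)) ∧
      (ContDiffOn ℝ 2 Hk W ∧ ContDiffOn ℝ 2 (fun y : ℝ × SRNF.Act => Z y.1 y.2) (Set.univ ×ˢ W) ∧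
        ContDiffOn ℝ 2 Rk (Set.univ ×ˢ W)) ∧
      -- the integrable part is unchanged, and strictly convex
      (Set.EqOn Hk H W ∧ SRNF.HessianBounds Hk W D) ∧
      -- estimates in the original variables
      SRNF.CkNormLE 2 (SRNF.onSlow k Z) (Set.univ ×ˢ W)
        (C * ρ ^ (4 / 3 * (r : ℝ) - 2 * (SRNF.mPar : ℝ))) ∧
      SRNF.CkNormLE 2 Rk (Set.univ ×ˢ W)
        (C * ρ ^ ((SRNF.qPar : ℝ) * ((r : ℝ) + 1) - 2 * (SRNF.mPar : ℝ))) ∧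
      SRNF.CkNormLE 1 (SRNF.displacement Φ e) (Set.univ ×ˢ W)
        (C * ρ ^ (2 * (r : ℝ) - 2 * (SRNF.mPar : ℝ))) ∧
      -- estimates in the rescaled variables, where the actions are centred at a double resonance
      -- and measured in units of `ρ ^ m`
      SRNF.CkNormLE 2 (SRNF.onSlow k Z ∘ SRNF.rescale (ρ ^ SRNF.mPar) I₁)
        (SRNF.rescale (ρ ^ SRNF.mPar) I₁ ⁻¹' (Set.univ ×ˢ W))
        (C * ρ ^ (4 / 3 * (r : ℝ))) ∧
      SRNF.CkNormLE 2 (Rk ∘ SRNF.rescale (ρ ^ SRNF.mPar) I₁)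
        (SRNF.rescale (ρ ^ SRNF.mPar) I₁ ⁻¹' (Set.univ ×ˢ W))
        (C * ρ ^ ((SRNF.qPar : ℝ) * ((r : ℝ) + 1))) ∧
      SRNF.CkNormLE 1 (SRNF.rescaledDisplacement (ρ ^ SRNF.mPar) I₁ Φ e)
        (SRNF.rescale (ρ ^ SRNF.mPar) I₁ ⁻¹' (Set.univ ×ˢ W))
        (C * ρ ^ ((r : ℝ) - (SRNF.mPar : ℝ) / 2)) := by
  -- `τ` only has to be small enough for the exponents of `X` to stay on the right side of the
  -- integers they are compared with
  refine ⟨1 / 1000000, by norm_num, fun τ hτ hτ1 r hr η D₀ K lam₀ c B hη hD₀ hK hlam hc hB => ?_⟩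
  have hr' : 2018 ≤ r := by
    have h : SRNF.mPar + 5 * SRNF.qPar = 2018 := by norm_num [SRNF.mPar, SRNF.thetaPar, SRNF.qPar]
    omega
  obtain ⟨Q, hQ⟩ : ∃ Q, Q + 3 = 3 * r := ⟨3 * r - 3, by omega⟩
  refine ⟨1, D₀, max 2 (SRNF.orderBound Q η D₀ K lam₀ c B), le_rfl, hD₀,
    lt_of_lt_of_le (by norm_num) (le_max_left _ _), ?_⟩
  intro U ε H R hN R₀ hR₀ n k k₁ k₂ ω ω' S I₁ I₂ ρ μ hseg hDR hρ _ hμ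
  have hR₀1 : 1 ≤ R₀ := by linarith [(le_max_left _ _).trans hR₀]
  have hX : SRNF.orderBound Q η D₀ K lam₀ c B ≤ SRNF.Rgen τ R₀ n :=
    ((le_max_right _ _).trans hR₀).trans (SRNF.le_Rgen hτ.le hR₀1 n)
  obtain ⟨D, hU⟩ := hN.scaleData hτ hτ1 hr' hQ hη hD₀ hK hlam hc hB hR₀1 rfl hX hseg hDR hρ hμ
  have hord := (SRNF.le_of_orderBound_le hη (by linarith) hK hlam hc (by linarith) hX).1
  have hρX : ρ = SRNF.Rgen τ R₀ n ^ (-(3 - 5 * τ)) := hρ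
  have hX1 : 1 ≤ SRNF.Rgen τ R₀ n := hR₀1.trans (SRNF.le_Rgen hτ.le hR₀1 n)
  generalize SRNF.Rgen τ R₀ n = X at D hU hord hρX hX1
  obtain ⟨Φ, e, ζ, Rk, g1, g2, g3, g4, g5, g6, g7, g8, g9, g10, g11⟩ :=
    SRNF.exists_normalForm_of_scaleData hr' hQ hord D
  set Z := SRNF.zoneActions U H S c ρ μ I₁ I₂ with hZ
  have hX0 : 0 < X := by linarith
  have hs0 : 0 < X ^ (-2680 : ℤ) := zpow_pos hX0 _
  have hr'' : (2018 : ℝ) ≤ r := by exact_mod_cast hr'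
  have hm : (SRNF.mPar : ℝ) = 758 := by norm_num [SRNF.mPar, SRNF.thetaPar, SRNF.qPar]
  have hq : (SRNF.qPar : ℝ) = 252 := by norm_num [SRNF.qPar]
  have hWU : Metric.thickening (X ^ (-2680 : ℤ)) Z ⊆ U :=
    (Metric.thickening_mono (by linarith) Z).trans hU
  have hWo : IsOpen (Metric.thickening (X ^ (-2680 : ℤ)) Z) := Metric.isOpen_thickening
  -- powers of `ρ` are at least powers of `X` with three times the exponent, as `ρ ≥ X ^ (-3)`
  have hpow : ∀ {z : ℤ} {y : ℝ}, 0 ≤ y → (z : ℝ) ≤ -3 * y → X ^ z ≤ 1 * ρ ^ y := by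
    intro z y hy h
    rw [one_mul, hρX]
    refine SRNF.zpow_le_rpow_rpow hX1 (h.trans ?_)
    nlinarith
  have hσ0 : 0 < ρ ^ SRNF.mPar := by
    rw [hρX]; exact pow_pos (Real.rpow_pos_of_pos hX0 _) _
  have hσ1 : ρ ^ SRNF.mPar ≤ 1 := by
    rw [hρX]
    exact pow_le_one₀ (Real.rpow_nonneg hX0.le _) (Real.rpow_le_one_of_one_le_of_nonpos hX1
      (by linarith))
  have hσX : (ρ ^ SRNF.mPar)⁻¹ ≤ X ^ (2274 : ℤ) := by
    have h1 : X ^ (-2274 : ℤ) ≤ 1 * ρ ^ (SRNF.mPar : ℝ) :=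
      hpow (by rw [hm]; norm_num) (by rw [hm]; norm_num)
    rw [one_mul, Real.rpow_natCast, zpow_neg] at h1
    exact inv_le_of_inv_le₀ (zpow_pos hX0 _) h1
  have mono : ∀ {E F : Type} [NormedAddCommGroup E] [NormedSpace ℝ E] [NormedAddCommGroup F]
      [NormedSpace ℝ F] {p : ℕ} {f : E → F} {T : Set E} {b b' : ℝ}, SRNF.CkNormLE p f T b → b ≤ b' →
      SRNF.CkNormLE p f T b' := fun h hb i hi x hx => (h i hi x hx).trans hb
  have hslow : ContDiffOn ℝ 2 (SRNF.onSlow k ζ)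
      (Set.univ ×ˢ Metric.thickening (X ^ (-2680 : ℤ)) Z) := by
    refine ContDiffOn.comp (g := fun y : ℝ × SRNF.Act => ζ y.1 y.2)
      (f := fun x : SRNF.Base => (SRNF.slow k x.1, x.2)) g7 ?_ fun x hx => ⟨Set.mem_univ _, hx.2⟩
    exact (((SRNF.contDiff_slow k).comp contDiff_fst).prodMk contDiff_snd).contDiffOn
  refine ⟨Metric.thickening (X ^ (-2680 : ℤ)) Z, Φ, e, H, ζ, Rk,
    ⟨hWo, hWU, Set.prod_mono subset_rfl (Metric.self_subset_thickening hs0 Z), g1,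
      fun x hx => ⟨Set.mem_univ _, hU (g2 x hx.2)⟩, g3⟩,
    g4, g5, g6, ⟨(hN.smooth_H.mono hWU).of_le ?_, g7, g8⟩, ⟨fun _ _ => rfl,
      fun I hI => hN.hessian_H I (hWU hI)⟩, mono g9 (hpow ?_ ?_), mono g10 (hpow ?_ ?_),
    mono g11 (hpow ?_ ?_),
    mono (SRNF.CkNormLE.comp_rescale hWo hslow g9 hσ0.le hσ1 I₁) (hpow ?_ ?_),
    mono (SRNF.CkNormLE.comp_rescale hWo g8 g10 hσ0.le hσ1 I₁) (hpow ?_ ?_),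
    mono (SRNF.ckNormLE_rescaledDisplacement hWo g1 g11 hσ0 hσ1 I₁) (le_trans ?_
      (hpow (z := 10122 - 8 * r) ?_ ?_))⟩
  · rw [SRNF.floor_order hτ hτ1 hr' hQ]
    norm_cast
    omega
  on_goal 11 =>
    calc (ρ ^ SRNF.mPar)⁻¹ * X ^ (7848 - 8 * r : ℤ)
        ≤ X ^ (2274 : ℤ) * X ^ (7848 - 8 * r : ℤ) := by gcongr
      _ = X ^ (10122 - 8 * r : ℤ) := by
        rw [← zpow_add₀ hX0.ne']
        congr 1
        ring
  all_goals
    try simp only [hm, hq]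
    push_cast
    linarith
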